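/- **Setting.** Let $U$ be a finite set with $n$ elements. A family $\mathcal F\subseteq 2^U$ is *monotone* if $U\in\mathcal F$ and every superset (in $U$) of a member of $\mathcal F$ is in $\mathcal F$. For $X\subseteq U$ and real $b\ge 0$, a set $S\subseteq U$ is a *$b$-extension* of $X$ if $X\cup S\in\mathcal F$ and $|S|\le b$. For $\alpha\ge 1$, a *random $\alpha$-extension oracle* for $(U,\mathcal F)$ is a function $\mathcal O\colon 2^U\times\mathbb N\times\{0,1\}^m\to 2^U$, for some $m\in\mathbb N$, such that $X\cup\mathcal O(X,\ell,r)\in\mathcal F$ for all $(X,\ell,r)$ and such that, for every $(X,\ell)$ for which $X$ has an $\ell$-extension, $\mathcal O(X,\ell,r)$ is an $(\alpha\ell)$-extension of $X$ for at least half of all $r\in\{0,1\}^m$. A *specification list* is a non-empty finite set $\mathcal L$ of pairs $(\alpha,c)$ of real numbers with $\alpha,c\ge 1$. An algorithm for *$\mathcal L$-subset minimization* is a randomized program (of a random access machine, with computational operations counted under the logarithmic cost criterion) which is given $U$ and, for each $(\alpha,c)\in\mathcal L$, access to a random $\alpha$-extension oracle $\mathcal O_{\alpha,c}$ for $(U,\mathcal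 F)$, where $\mathcal F$ is a monotone family that is not part of the input; each query $(X,\ell)$ is answered by $\mathcal O_{\alpha,c}(X,\ell,r)$ with a fresh uniformly random $r$. The *cost* of an execution is the number of computational operations plus the sum of $c^\ell$ over all queries $(X,\ell)$ to the oracles $\mathcal O_{\alpha,c}$. The algorithm *has cost $f$* if, for all $n$, every execution on a universe with at most $n$ elements costs at most $f(n)$. It is a *$\beta$-approximation* if, for all $U$, $\mathcal F$ and oracles, it always halts and returns a member of $\mathcal F$, and with probability at least $\tfrac12$ the returned set $S$ satisfies $|S|\le\beta\cdot\min_{T\in\mathcal F}|T|$. Define $$\mathrm{best}(\mathcal L,\beta)=\inf\{d\ge 1 : \text{there is a }\beta\text{-approximation for }\mathcal L\text{-subset minimization with cost } d^n\cdot n^{O(1)}\},$$ where $\inf\emptyset=+\infty$, the factor $n^{O(1)}$ stands for $C(n+1)^C$ with a constant $C$ that does not depend on $n$, and $\mathrm{best}(\alpha,c,\beta)=\mathrm{best}(\{(\alpha,c)\},\beta)$. Let $$\mathrm{brute}(\beta)=1+\exp\!\left(-\beta\cdot H\!\left(\tfrac1\beta\right)\right),\qquad H(x)=-x\ln x-(1-x)\ln(1-x).$$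 **Theorem.** For every real $\beta>1$ and every specification list $\mathcal L$, $$\mathrm{best}(\mathcal L,\beta)<\mathrm{brute}(\beta).$$ Moreover, for every $\alpha\ge 1$ and $\beta>1$, $$\lim_{c\to\infty}\mathrm{best}(\alpha,c,\beta)=\mathrm{brute}(\beta).$$ -/

import Mathlib

open Filter Topology

noncomputable section

namespace SubsetMin

/-! ### Monotone set systems and extension oracles

A universe with `n` elements is enumerated as `Fin n`. -/

/-- A set system is monotone if it contains the universe and is closed under supersets. -/
def IsMonotone {n : ℕ} (F : Set (Finset (Fin n))) : Prop :=
  Finset.univ ∈ F ∧ ∀ S T : Finset (Fin n), S ⊆ T → S ∈ F → T ∈ F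

/-- The minimum cardinality of a member of `F`. -/
def opt {n : ℕ} (F : Set (Finset (Fin n))) : ℕ :=
  sInf (Finset.card '' F)

/-- `S` is a `b`-extension of `X` with respect to `F` (the bound `b` may be real). -/
def IsExtension {n : ℕ} (F : Set (Finset (Fin n))) (b : ℝ) (X S : Finset (Fin n)) : Prop :=
  X ∪ S ∈ F ∧ (S.card : ℝ) ≤ b

/-- A random `α`-extension oracle for `F`: a function of the query `(X, ℓ)` and of a string of
`bits` random bits. -/
structure ExtOracle {n : ℕ} (F : Set (Finset (Fin n))) (α : ℝ) where
  bits : ℕ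
  ans : Finset (Fin n) → ℕ → (Fin bits → Bool) → Finset (Fin n)
  ans_mem : ∀ X ℓ r, X ∪ ans X ℓ r ∈ F
  ans_good : ∀ X (ℓ : ℕ), (∃ S, IsExtension F ℓ X S) →
    (1 / 2 : ℝ) * Nat.card (Fin bits → Bool) ≤
      Nat.card {r : Fin bits → Bool // IsExtension F (α * ℓ) X (ans X ℓ r)}

/-- A specification list: a non-empty finite set of pairs `(α, c)` with `α, c ≥ 1`. -/
def IsSpecList (L : Finset (ℝ × ℝ)) : Prop :=
  L.Nonempty ∧ ∀ p ∈ L, 1 ≤ p.1 ∧ 1 ≤ p.2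

/-! ### The machine model

A random access machine with registers `0, 1, 2, …` that hold natural numbers, indirect
addressing, structured control flow, fair coin flips and oracle queries. The number of
computational operations is measured by the logarithmic cost criterion: an operation costs one
plus the bit lengths of the numbers it handles. A subset of the universe is handled as the number
whose binary digits form its characteristic vector. -/

/-- The arithmetical and bitwise operations of the machine. -/
inductive Op
  | add | sub | mul | div | land | lor | shl | shr

/-- Subtraction is truncated, division is rounded down. -/
def Op.eval : Op → ℕ → ℕ → ℕ
  | .add, a, b => a + b
  | .sub, a, b => a - b
  | .mul, a, b => a * b
  | .div, a, b => a / b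
  | .land, a, b => a &&& b
  | .lor, a, b => a ||| b
  | .shl, a, b => a <<< b
  | .shr, a, b => a >>> b

/-- Programs with access to oracles that are indexed by `ι`. Below, `M i` is the content of
register `i`.
* `const z k`: `M z := k`;
* `op o z x y`: `M z := o (M x) (M y)`;
* `load z x`: `M z := M (M x)`;
* `store x y`: `M (M x) := M y`;
* `flip z`: `M z :=` a fair random bit;
* `query j z x y`: `M z :=` the answer of oracle `j` to the query `(X, ℓ)`, where `X` is the set
  coded by `M x` and `ℓ = M y`;
* `ite x p q`: run `p` if `M x ≠ 0`, otherwise `q`;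
* `loop x p`: while `M x ≠ 0`, run `p`. -/
inductive Prog (ι : Type) : Type
  | const (z k : ℕ)
  | op (o : Op) (z x y : ℕ)
  | load (z x : ℕ)
  | store (x y : ℕ)
  | flip (z : ℕ)
  | query (j : ι) (z x y : ℕ)
  | seq (p q : Prog ι)
  | ite (x : ℕ) (p q : Prog ι)
  | loop (x : ℕ) (p : Prog ι)

/-- The set whose characteristic vector is formed by the `n` lowest binary digits of `w`. -/
def decode (n w : ℕ) : Finset (Fin n) :=
  Finset.univ.filter fun i => w.testBit i = true

/-- The number whose binary digits form the characteristic vector of `S`. -/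
def encode {n : ℕ} (S : Finset (Fin n)) : ℕ :=
  ∑ i ∈ S, 2 ^ (i : ℕ)

/-- The content of the registers, and the cost of the execution so far. -/
structure Config where
  mem : ℕ → ℕ
  cost : ℝ

/-- Pay `a`. -/
def Config.pay (s : Config) (a : ℝ) : Config := ⟨s.mem, s.cost + a⟩

/-- Write `v` into register `z` and pay `a`. -/
def Config.write (s : Config) (z v : ℕ) (a : ℝ) : Config :=
  ⟨Function.update s.mem z v, s.cost + a⟩

/-- Sequential composition of random computations; `none` stands for a computation that was cut
off. -/
def andThen {A B : Type} (p : PMF (Option A)) (f : A → PMF (Option B)) : PMF (Option B) :=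
  p.bind fun o => match o with
    | none => PMF.pure none
    | some a => f a

/-- `while M x ≠ 0 do body`, cut off after `fuel` tests of the condition. -/
def runLoop (x : ℕ) (body : Config → PMF (Option Config)) : ℕ → Config → PMF (Option Config)
  | 0, _ => PMF.pure none
  | fuel + 1, s =>
    let s' := s.pay (1 + Nat.size (s.mem x))
    if s.mem x = 0 then PMF.pure (some s') else andThen (body s') (runLoop x body fuel)

/-- The distribution of the result of running a program, where every execution of a loop is cut
off after `fuel` tests of its condition. A query `(X, ℓ)` to the oracle of the pair `(α, c)`
draws a fresh uniform bit string for the oracle and costs `c ^ ℓ`, in addition to the operation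
itself. -/
def exec {n : ℕ} {L : Finset (ℝ × ℝ)} {F : Set (Finset (Fin n))}
    (O : ∀ j : L, ExtOracle F j.1.1) (fuel : ℕ) : Prog L → Config → PMF (Option Config)
  | .const z k, s => PMF.pure (some (s.write z k (1 + Nat.size k)))
  | .op o z x y, s =>
    let v := o.eval (s.mem x) (s.mem y)
    PMF.pure (some (s.write z v
      (1 + Nat.size (s.mem x) + Nat.size (s.mem y) + Nat.size v)))
  | .load z x, s =>
    let v := s.mem (s.mem x)
    PMF.pure (some (s.write z v (1 + Nat.size (s.mem x) + Nat.size v)))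
  | .store x y, s =>
    PMF.pure (some (s.write (s.mem x) (s.mem y)
      (1 + Nat.size (s.mem x) + Nat.size (s.mem y))))
  | .flip z, s =>
    (PMF.uniformOfFintype Bool).map fun b => some (s.write z b.toNat 1)
  | .query j z x y, s =>
    (PMF.uniformOfFintype (Fin (O j).bits → Bool)).map fun r =>
      let v := encode ((O j).ans (decode n (s.mem x)) (s.mem y) r)
      some (s.write z v (j.1.2 ^ s.mem y +
        (1 + Nat.size (s.mem x) + Nat.size (s.mem y) + Nat.size v)))
  | .seq p q, s => andThen (exec O fuel p s) (exec O fuel q)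
  | .ite x p q, s =>
    let s' := s.pay (1 + Nat.size (s.mem x))
    if s.mem x = 0 then exec O fuel q s' else exec O fuel p s'
  | .loop x p, s => runLoop x (exec O fuel p) fuel s

/-- At the start register `0` holds the size of the universe and all other registers hold `0`. -/
def start (n : ℕ) : Config := ⟨fun i => if i = 0 then n else 0, 0⟩

/-- The set returned by a halted program is the one coded by register `0`. -/
def output (n : ℕ) (s : Config) : Finset (Fin n) := decode n (s.mem 0)

/-- The program `A` is a randomized `β`-approximation for `L`-subset minimization: for every
universe, monotone set system and oracles, every execution halts and returns a member of the set
system, which is a `β`-approximate solution with probability at least `1 / 2`. -/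
def IsApprox (L : Finset (ℝ × ℝ)) (β : ℝ) (A : Prog L) : Prop :=
  ∀ (n : ℕ) (F : Set (Finset (Fin n))), IsMonotone F → ∀ O : (∀ j : L, ExtOracle F j.1.1),
    ∃ fuel : ℕ,
      (∀ o ∈ (exec O fuel A (start n)).support, ∃ s, o = some s ∧ output n s ∈ F) ∧
      1 / 2 ≤ (exec O fuel A (start n)).toOuterMeasure
        {o | ∃ s, o = some s ∧ ((output n s).card : ℝ) ≤ β * opt F}

/-- The program `A` has cost `f`: on a universe of at most `n` elements every execution costs at
most `f n`. -/
def HasCost (L : Finset (ℝ × ℝ)) (A : Prog L) (f : ℕ → ℝ) : Prop :=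
  ∀ n m : ℕ, m ≤ n → ∀ F : Set (Finset (Fin m)), IsMonotone F →
    ∀ O : (∀ j : L, ExtOracle F j.1.1), ∀ (fuel : ℕ) (s : Config),
      some s ∈ (exec O fuel A (start m)).support → s.cost ≤ f n

/-- The infimum (in the extended reals, so that the infimum of the empty set is `⊤`) of all
`d ≥ 1` such that there is a `β`-approximation for `L`-subset minimization with cost
`d ^ n * n ^ O(1)`. -/
def best (L : Finset (ℝ × ℝ)) (β : ℝ) : EReal :=
  sInf ((fun d : ℝ => (d : EReal)) '' {d : ℝ | 1 ≤ d ∧ ∃ A : Prog L, IsApprox L β A ∧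
    ∃ C : ℕ, HasCost L A fun n => d ^ n * (C * ((n : ℝ) + 1) ^ C)})

/-- The base of the running time of the `β`-approximate brute force. -/
def brute (β : ℝ) : ℝ := 1 + Real.exp (-β * Real.binEntropy (1 / β))

end SubsetMin

end

/-! ### Random computations with cut-offs, and monotonicity in the fuel -/

noncomputable section
namespace SubsetMin

/-! Write `B = bruteFactor β`, so that `brute β = 1 + B`. The number `B` is the maximum of `x / (1 +
x) ^ β` over `x > 0`, attained at `x = (β - 1)⁻¹`; hence `(β * k).choose k` is `B ^ (-k)` up to
polynomial factors. Hitting an unknown `k`-set with random sets of size `β * k` takes about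
`n.choose k * B ^ k` attempts, and these numbers sum to `(1 + B) ^ n` over `k`.

Lower bound. Plant a random `k`-set `P`: the family consists of the supersets of `P` and of all sets
with more than `β * k` elements. The oracle gives an answer that does not depend on `P` unless `|X|
+ ℓ ≤ β * k` and `|P \ X| ≤ ℓ`. For a given query this exception concerns at most `⌊β * k⌋₊.choose k
* (1 + 1 / c) ^ n * c ^ ℓ` of the sets `P` (`card_hits_le`), and the query costs `c ^ ℓ`. So the
number of planted sets that a run can detect is proportional to its cost, and its output can cover
only `⌊β * k⌋₊.choose k` further ones. A domination inequality, proved by induction on programs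
(`dominates_exec`), makes this rigorous for random runs without an explicit coupling. With the best
`k` it gives `best ≥ brute β / (1 + 1 / c)` (`div_le_best`), which tends to `brute β` as `c` grows.

Upper bound. One pair `(α, c)` of the list suffices. Let `M ≥ c` be an integer. Sample a set of size
about `s`, ask for an extension of size `ℓ`, and repeat this about `d ^ n / M ^ ℓ` times, for all
`s` and `ℓ`; each pair then costs `d ^ n` up to a polynomial. A trial can succeed if the sample
misses at most `ℓ` elements of an optimum of size `k` and `s + α * ℓ ≤ β * k`. The point is that
some `d < 1 + B` works for all `k` (`exists_goodParams`). If `k` is bounded or clearly exceeds the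
mode `n * B / (1 + B)`, then `n.choose k * B ^ k` is already exponentially smaller than `(1 + B) ^
n` up to a constant factor, and `ℓ = 0` works. Otherwise `n - β * k` is linear in `k`, because the
mode lies below `n / β`. With `ℓ = ⌊ε * k⌋₊` the freedom in the missing elements contributes `(n -
s).choose ℓ`, which is at least `r ^ ℓ` for any prescribed `r` once `ε` is small. This beats both
the price `M ^ ℓ` and the factor lost by shrinking `s` by `α * ℓ`.

The rest implements this scheme on the machine: a program logic with assertions about surely bounded
cost (`Spec`) and about success probability (`Pr`) is applied to an explicit program. -/

theorem tsum_option {A : Type} (f : Option A → ENNReal) :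
    ∑' o, f o = f none + ∑' a, f (some a) := by
  classical
  rw [ENNReal.summable.tsum_eq_add_tsum_ite' none]
  congr 1
  rw [← (Option.some_injective A).tsum_eq (f := fun o => ite (o = none) 0 (f o))]
  · simp
  · rintro (_ | a) ho
    · simp at ho
    · exact ⟨a, rfl⟩

@[simp] theorem andThen_pure_some {A B : Type} (a : A) (f : A → PMF (Option B)) :
    andThen (PMF.pure (some a)) f = f a := by
  simp [andThen]

theorem andThen_apply {A B : Type} (p : PMF (Option A)) (f : A → PMF (Option B)) (t : B) :
    andThen p f (some t) = ∑' a, p (some a) * f a (some t) := by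
  rw [andThen, PMF.bind_apply, tsum_option] 
  simp

theorem some_mem_support_andThen {A B : Type} {p : PMF (Option A)} {f : A → PMF (Option B)}
    {t : B} : some t ∈ (andThen p f).support ↔
      ∃ a, some a ∈ p.support ∧ some t ∈ (f a).support := by
  simp only [andThen, PMF.mem_support_bind_iff]
  constructor
  · rintro ⟨_ | a, ha, h⟩
    · simp at h
    · exact ⟨a, ha, h⟩
  · rintro ⟨a, ha, h⟩
    exact ⟨some a, ha, h⟩

theorem none_mem_support_andThen {A B : Type} {p : PMF (Option A)} {f : A → PMF (Option B)} :
    none ∈ (andThen p f).support ↔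
      none ∈ p.support ∨ ∃ a, some a ∈ p.support ∧ none ∈ (f a).support := by
  simp only [andThen, PMF.mem_support_bind_iff]
  constructor
  · rintro ⟨_ | a, ha, h⟩
    · exact Or.inl ha
    · exact Or.inr ⟨a, ha, h⟩
  · rintro (h | ⟨a, ha, h⟩)
    · exact ⟨none, h, by simp⟩
    · exact ⟨some a, ha, h⟩

theorem andThen_mono {A B : Type} {p p' : PMF (Option A)} {f f' : A → PMF (Option B)}
    (hp : ∀ a, p (some a) ≤ p' (some a)) (hf : ∀ a t, f a (some t) ≤ f' a (some t)) (t : B) :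
    andThen p f (some t) ≤ andThen p' f' (some t) := by
  simp only [andThen_apply]
  exact ENNReal.tsum_le_tsum fun a => mul_le_mul' (hp a) (hf a t)

theorem runLoop_mono (x : ℕ) {b b' : Config → PMF (Option Config)}
    (hb : ∀ s t, b s (some t) ≤ b' s (some t)) {f f' : ℕ} (hf : f ≤ f') (s t : Config) :
    runLoop x b f s (some t) ≤ runLoop x b' f' s (some t) := by
  induction f generalizing f' s t with
  | zero => simp [runLoop]
  | succ f ih =>
    obtain ⟨f', rfl⟩ : ∃ g, f' = g + 1 := ⟨f' - 1, by omega⟩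
    have hf' := Nat.le_of_succ_le_succ hf
    simp only [runLoop]
    split_ifs
    · exact le_rfl
    · exact andThen_mono (hb _) (fun a t => ih hf' a t) t

variable {n : ℕ} {L : Finset (ℝ × ℝ)} {F : Set (Finset (Fin n))}

/-- More fuel makes every proper outcome at least as likely. -/
theorem exec_mono (O : ∀ j : L, ExtOracle F j.1.1) {f f' : ℕ} (hf : f ≤ f') (p : Prog L)
    (s t : Config) : exec O f p s (some t) ≤ exec O f' p s (some t) := by
  induction p generalizing s t with
  | seq p q hp hq =>
    simp only [exec]
    exact andThen_mono (hp s) hq t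
  | ite x p q hp hq =>
    simp only [exec]
    split_ifs
    · exact hq _ t
    · exact hp _ t
  | loop x p hp => exact runLoop_mono x hp hf s t
  | _ => simp only [exec]; exact le_rfl

theorem exec_support_mono (O : ∀ j : L, ExtOracle F j.1.1) {f f' : ℕ} (hf : f ≤ f')
    (p : Prog L) {s t : Config} (h : some t ∈ (exec O f p s).support) :
    some t ∈ (exec O f' p s).support := by
  rw [PMF.mem_support_iff] at h ⊢
  exact fun h0 => h (le_antisymm (h0 ▸ exec_mono O hf p s t) zero_le)

theorem toOuterMeasure_some {A : Type} (p : PMF (Option A)) (P : A → Prop) :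
    p.toOuterMeasure {o | ∃ a, o = some a ∧ P a} =
      ∑' a, p (some a) * (Set.indicator {a | P a} 1 a) := by
  rw [PMF.toOuterMeasure_apply, tsum_option]
  have h0 : (none : Option A) ∉ {o | ∃ a, o = some a ∧ P a} := by simp
  rw [Set.indicator_of_notMem h0, zero_add]
  refine tsum_congr fun a => ?_
  by_cases ha : P a <;> simp [ha]

/-- Once a program halts surely, it does so with more fuel. -/
theorem exec_none_mono (O : ∀ j : L, ExtOracle F j.1.1) {f f' : ℕ} (hf : f ≤ f')
    (p : Prog L) (s : Config) (h : none ∉ (exec O f p s).support) :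
    none ∉ (exec O f' p s).support := by
  rw [PMF.mem_support_iff, not_not] at h ⊢
  have h1 := (exec O f p s).tsum_coe
  have h2 := (exec O f' p s).tsum_coe
  rw [tsum_option] at h1 h2
  rw [h, zero_add] at h1
  -- Proper outcomes carry all the mass with the smaller fuel and can only gain, so nothing is left
  -- for `none`.
  have h3 : 1 ≤ ∑' a, exec O f' p s (some a) :=
    h1 ▸ ENNReal.tsum_le_tsum fun a => exec_mono O hf p s a
  have h4 : exec O f' p s none + 1 ≤ 0 + 1 := by
    rw [zero_add]; exact (add_le_add le_rfl h3).trans h2.le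
  exact le_antisymm ((ENNReal.add_le_add_iff_right ENNReal.one_ne_top).1 h4) zero_le

/-! ### Expectations and domination by a blind computation -/

/-- The expectation of `φ`, where a computation that was cut off counts `v`. -/
def expect {A : Type} (D : PMF (Option A)) (v : ENNReal) (φ : A → ENNReal) : ENNReal :=
  ∑' o, D o * o.elim v φ

theorem expect_pure {A : Type} (a : A) (v : ENNReal) (φ : A → ENNReal) :
    expect (PMF.pure (some a)) v φ = φ a := by
  rw [expect, tsum_eq_single (some a)]
  · simp
  · intro b hb
    simp [hb]

theorem expect_none {A : Type} (v : ENNReal) (φ : A → ENNReal) :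
    expect (PMF.pure none) v φ = v := by
  rw [expect, tsum_eq_single none]
  · simp
  · intro b hb
    simp [hb]

theorem tsum_bind_mul {A B : Type} (p : PMF A) (f : A → PMF B) (φ : B → ENNReal) :
    ∑' b, p.bind f b * φ b = ∑' a, p a * ∑' b, f a b * φ b := by
  simp only [PMF.bind_apply, ← ENNReal.tsum_mul_right, ← ENNReal.tsum_mul_left]
  rw [ENNReal.tsum_comm]
  simp only [mul_assoc]

theorem expect_andThen {A B : Type} (p : PMF (Option A)) (f : A → PMF (Option B)) (v : ENNReal)
    (φ : B → ENNReal) :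
    expect (andThen p f) v φ = expect p v fun a => expect (f a) v φ := by
  rw [expect, andThen, tsum_bind_mul, expect]
  refine tsum_congr ?_
  rintro (_ | a)
  · congr 1
    exact expect_none v φ
  · rfl

theorem expect_bind_pure {A B : Type} (p : PMF A) (f : A → B) (v : ENNReal) (φ : B → ENNReal) :
    expect (p.map fun a => some (f a)) v φ = ∑' a, p a * φ (f a) := by
  rw [expect, PMF.map, tsum_bind_mul]
  refine tsum_congr fun a => ?_
  congr 1
  exact expect_pure (f a) v φ

theorem expect_mono {A : Type} (D : PMF (Option A)) (v : ENNReal) {φ ψ : A → ENNReal}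
    (h : ∀ a, some a ∈ D.support → φ a ≤ ψ a) : expect D v φ ≤ expect D v ψ := by
  refine ENNReal.tsum_le_tsum ?_
  rintro (_ | a)
  · exact le_rfl
  · by_cases ha : some a ∈ D.support
    · exact mul_le_mul' le_rfl (h a ha)
    · rw [PMF.mem_support_iff, not_not] at ha
      simp [ha]

theorem expect_le_of_forall {A : Type} {D : PMF (Option A)} {v b : ENNReal} {φ : A → ENNReal}
    (hD : none ∉ D.support) (h : ∀ a, some a ∈ D.support → φ a ≤ b) : expect D v φ ≤ b := by
  have h1 : expect D v φ ≤ ∑' o, D o * b := by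
    refine ENNReal.tsum_le_tsum ?_
    rintro (_ | a)
    · rw [PMF.mem_support_iff, not_not] at hD
      simp [hD]
    · by_cases ha : some a ∈ D.support
      · exact mul_le_mul' le_rfl (h a ha)
      · rw [PMF.mem_support_iff, not_not] at ha
        simp [ha]
  rwa [ENNReal.tsum_mul_right, PMF.tsum_coe, one_mul] at h1

/-- The total expected gain of a family of computations is bounded by the expected total gain
of a single one, up to `Γ` times its cost. -/
structure Dominates {ι : Type} (Γ : ENNReal) (S : Finset ι)
    (b : ι → Config → PMF (Option Config)) (b₀ : Config → PMF (Option Config)) : Prop where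
  -- Being cut off counts `0` on the left and `⊤` on the right, so exhausted fuel makes the
  -- inequality trivial. The gains are arbitrary functions bounded by one: in a sequential
  -- composition they become the expected gains of the second program.
  le : ∀ g : ι → Config → ENNReal, (∀ i s, g i s ≤ 1) → ∀ s : Config, 0 ≤ s.cost →
    ∑ i ∈ S, expect (b i s) 0 (g i) + Γ * ENNReal.ofReal s.cost ≤
      expect (b₀ s) ⊤ fun t => ∑ i ∈ S, g i t + Γ * ENNReal.ofReal t.cost
  cost : ∀ s t : Config, 0 ≤ s.cost → some t ∈ (b₀ s).support → 0 ≤ t.cost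

theorem expect_le_one {A : Type} (D : PMF (Option A)) {φ : A → ENNReal} (h : ∀ a, φ a ≤ 1) :
    expect D 0 φ ≤ 1 := by
  have h1 : expect D 0 φ ≤ ∑' o, D o * 1 := by
    refine ENNReal.tsum_le_tsum ?_
    rintro (_ | a)
    · simp
    · exact mul_le_mul' le_rfl (h a)
  rwa [ENNReal.tsum_mul_right, PMF.tsum_coe, one_mul] at h1

variable {ι : Type} {Γ : ENNReal} {S : Finset ι}

theorem dominates_pure {f : Config → Config} (hf : ∀ s, s.cost ≤ (f s).cost) :
    Dominates Γ S (fun _ s => PMF.pure (some (f s))) (fun s => PMF.pure (some (f s))) where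
  le g hg s hs := by
    simp only [expect_pure]
    gcongr
    exact hf s
  cost s t hs ht := by
    simp only [PMF.support_pure, Set.mem_singleton_iff, Option.some.injEq] at ht
    exact ht ▸ hs.trans (hf s)

theorem dominates_andThen {b b' : ι → Config → PMF (Option Config)}
    {b₀ b₀' : Config → PMF (Option Config)} (h : Dominates Γ S b b₀)
    (h' : Dominates Γ S b' b₀') :
    Dominates Γ S (fun i s => andThen (b i s) (b' i)) (fun s => andThen (b₀ s) b₀') where
  le g hg s hs := by
    simp only [expect_andThen]
    refine (h.le (fun i a => expect (b' i a) 0 (g i))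
      (fun i a => expect_le_one _ (hg i)) s hs).trans ?_
    exact expect_mono _ _ fun a ha => h'.le g hg a (h.cost s a hs ha)
  cost s t hs ht := by
    obtain ⟨a, ha, hat⟩ := some_mem_support_andThen.1 ht
    exact h'.cost a t (h.cost s a hs ha) hat

theorem dominates_ite {b b' : ι → Config → PMF (Option Config)}
    {b₀ b₀' : Config → PMF (Option Config)} (h : Dominates Γ S b b₀)
    (h' : Dominates Γ S b' b₀') (P : Config → Prop) [DecidablePred P] :
    Dominates Γ S (fun i s => if P s then b i s else b' i s)
      (fun s => if P s then b₀ s else b₀' s) where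
  le g hg s hs := by
    by_cases hP : P s
    · simpa [hP] using h.le g hg s hs
    · simpa [hP] using h'.le g hg s hs
  cost s t hs ht := by
    by_cases hP : P s
    · exact h.cost s t hs (by simpa [hP] using ht)
    · exact h'.cost s t hs (by simpa [hP] using ht)

theorem dominates_comp {b : ι → Config → PMF (Option Config)}
    {b₀ : Config → PMF (Option Config)} (h : Dominates Γ S b b₀) {f : Config → Config}
    (hf : ∀ s, s.cost ≤ (f s).cost) :
    Dominates Γ S (fun i s => b i (f s)) (fun s => b₀ (f s)) := by
  have := dominates_andThen (dominates_pure (Γ := Γ) (S := S) hf) h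
  simpa only [andThen_pure_some] using this

theorem pay_le {a : ℝ} (ha : 0 ≤ a) (s : Config) : s.cost ≤ (s.pay a).cost := by
  simp [Config.pay, ha]

theorem dominates_runLoop {b : ι → Config → PMF (Option Config)}
    {b₀ : Config → PMF (Option Config)} (h : Dominates Γ S b b₀) (x fuel : ℕ) :
    Dominates Γ S (fun i => runLoop x (b i) fuel) (runLoop x b₀ fuel) := by
  have hp : ∀ s : Config, s.cost ≤ (s.pay (1 + Nat.size (s.mem x))).cost :=
    fun s => pay_le (by positivity) s
  induction fuel with
  | zero =>
    constructor
    · intro g hg s hs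
      simp [runLoop, expect_none]
    · intro s t hs ht
      simp [runLoop] at ht
  | succ fuel ih =>
    exact dominates_ite (dominates_pure hp) (dominates_comp (dominates_andThen h ih) hp)
      (fun s => s.mem x = 0)

theorem dominates_random {A : Type} (p : PMF A) {f : A → Config → Config}
    (hf : ∀ a s, s.cost ≤ (f a s).cost) :
    Dominates Γ S (fun _ s => p.map fun a => some (f a s)) (fun s => p.map fun a => some (f a s))
    where
  le g hg s hs := by
    simp only [expect_bind_pure]
    rw [← Summable.tsum_finsetSum (fun _ _ => ENNReal.summable)]
    have h1 : Γ * ENNReal.ofReal s.cost = ∑' a, p a * (Γ * ENNReal.ofReal s.cost) := by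
      rw [ENNReal.tsum_mul_right, PMF.tsum_coe, one_mul]
    rw [h1, ← ENNReal.tsum_add]
    refine ENNReal.tsum_le_tsum fun a => ?_
    rw [← Finset.mul_sum, ← mul_add]
    gcongr
    exact hf a s
  cost s t hs ht := by
    simp only [PMF.support_map, Set.mem_image, Option.some.injEq] at ht
    obtain ⟨a, -, rfl⟩ := ht
    exact hs.trans (hf a s)

open Classical in
/-- A step whose result for `i` differs from the blind one for few `i` only. -/
theorem dominates_of_few {f : ι → Config → Config} {f₀ : Config → Config}
    (hc : ∀ s, s.cost ≤ (f₀ s).cost)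
    (h : ∀ s, ((S.filter fun i => f i s ≠ f₀ s).card : ENNReal) ≤
      Γ * ENNReal.ofReal ((f₀ s).cost - s.cost)) :
    Dominates Γ S (fun i s => PMF.pure (some (f i s))) (fun s => PMF.pure (some (f₀ s))) where
  le g hg s hs := by
    simp only [expect_pure]
    -- An index with a different answer is given up: its gain is at most one, and the increase of
    -- the blind cost pays for it.
    have h1 : ∑ i ∈ S, g i (f i s) ≤ ∑ i ∈ S, g i (f₀ s) +
        ((S.filter fun i => f i s ≠ f₀ s).card : ENNReal) := by
      rw [Finset.card_filter, Nat.cast_sum, ← Finset.sum_add_distrib]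
      refine Finset.sum_le_sum fun i _ => ?_
      by_cases hi : f i s = f₀ s
      · simp [hi]
      · simp only [ne_eq, hi, not_false_eq_true, if_true, Nat.cast_one]
        exact (hg _ _).trans le_add_self
    have h2 : ENNReal.ofReal (f₀ s).cost =
        ENNReal.ofReal ((f₀ s).cost - s.cost) + ENNReal.ofReal s.cost := by
      rw [← ENNReal.ofReal_add (sub_nonneg.2 (hc s)) hs, sub_add_cancel]
    rw [h2, mul_add, ← add_assoc]
    exact add_le_add (h1.trans (add_le_add le_rfl (h s))) le_rfl
  cost s t hs ht := by
    simp only [PMF.support_pure, Set.mem_singleton_iff, Option.some.injEq] at ht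
    exact ht ▸ hs.trans (hc s)

/-- If the answers of oracles depend deterministically on the query, and at each query only few
of them differ from the blind answer, then every program is dominated by its blind run. -/
theorem dominates_exec {n : ℕ} {L : Finset (ℝ × ℝ)} (hL : ∀ j ∈ L, 1 ≤ j.2)
    {F : ι → Set (Finset (Fin n))}
    {F₀ : Set (Finset (Fin n))} (O : ∀ i, ∀ j : L, ExtOracle (F i) j.1.1)
    (O₀ : ∀ j : L, ExtOracle F₀ j.1.1)
    (a : ι → L → Finset (Fin n) → ℕ → Finset (Fin n))
    (a₀ : L → Finset (Fin n) → ℕ → Finset (Fin n))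
    (ha : ∀ i j X ℓ r, (O i j).ans X ℓ r = a i j X ℓ) (ha₀ : ∀ j X ℓ r, (O₀ j).ans X ℓ r = a₀ j X ℓ)
    (h : ∀ j X ℓ, ((S.filter fun i => a i j X ℓ ≠ a₀ j X ℓ).card : ENNReal) ≤
      Γ * ENNReal.ofReal (j.1.2 ^ ℓ)) (fuel : ℕ) (p : Prog L) :
    Dominates Γ S (fun i => exec (O i) fuel p) (exec O₀ fuel p) := by
  have hw : ∀ (s : Config) (z v : ℕ) {x : ℝ}, 0 ≤ x → s.cost ≤ (s.write z v x).cost := by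
    intro s z v x hx
    simp [Config.write, hx]
  induction p with
  | const z k => exact dominates_pure fun s => hw _ _ _ (by positivity)
  | op o z x y => exact dominates_pure fun s => hw _ _ _ (by positivity)
  | load z x => exact dominates_pure fun s => hw _ _ _ (by positivity)
  | store x y => exact dominates_pure fun s => hw _ _ _ (by positivity)
  | flip z =>
    exact dominates_random (PMF.uniformOfFintype Bool) fun b s => hw _ _ _ (by norm_num)
  | query j z x y =>
    have hc : (0 : ℝ) ≤ j.1.2 := zero_le_one.trans (hL j.1 j.2)
    let w (v : Finset (Fin n)) (s : Config) : Config :=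
      s.write z (encode v) (j.1.2 ^ s.mem y +
        (1 + Nat.size (s.mem x) + Nat.size (s.mem y) + Nat.size (encode v)))
    -- The answers ignore the random string, so drawing one leaves a point mass.
    have hmap : ∀ {A : Type} [Fintype A] [Nonempty A] (o : Option Config),
        (PMF.uniformOfFintype A).map (fun _ => o) = PMF.pure o := fun o => PMF.map_const _ _
    have key := dominates_of_few (Γ := Γ) (S := S)
      (f := fun i s => w (a i j (decode n (s.mem x)) (s.mem y)) s)
      (f₀ := fun s => w (a₀ j (decode n (s.mem x)) (s.mem y)) s)
      (fun s => hw _ _ _ (by positivity)) ?_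
    · convert key using 3 with i s s
      · simp only [exec, ha, hmap, w]
      · simp only [exec, ha₀, hmap, w]
    · intro s
      refine le_trans ?_ ((h j (decode n (s.mem x)) (s.mem y)).trans ?_)
      · refine (Nat.cast_le (α := ENNReal)).2 (Finset.card_le_card ?_)
        intro i
        simp only [Finset.mem_filter]
        rintro ⟨hi, hne⟩
        exact ⟨hi, fun he => hne (by rw [he])⟩
      · gcongr
        simp only [w, Config.write, add_sub_cancel_left]
        have : (0 : ℝ) ≤ 1 + Nat.size (s.mem x) + Nat.size (s.mem y) +
          Nat.size (encode (a₀ j (decode n (s.mem x)) (s.mem y))) := by positivity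
        linarith
  | seq p q hp hq => exact dominates_andThen hp hq
  | ite x p q hp hq =>
    have hp' : ∀ s : Config, s.cost ≤ (s.pay (1 + Nat.size (s.mem x))).cost :=
      fun s => pay_le (by positivity) s
    exact dominates_ite (dominates_comp hq hp') (dominates_comp hp hp') (fun s => s.mem x = 0)
  | loop x p hp => exact dominates_runLoop hp x fuel

/-! ### Planted solutions -/

/-- A set belongs to the planted family if it contains one of the sets in `P` or is large. -/
def planted {n : ℕ} (b : ℝ) (P : Finset (Fin n)) : Set (Finset (Fin n)) :=
  {T | P ⊆ T ∨ b < T.card}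

theorem planted_isMonotone {n : ℕ} (b : ℝ) (P : Finset (Fin n)) : IsMonotone (planted b P) := by
  refine ⟨Or.inl (Finset.subset_univ P), ?_⟩
  rintro S T hST (h | h)
  · exact Or.inl (h.trans hST)
  · exact Or.inr (h.trans_le (by exact_mod_cast Finset.card_le_card hST))

theorem opt_planted_le {n : ℕ} (b : ℝ) (P : Finset (Fin n)) : opt (planted b P) ≤ P.card :=
  Nat.sInf_le ⟨P, Or.inl subset_rfl, rfl⟩

theorem exists_fill {n : ℕ} (X : Finset (Fin n)) (ℓ : ℕ) :
    ∃ W : Finset (Fin n), W ⊆ Xᶜ ∧ W.card = min ℓ Xᶜ.card :=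
  Finset.exists_subset_card_eq (min_le_right _ _)

/-- A set of at most `ℓ` elements that is disjoint from `X`, and as large as possible. -/
def fill {n : ℕ} (X : Finset (Fin n)) (ℓ : ℕ) : Finset (Fin n) := (exists_fill X ℓ).choose

/-- The answer that does not depend on the planted set. -/
def blindAns {n : ℕ} (b : ℝ) (X : Finset (Fin n)) (ℓ : ℕ) : Finset (Fin n) :=
  open Classical in if b < X.card + ℓ then fill X ℓ else Xᶜ

/-- The answer that reveals the planted set `P` only if the query cannot be answered otherwise. -/
def plantedAns {n : ℕ} (b : ℝ) (P X : Finset (Fin n)) (ℓ : ℕ) : Finset (Fin n) :=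
  open Classical in if (X.card + ℓ : ℝ) ≤ b ∧ (P \ X).card ≤ ℓ then P \ X else blindAns b X ℓ

/-- If `b < |X| + ℓ`, then adding `ℓ` new elements makes the set large, unless fewer than `ℓ` remain
and all of them are added. Otherwise the answer is the whole complement. -/
theorem union_blindAns {n : ℕ} (b : ℝ) (X : Finset (Fin n)) (ℓ : ℕ) :
    X ∪ blindAns b X ℓ = Finset.univ ∨ b < (X ∪ blindAns b X ℓ).card := by
  obtain ⟨h1, h2⟩ := (exists_fill X ℓ).choose_spec
  unfold blindAns
  split_ifs with h
  · change fill X ℓ ⊆ Xᶜ at h1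
    change (fill X ℓ).card = _ at h2
    rcases le_total ℓ Xᶜ.card with hl | hl
    · right
      rw [Finset.card_union_of_disjoint (Finset.disjoint_left.2 fun a ha hb =>
        Finset.mem_compl.1 (h1 hb) ha), h2, min_eq_left hl]
      exact_mod_cast h
    · left
      rw [min_eq_right hl] at h2
      rw [Finset.eq_of_subset_of_card_le h1 h2.ge]
      simp
  · left
    simp

theorem card_blindAns_le {n : ℕ} {b : ℝ} {X : Finset (Fin n)} {ℓ : ℕ} (h : b < X.card + ℓ) :
    (blindAns b X ℓ).card ≤ ℓ := by
  rw [blindAns, if_pos h]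
  exact (exists_fill X ℓ).choose_spec.2.trans_le (min_le_left _ _)

theorem union_plantedAns {n : ℕ} (b : ℝ) (P X : Finset (Fin n)) (ℓ : ℕ) :
    X ∪ plantedAns b P X ℓ ∈ planted b P := by
  unfold plantedAns
  split_ifs with h
  · left
    simp
  · rcases union_blindAns b X ℓ with h | h
    · left
      rw [h]
      exact Finset.subset_univ _
    · exact Or.inr h

/-- The only expensive blind answer is `Xᶜ`, given when `|X| + ℓ ≤ b`. Then an `ℓ`-extension `S`
cannot make `X ∪ S` large, so `X ∪ S` contains `P`; hence `P \ X ⊆ S` is small and the first branch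
applies. -/
theorem card_plantedAns_le {n : ℕ} {b : ℝ} {P X : Finset (Fin n)} {ℓ : ℕ}
    (h : ∃ S, IsExtension (planted b P) ℓ X S) : (plantedAns b P X ℓ).card ≤ ℓ := by
  obtain ⟨S, hS, hc⟩ := h
  have hc : S.card ≤ ℓ := by exact_mod_cast hc
  unfold plantedAns
  split_ifs with hh
  · exact hh.2
  · refine card_blindAns_le ?_
    by_contra! hb
    refine hh ⟨hb, ?_⟩
    rcases hS with hS | hS
    · refine le_trans (Finset.card_le_card ?_) hc
      intro a ha
      rw [Finset.mem_sdiff] at ha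
      exact (Finset.mem_union.1 (hS ha.1)).resolve_left ha.2
    · have := Finset.card_union_le X S
      have : ((X ∪ S).card : ℝ) ≤ X.card + ℓ := by exact_mod_cast this.trans (by omega)
      linarith

/-- The oracle for a planted set. -/
def plantedOracle {n : ℕ} (b : ℝ) (P : Finset (Fin n)) {α : ℝ} (hα : 1 ≤ α) :
    ExtOracle (planted b P) α where
  bits := 0
  ans X ℓ _ := plantedAns b P X ℓ
  ans_mem X ℓ _ := union_plantedAns b P X ℓ
  ans_good X ℓ h := by
    have h1 : IsExtension (planted b P) (α * ℓ) X (plantedAns b P X ℓ) := by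
      refine ⟨union_plantedAns b P X ℓ, ?_⟩
      have h2 : ((plantedAns b P X ℓ).card : ℝ) ≤ ℓ := by exact_mod_cast card_plantedAns_le h
      nlinarith [(Nat.cast_nonneg ℓ : (0 : ℝ) ≤ ℓ)]
    simp [h1]
    norm_num

/-- The oracle for the whole universe as planted set, which gives the blind answers. -/
theorem plantedAns_univ {n : ℕ} (b : ℝ) (X : Finset (Fin n)) (ℓ : ℕ) :
    plantedAns b Finset.univ X ℓ = blindAns b X ℓ := by
  unfold plantedAns
  split_ifs with h
  · rw [blindAns, if_neg (not_lt.2 h.1)]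
    ext a
    simp
  · rfl

/-- Weigh each `J` by `c ^ (-|J|)`. The total weight is `(1 + 1 / c) ^ n`, and every counted `J` has
weight at least `c ^ (-ℓ)`. This is how the price `c ^ ℓ` of a query enters the lower bound. -/
theorem sum_small_subsets_le {n : ℕ} {c : ℝ} (hc : 1 ≤ c) (ℓ : ℕ) :
    (((Finset.univ : Finset (Finset (Fin n))).filter fun J => J.card ≤ ℓ).card : ℝ) ≤
      c ^ ℓ * (1 + 1 / c) ^ n := by
  have hc0 : 0 < c := by linarith
  have h1 : (1 + 1 / c) ^ n = ∑ J : Finset (Fin n), (1 / c) ^ J.card := by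
    have := Finset.sum_pow_mul_eq_add_pow (1 / c) 1 (Finset.univ : Finset (Fin n))
    simp only [one_pow, mul_one, Finset.powerset_univ, Finset.card_univ, Fintype.card_fin] at this
    rw [this, add_comm]
  rw [h1, Finset.mul_sum, Finset.card_eq_sum_ones, Nat.cast_sum]
  refine (Finset.sum_le_sum fun J hJ => ?_).trans
    (Finset.sum_le_univ_sum_of_nonneg (fun J => by positivity))
  have hJ : J.card ≤ ℓ := (Finset.mem_filter.1 hJ).2
  rw [one_div, inv_pow, ← div_eq_mul_inv, Nat.cast_one, le_div_iff₀ (by positivity), one_mul]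
  exact pow_le_pow_right₀ hc hJ

/-- Few sets of a given size are contained in a given small set up to few elements. -/
theorem card_hits_le {n : ℕ} (k m ℓ : ℕ) {c : ℝ} (hc : 1 ≤ c) {X : Finset (Fin n)}
    (hX : X.card + ℓ ≤ m) :
    (((Finset.univ.powersetCard k).filter fun P => (P \ X).card ≤ ℓ).card : ℝ) ≤
      m.choose k * (1 + 1 / c) ^ n * c ^ ℓ := by
  -- Classify `P` by the part `J = P \ X` outside `X`; then `P` is a `k`-subset of `X ∪ J`, which
  -- has at most `m` elements.
  have h1 : ((Finset.univ.powersetCard k).filter fun P => (P \ X).card ≤ ℓ) ⊆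
      ((Finset.univ : Finset (Finset (Fin n))).filter fun J => J.card ≤ ℓ).biUnion
        fun J => (X ∪ J).powersetCard k := by
    intro P hP
    simp only [Finset.mem_filter, Finset.mem_powersetCard] at hP
    simp only [Finset.mem_biUnion, Finset.mem_filter, Finset.mem_univ, true_and,
      Finset.mem_powersetCard]
    refine ⟨P \ X, hP.2, ?_, hP.1.2⟩
    intro a ha
    by_cases h : a ∈ X <;> simp [ha, h]
  have h2 := (Finset.card_le_card h1).trans (Finset.card_biUnion_le_card_mul _ _ (m.choose k) ?_)
  · have h3 : (((Finset.univ.powersetCard k).filter fun P => (P \ X).card ≤ ℓ).card : ℝ) ≤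
        (((Finset.univ : Finset (Finset (Fin n))).filter fun J => J.card ≤ ℓ).card : ℝ) *
          m.choose k := by exact_mod_cast h2
    refine h3.trans ?_
    have := mul_le_mul_of_nonneg_right (sum_small_subsets_le (n := n) hc ℓ)
      (Nat.cast_nonneg (α := ℝ) (m.choose k))
    linarith
  · intro J hJ
    have hJ := (Finset.mem_filter.1 hJ).2
    rw [Finset.card_powersetCard]
    exact Nat.choose_le_choose k ((Finset.card_union_le X J).trans (by omega))

/-- A cost bound of a `β`-approximation is at least about the ratio of two binomial coefficients. -/
theorem choose_le_of_isApprox {α β c : ℝ} (hα : 1 ≤ α) (hβ : 1 < β) (hc : 1 ≤ c)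
    {A : Prog ({(α, c)} : Finset (ℝ × ℝ))} (hA : IsApprox {(α, c)} β A) {f : ℕ → ℝ}
    (hf : HasCost {(α, c)} A f) (n k : ℕ) :
    (n.choose k : ℝ) ≤ 2 * (⌊β * k⌋₊.choose k * (1 + (1 + 1 / c) ^ n * max (f n) 0)) := by
  classical
  set b : ℝ := β * k with hb
  have hb0 : 0 ≤ b := by positivity
  set m := ⌊b⌋₊ with hm
  have hj : ∀ j : ({(α, c)} : Finset (ℝ × ℝ)), j.1 = (α, c) := fun j => Finset.mem_singleton.1 j.2
  have hjα : ∀ j : ({(α, c)} : Finset (ℝ × ℝ)), 1 ≤ j.1.1 := fun j => by rw [hj j]; exact hα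
  let O (P : Finset (Fin n)) (j : ({(α, c)} : Finset (ℝ × ℝ))) :
      ExtOracle (planted b P) j.1.1 := plantedOracle b P (hjα j)
  have hO := fun P => hA n (planted b P) (planted_isMonotone b P) (O P)
  choose fuel hsupp hprob using hO
  -- There are finitely many `P`, so one fuel makes all runs halt, including the blind one, which is
  -- the run for `P = Finset.univ`.
  obtain ⟨F, hF⟩ : ∃ F, ∀ P, fuel P ≤ F := ⟨Finset.univ.sup fuel, fun P =>
    Finset.le_sup (Finset.mem_univ P)⟩
  have hnone : ∀ P, none ∉ (exec (O P) F A (start n)).support := fun P =>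
    exec_none_mono _ (hF P) _ _ fun h => by
      obtain ⟨s, hs, -⟩ := hsupp P none h
      exact absurd hs (by simp)
  set Γ : ENNReal := ENNReal.ofReal (m.choose k * (1 + 1 / c) ^ n) with hΓ
  set S : Finset (Finset (Fin n)) := Finset.univ.powersetCard k with hS
  have hdom := dominates_exec (Γ := Γ) (S := S) (L := {(α, c)})
    (fun j hj => by rw [Finset.mem_singleton.1 hj]; exact hc)
    O (O Finset.univ) (fun P _ X ℓ => plantedAns b P X ℓ) (fun _ X ℓ => blindAns b X ℓ)
    (fun _ _ _ _ _ => rfl) (fun _ X ℓ _ => plantedAns_univ b X ℓ) ?_ F A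
  -- The gain of `P` is one if the output reveals it: a member of the planted family with at most
  -- `b` elements must contain `P`.
  · let g (P : Finset (Fin n)) (s : Config) : ENNReal :=
      if P ⊆ output n s ∧ ((output n s).card : ℝ) ≤ b then 1 else 0
    have h1 := hdom.le g (fun P s => by dsimp only [g]; split_ifs <;> simp) (start n) le_rfl
    have h2 : ∀ P ∈ S, 1 / 2 ≤ expect (exec (O P) F A (start n)) 0 (g P) := by
      intro P hP
      have hPk : P.card = k := (Finset.mem_powersetCard.1 hP).2
      refine (hprob P).trans ?_
      rw [toOuterMeasure_some]
      rw [expect, tsum_option]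
      simp only [Option.elim, mul_zero, zero_add]
      refine ENNReal.tsum_le_tsum fun s => ?_
      by_cases hs : some s ∈ (exec (O P) (fuel P) A (start n)).support
      · refine mul_le_mul' (exec_mono _ (hF P) _ _ _) ?_
        by_cases hs' : ((output n s).card : ℝ) ≤ β * opt (planted b P)
        · have hle : ((output n s).card : ℝ) ≤ b := by
            refine hs'.trans (mul_le_mul_of_nonneg_left ?_ (by linarith))
            exact_mod_cast hPk ▸ opt_planted_le b P
          have hsub : P ⊆ output n s := by
            obtain ⟨s', hss, hmem⟩ := hsupp P _ hs
            obtain rfl := Option.some.inj hss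
            exact hmem.resolve_right (not_lt.2 hle)
          simp [g, hle, hsub, hs']
        · simp [hs']
      · rw [PMF.mem_support_iff, not_not] at hs
        simp [hs]
    -- In the blind run a single output collects the gains of all `P`, but a set of at most `m`
    -- elements has at most `m.choose k` subsets of size `k`.
    have h3 : ∀ s, ∑ P ∈ S, g P s ≤ (m.choose k : ENNReal) := by
      intro s
      by_cases hs : ((output n s).card : ℝ) ≤ b
      · have h4 : ∑ P ∈ S, g P s = ((S.filter fun P => P ⊆ output n s).card : ENNReal) := by
          rw [Finset.card_filter, Nat.cast_sum]
          refine Finset.sum_congr rfl fun P _ => ?_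
          by_cases hP : P ⊆ output n s <;> simp [g, hP, hs]
        rw [h4]
        refine Nat.cast_le.2 ((Finset.card_le_card (t := (output n s).powersetCard k) ?_).trans ?_)
        · intro P hP
          simp only [hS, Finset.mem_filter, Finset.mem_powersetCard] at hP ⊢
          exact ⟨hP.2, hP.1.2⟩
        · rw [Finset.card_powersetCard]
          exact Nat.choose_le_choose k (Nat.le_floor hs)
      · simp [g, hs]
    have h5 : expect (exec (O Finset.univ) F A (start n)) ⊤
        (fun t => ∑ P ∈ S, g P t + Γ * ENNReal.ofReal t.cost) ≤
        (m.choose k : ENNReal) + Γ * ENNReal.ofReal (max (f n) 0) := by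
      refine expect_le_of_forall (hnone _) fun s hs => ?_
      gcongr
      · exact h3 s
      · exact (hf n n le_rfl _ (planted_isMonotone b _) _ F s hs).trans (le_max_left _ _)
    have h6 : (n.choose k : ENNReal) * (1 / 2) ≤
        (m.choose k : ENNReal) + Γ * ENNReal.ofReal (max (f n) 0) := by
      refine le_trans ?_ ((le_self_add.trans h1).trans h5)
      have := Finset.sum_le_sum h2
      rwa [Finset.sum_const, hS, Finset.card_powersetCard, Finset.card_univ, Fintype.card_fin,
        nsmul_eq_mul] at this
    have hc' : 0 < c := by linarith
    have h7 : (n.choose k : ℝ) * (1 / 2) ≤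
        m.choose k + m.choose k * (1 + 1 / c) ^ n * max (f n) 0 := by
      rw [hΓ, ← ENNReal.ofReal_mul (by positivity), ← ENNReal.ofReal_natCast,
        ← ENNReal.ofReal_natCast, ← ENNReal.ofReal_add (by positivity) (by positivity),
        show (1 / 2 : ENNReal) = ENNReal.ofReal (1 / 2) by
          rw [ENNReal.ofReal_div_of_pos (by norm_num)]; simp,
        ← ENNReal.ofReal_mul (by positivity)] at h6
      exact (ENNReal.ofReal_le_ofReal_iff (by positivity)).1 h6
    linarith
  -- If `|X| + ℓ > b`, all answers are blind. Otherwise they differ only for the `P` that `X`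
  -- contains up to `ℓ` elements.
  · intro j X ℓ
    rw [show j.1.2 = c by rw [hj j]]
    by_cases hX : (X.card + ℓ : ℝ) ≤ b
    · have hX' : X.card + ℓ ≤ m := Nat.le_floor (by exact_mod_cast hX)
      have h1 := card_hits_le (n := n) k m ℓ hc hX'
      rw [hΓ, ← ENNReal.ofReal_mul (by positivity), ← ENNReal.ofReal_natCast]
      refine ENNReal.ofReal_le_ofReal (le_trans (Nat.cast_le.2 (Finset.card_le_card ?_)) h1)
      intro P hP
      simp only [Finset.mem_filter] at hP ⊢
      refine ⟨hP.1, ?_⟩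
      by_contra hn
      exact hP.2 (if_neg fun h => hn h.2)
    · rw [Finset.filter_false_of_mem]
      · simp
      · intro P _
        rw [not_not]
        exact if_neg fun h => hX h.1

/-! ### The base of the brute force -/

/-- The factor of an element of an optimal solution in the running time of the brute force. -/
def bruteFactor (β : ℝ) : ℝ := Real.exp (-β * Real.binEntropy (1 / β))

theorem bruteFactor_pos (β : ℝ) : 0 < bruteFactor β := Real.exp_pos _

/-- The right-hand side is the value of `x / (1 + x) ^ β` at its maximiser `x = (β - 1)⁻¹`. In this
form the factor can be compared with terms of binomial expansions. -/
theorem bruteFactor_eq {β : ℝ} (hβ : 1 < β) :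
    bruteFactor β = (β - 1)⁻¹ * (1 + (β - 1)⁻¹) ^ (-β) := by
  have h0 : 0 < β := by linarith
  have h1 : 0 < β - 1 := by linarith
  have h2 : 1 + (β - 1)⁻¹ = β * (β - 1)⁻¹ := by field_simp; ring
  have h3 : 1 - 1 / β = (β - 1) * β⁻¹ := by field_simp
  rw [bruteFactor, h2, Real.rpow_def_of_pos (by positivity), ← Real.exp_log (inv_pos.2 h1),
    ← Real.exp_add, Real.exp_log (inv_pos.2 h1), Real.binEntropy, h3,
    Real.log_inv, Real.log_inv, Real.log_mul (by positivity) (by positivity),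
    Real.log_mul (by positivity) (by positivity), one_div, Real.log_inv, Real.log_inv]
  congr 1
  field_simp
  ring

theorem choose_mul_pow_le (m k : ℕ) {x : ℝ} (hx : 0 ≤ x) : m.choose k * x ^ k ≤ (1 + x) ^ m := by
  rcases le_or_gt k m with h | h
  · rw [add_comm, add_pow]
    refine le_trans (le_of_eq ?_) (Finset.single_le_sum
      (f := fun i => x ^ i * 1 ^ (m - i) * (m.choose i : ℝ)) (fun i _ => by positivity)
      (Finset.mem_range.2 (Nat.lt_succ_of_le h)))
    simp
    ring
  · rw [Nat.choose_eq_zero_of_lt h]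
    simp
    positivity

/-- This is `choose_mul_pow_le` at the maximiser `x = (β - 1)⁻¹`; rounding `β * k` down only helps.
-/
theorem choose_floor_le {β : ℝ} (hβ : 1 < β) (k : ℕ) :
    (⌊β * k⌋₊.choose k : ℝ) * bruteFactor β ^ k ≤ 1 := by
  have h1 : 0 < β - 1 := by linarith
  have hx : 0 < (β - 1)⁻¹ := inv_pos.2 h1
  have h2 := choose_mul_pow_le ⌊β * k⌋₊ k hx.le
  have h3 : (1 + (β - 1)⁻¹) ^ ⌊β * k⌋₊ ≤ (1 + (β - 1)⁻¹) ^ (β * k) := by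
    rw [← Real.rpow_natCast]
    exact Real.rpow_le_rpow_of_exponent_le (by linarith) (Nat.floor_le (by positivity))
  rw [bruteFactor_eq hβ, mul_pow, ← Real.rpow_natCast ((1 + (β - 1)⁻¹) ^ (-β)), ← Real.rpow_mul
    (by positivity), ← mul_assoc]
  calc _ ≤ (1 + (β - 1)⁻¹) ^ (β * k) * (1 + (β - 1)⁻¹) ^ (-β * k) := by
        gcongr
        exact h2.trans h3
    _ = 1 := by
        rw [← Real.rpow_add (by positivity)]
        simp

/-- The expansion of `(1 + bruteFactor β) ^ n` has `n + 1` terms, so one of them is at least the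
average; `choose_floor_le` then bounds the power of `bruteFactor β` in it by the inverse of a
binomial coefficient. -/
theorem exists_brute_pow_le {β : ℝ} (hβ : 1 < β) (n : ℕ) :
    ∃ k : ℕ, brute β ^ n * ⌊β * k⌋₊.choose k ≤ (n + 1) * n.choose k := by
  by_contra! h
  have h1 : brute β ^ n = ∑ k ∈ Finset.range (n + 1), bruteFactor β ^ k * n.choose k := by
    rw [brute, add_comm, add_pow]
    simp [bruteFactor]
  have h2 : ∀ k ∈ Finset.range (n + 1), (n + 1) * (bruteFactor β ^ k * n.choose k) <
      brute β ^ n := by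
    intro k _
    have h3 : 0 < bruteFactor β ^ k := pow_pos (bruteFactor_pos β) k
    have h4 := mul_lt_mul_of_pos_right (h k) h3
    have h5 := mul_le_mul_of_nonneg_left (choose_floor_le hβ k)
      (show 0 ≤ brute β ^ n by rw [brute]; positivity)
    nlinarith
  have h3 := Finset.sum_lt_sum_of_nonempty (Finset.nonempty_range_add_one) h2
  rw [← Finset.mul_sum, ← h1] at h3
  simp at h3

/-! ### The lower bound on the base of the running time -/

theorem brute_pow_le_of_isApprox {α β c : ℝ} (hα : 1 ≤ α) (hβ : 1 < β) (hc : 1 ≤ c)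
    {A : Prog ({(α, c)} : Finset (ℝ × ℝ))} (hA : IsApprox {(α, c)} β A) {f : ℕ → ℝ}
    (hf : HasCost {(α, c)} A f) (n : ℕ) :
    brute β ^ n ≤ 2 * (n + 1) * (1 + (1 + 1 / c) ^ n * max (f n) 0) := by
  obtain ⟨k, hk⟩ := exists_brute_pow_le hβ n
  have h1 := choose_le_of_isApprox hα hβ hc hA hf n k
  have h2 : (0 : ℝ) < ⌊β * k⌋₊.choose k := by
    exact_mod_cast Nat.choose_pos (Nat.le_floor (by nlinarith [(Nat.cast_nonneg k : (0 : ℝ) ≤ k)]))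
  refine le_of_mul_le_mul_right (hk.trans ?_) h2
  calc _ ≤ ((n : ℝ) + 1) * (2 * (⌊β * k⌋₊.choose k * (1 + (1 + 1 / c) ^ n * max (f n) 0))) := by
        gcongr
    _ = _ := by ring

/-- An exponential function is not bounded by a smaller exponential times a polynomial. -/
theorem le_of_forall_pow_le {x y : ℝ} (hx : 0 < x) (hy : 1 ≤ y) (C : ℕ)
    (h : ∀ n : ℕ, x ^ n ≤ C * ((n : ℝ) + 1) ^ C * y ^ n) : x ≤ y := by
  by_contra! hlt
  have hy0 : 0 < y := by linarith
  have h1 : ∀ n : ℕ, (1 : ℝ) ≤ C * ((n : ℝ) + 1) ^ C * (y / x) ^ n := by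
    intro n
    rw [div_pow, ← mul_div_assoc, le_div_iff₀ (by positivity), one_mul]
    exact h n
  have hr : y / x < 1 := (div_lt_one hx).2 hlt
  have hr0 : 0 < y / x := by positivity
  have h2 : Tendsto (fun n : ℕ => (n : ℝ) ^ C * (y / x) ^ n) atTop (𝓝 0) :=
    tendsto_pow_const_mul_const_pow_of_abs_lt_one C (by rwa [abs_of_pos hr0])
  have h3 := ((tendsto_add_atTop_iff_nat 1).2 h2).const_mul (C / (y / x))
  rw [mul_zero] at h3
  have h4 : (fun n : ℕ => C / (y / x) * (((n + 1 : ℕ) : ℝ) ^ C * (y / x) ^ (n + 1))) =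
      fun n : ℕ => C * ((n : ℝ) + 1) ^ C * (y / x) ^ n := by
    funext n
    push_cast
    rw [pow_succ (y / x) n]
    field_simp
  rw [h4] at h3
  have h5 := ge_of_tendsto' h3 h1
  norm_num at h5

theorem brute_le_of_isApprox {α β c d : ℝ} (hα : 1 ≤ α) (hβ : 1 < β) (hc : 1 ≤ c)
    {A : Prog ({(α, c)} : Finset (ℝ × ℝ))} (hA : IsApprox {(α, c)} β A) (hd : 1 ≤ d) {C : ℕ}
    (hf : HasCost {(α, c)} A fun n => d ^ n * (C * ((n : ℝ) + 1) ^ C)) :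
    brute β ≤ (1 + 1 / c) * d := by
  have hc0 : 0 < c := by linarith
  have h1c : 1 ≤ 1 + 1 / c := by
    have : 0 ≤ 1 / c := by positivity
    linarith
  have hy : 1 ≤ (1 + 1 / c) * d := one_le_mul_of_one_le_of_one_le h1c hd
  -- The constant `2 * (C + 1)` serves both as coefficient and as exponent of the polynomial factor.
  refine le_of_forall_pow_le (by rw [brute]; positivity) hy (2 * (C + 1)) fun n => ?_
  have h1 := brute_pow_le_of_isApprox hα hβ hc hA hf n
  rw [max_eq_left (by positivity)] at h1
  have h2 : (1 : ℝ) ≤ ((1 + 1 / c) * d) ^ n := one_le_pow₀ hy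
  have h3 : (1 : ℝ) ≤ ((n : ℝ) + 1) ^ C :=
    one_le_pow₀ (by linarith [(Nat.cast_nonneg n : (0:ℝ) ≤ n)])
  refine h1.trans ?_
  rw [mul_pow] at h2 ⊢
  have h4 : (1 : ℝ) + (1 + 1 / c) ^ n * (d ^ n * (C * ((n : ℝ) + 1) ^ C)) ≤
      (C + 1) * ((n : ℝ) + 1) ^ C * ((1 + 1 / c) ^ n * d ^ n) := by
    have := one_le_mul_of_one_le_of_one_le h3 h2
    linarith
  have h5 : ((n : ℝ) + 1) * ((n : ℝ) + 1) ^ C ≤ ((n : ℝ) + 1) ^ (2 * (C + 1)) := by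
    rw [← pow_succ']
    exact pow_le_pow_right₀ (by linarith [(Nat.cast_nonneg n : (0:ℝ) ≤ n)]) (by omega)
  calc 2 * ((n : ℝ) + 1) * (1 + (1 + 1 / c) ^ n * (d ^ n * (C * ((n : ℝ) + 1) ^ C)))
      ≤ 2 * ((n : ℝ) + 1) * ((C + 1) * ((n : ℝ) + 1) ^ C * ((1 + 1 / c) ^ n * d ^ n)) := by gcongr
    _ = 2 * (C + 1) * (((n : ℝ) + 1) * ((n : ℝ) + 1) ^ C) * ((1 + 1 / c) ^ n * d ^ n) := by ring
    _ ≤ 2 * (C + 1) * ((n : ℝ) + 1) ^ (2 * (C + 1)) * ((1 + 1 / c) ^ n * d ^ n) := by gcongr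
    _ = _ := by push_cast; ring

/-- The lower bound on the optimal base of the running time. -/
theorem div_le_best {α β c : ℝ} (hα : 1 ≤ α) (hβ : 1 < β) (hc : 1 ≤ c) :
    ((brute β / (1 + 1 / c) : ℝ) : EReal) ≤ best {(α, c)} β := by
  refine le_sInf ?_
  rintro _ ⟨d, ⟨hd, A, hA, C, hf⟩, rfl⟩
  have hc0 : 0 < c := by linarith
  refine EReal.coe_le_coe_iff.2 ?_
  rw [div_le_iff₀ (by positivity), mul_comm]
  exact brute_le_of_isApprox hα hβ hc hA hd hf

theorem tendsto_best_of_lt {α β : ℝ} (hα : 1 ≤ α) (hβ : 1 < β)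
    (h : ∀ c : ℝ, 1 ≤ c → best {(α, c)} β < (brute β : EReal)) :
    Tendsto (fun c : ℝ => best {(α, c)} β) atTop (𝓝 (brute β : EReal)) := by
  have h1 : Tendsto (fun c : ℝ => ((brute β / (1 + 1 / c) : ℝ) : EReal)) atTop
      (𝓝 (brute β : EReal)) := by
    refine (continuous_coe_real_ereal.tendsto _).comp ?_
    have h2 : Tendsto (fun c : ℝ => 1 + 1 / c) atTop (𝓝 (1 + 0)) := by
      simp only [one_div]
      exact tendsto_const_nhds.add tendsto_inv_atTop_zero
    have h3 : Tendsto (fun c : ℝ => brute β / (1 + 1 / c)) atTop (𝓝 (brute β / (1 + 0))) :=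
      tendsto_const_nhds.div h2 (by norm_num)
    rwa [add_zero, div_one] at h3
  refine tendsto_of_tendsto_of_tendsto_of_le_of_le' h1 tendsto_const_nhds ?_ ?_
  · filter_upwards [eventually_ge_atTop 1] with c hc using div_le_best hα hβ hc
  · filter_upwards [eventually_ge_atTop 1] with c hc using (h c hc).le

/-! ### Estimates for binomial coefficients -/

/-- The `j`-th term is the largest one in the binomial expansion of `(j + (m - j)) ^ m`. -/
theorem pow_self_le_choose {m j : ℕ} (hj : j ≤ m) :
    m ^ m ≤ (m + 1) * (m.choose j * j ^ j * (m - j) ^ (m - j)) := by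
  set t : ℕ → ℕ := fun i => j ^ i * (m - j) ^ (m - i) * m.choose i with ht
  -- The ratio of consecutive terms, with denominators cleared. It is at least one before `j` and at
  -- most one from `j` on.
  have hstep : ∀ i, i < m → t i * ((m - i) * j) = t (i + 1) * ((i + 1) * (m - j)) := by
    intro i hi
    have h1 := Nat.choose_succ_right_eq m i
    have h2 : m - i = m - (i + 1) + 1 := by omega
    simp only [ht]
    rw [h2, pow_succ (m - j), pow_succ j i]
    rw [h2] at h1
    calc _ = j ^ i * ((m - j) ^ (m - (i + 1)) * (m - j)) *
          (m.choose i * (m - (i + 1) + 1)) * j := by ring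
      _ = _ := by rw [← h1]; ring
  have hup : ∀ i, i < j → t i ≤ t (i + 1) := by
    intro i hi
    obtain ⟨u, rfl⟩ := Nat.exists_eq_add_of_lt hi
    obtain ⟨v, rfl⟩ := Nat.exists_eq_add_of_le hj
    have h1 := hstep i (by omega)
    have h2 : (i + 1) * (i + u + 1 + v - (i + u + 1)) ≤
        (i + u + 1 + v - i) * (i + u + 1) := by
      rw [show i + u + 1 + v - (i + u + 1) = v by omega,
        show i + u + 1 + v - i = u + 1 + v by omega]
      nlinarith
    have h3 : 0 < (i + u + 1 + v - i) * (i + u + 1) := by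
      apply Nat.mul_pos <;> omega
    exact Nat.le_of_mul_le_mul_right (h1.trans_le (Nat.mul_le_mul_left _ h2)) h3
  have hdown : ∀ i, j ≤ i → i < m → t (i + 1) ≤ t i := by
    intro i hi him
    obtain ⟨u, rfl⟩ := Nat.exists_eq_add_of_le hi
    obtain ⟨v, rfl⟩ := Nat.exists_eq_add_of_lt him
    have h1 := hstep (j + u) (by omega)
    have h2 : (j + u + v + 1 - (j + u)) * j ≤ (j + u + 1) * (j + u + v + 1 - j) := by
      rw [show j + u + v + 1 - (j + u) = v + 1 by omega,
        show j + u + v + 1 - j = u + v + 1 by omega]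
      nlinarith
    have h3 : 0 < (j + u + 1) * (j + u + v + 1 - j) := by
      apply Nat.mul_pos <;> omega
    exact Nat.le_of_mul_le_mul_right (h1.symm.trans_le (Nat.mul_le_mul_left _ h2)) h3
  have hlow : ∀ d i, i + d = j → t i ≤ t j := by
    intro d
    induction d with
    | zero => rintro i rfl; exact le_rfl
    | succ d ih => intro i hi; exact (hup i (by omega)).trans (ih (i + 1) (by omega))
  have hhigh : ∀ d, j + d ≤ m → t (j + d) ≤ t j := by
    intro d
    induction d with
    | zero => intro _; exact le_rfl
    | succ d ih => intro hd; exact (hdown (j + d) (by omega) (by omega)).trans (ih (by omega))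
  have hall : ∀ i ∈ Finset.range (m + 1), t i ≤ t j := by
    intro i hi
    have hi := Finset.mem_range.1 hi
    rcases le_total i j with h | h
    · exact hlow (j - i) i (by omega)
    · have := hhigh (i - j) (by omega)
      rwa [Nat.add_sub_cancel' h] at this
  have hsum := Finset.sum_le_card_nsmul _ _ _ hall
  have hbin := add_pow j (m - j) m
  rw [Nat.add_sub_cancel' hj] at hbin
  rw [Finset.card_range, smul_eq_mul] at hsum
  refine hbin.le.trans (hsum.trans (le_of_eq ?_))
  simp only [ht]
  ring

/-- The converse of `choose_mul_pow_le` up to the factor `m + 1`, at the point `x = j / (m - j)` for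
which the `j`-th term of `(1 + x) ^ m` is the largest. -/
theorem one_add_pow_le_choose {m j : ℕ} (hj : j < m) :
    (1 + (j : ℝ) / ((m : ℝ) - j)) ^ m ≤ (m + 1) * m.choose j * ((j : ℝ) / ((m : ℝ) - j)) ^ j := by
  have h1 : (m : ℝ) ^ m ≤ (m + 1) * (m.choose j * j ^ j * ((m : ℝ) - j) ^ (m - j)) := by
    have := pow_self_le_choose hj.le
    have h2 : ((m ^ m : ℕ) : ℝ) ≤ (((m + 1) * (m.choose j * j ^ j * (m - j) ^ (m - j)) : ℕ) : ℝ) :=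
      Nat.cast_le.2 this
    push_cast [Nat.cast_sub hj.le] at h2
    exact h2
  have h0 : (0 : ℝ) < (m : ℝ) - j := sub_pos.2 (by exact_mod_cast hj)
  have h2 : (1 : ℝ) + j / ((m : ℝ) - j) = m / ((m : ℝ) - j) := by field_simp; ring
  rw [h2, div_pow, div_le_iff₀ (by positivity), div_pow]
  refine h1.trans (le_of_eq ?_)
  have h3 : ((m : ℝ) - j) ^ m = ((m : ℝ) - j) ^ j * ((m : ℝ) - j) ^ (m - j) := by
    rw [← pow_add, Nat.add_sub_cancel' hj.le]
  rw [h3]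
  field_simp

/-- It follows from `a.choose b ≥ (a + 1 - b) ^ b / b!` and `b! ≤ b ^ b`. It is used for `b` far
below `a`, where `r` can be as large as desired. -/
theorem pow_le_choose_of_mul_le {a b : ℕ} {r : ℝ} (hr : 0 ≤ r) (hb : b ≤ a) (h : r * b ≤
    (a : ℝ) - b) :
    r ^ b ≤ a.choose b := by
  rcases Nat.eq_zero_or_pos b with rfl | hb0
  · simp
  have h1 : ((a + 1 - b : ℕ) : ℝ) ^ b ≤ b.factorial * a.choose b := by
    have := Nat.pow_le_choose (α := ℝ) b a
    rw [div_le_iff₀ (by positivity), mul_comm] at this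
    exact_mod_cast this
  have h2 : (b.factorial : ℝ) ≤ (b : ℝ) ^ b := by exact_mod_cast Nat.factorial_le_pow b
  have h3 : (r * b) ^ b ≤ ((a + 1 - b : ℕ) : ℝ) ^ b := by
    refine pow_le_pow_left₀ (by positivity) (h.trans ?_) b
    rw [Nat.cast_sub (by omega)]
    push_cast
    linarith
  rw [mul_pow] at h3
  have h4 : (0 : ℝ) < (b : ℝ) ^ b := by positivity
  refine le_of_mul_le_mul_right ?_ h4
  calc r ^ b * (b : ℝ) ^ b ≤ b.factorial * a.choose b := h3.trans h1
    _ ≤ (b : ℝ) ^ b * a.choose b := by gcongr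
    _ = _ := mul_comm _ _

/-- The maximality of `x = (β - 1)⁻¹` for `x / (1 + x) ^ β`, which is Bernoulli's inequality for the
ratio of `1 + x` to its value at the maximiser. -/
theorem le_bruteFactor_mul {β : ℝ} (hβ : 1 < β) {x : ℝ} (hx : 0 ≤ x) :
    x ≤ bruteFactor β * (1 + x) ^ β := by
  have h1 : 0 < β - 1 := by linarith
  have h0 : 0 < β := by linarith
  have h2 : 1 + (β - 1)⁻¹ = β / (β - 1) := by field_simp; ring
  have h3 := one_add_mul_self_le_rpow_one_add (s := (1 + x) / (1 + (β - 1)⁻¹) - 1)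
    (by have : 0 ≤ (1 + x) / (1 + (β - 1)⁻¹) := by positivity
        linarith) hβ.le
  rw [add_sub_cancel, Real.div_rpow (by positivity) (by positivity)] at h3
  have h4 : 1 + β * ((1 + x) / (1 + (β - 1)⁻¹) - 1) = (β - 1) * x := by
    rw [h2]
    field_simp
    ring
  rw [h4] at h3
  rw [bruteFactor_eq hβ, Real.rpow_neg (by positivity)]
  have h5 : 0 < (1 + (β - 1)⁻¹) ^ β := by positivity
  rw [le_div_iff₀ h5] at h3
  rw [mul_assoc, ← div_eq_inv_mul, le_div_iff₀ h1, ← div_eq_inv_mul, le_div_iff₀ h5]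
  linarith

theorem bruteFactor_le_one {β : ℝ} (hβ : 1 < β) : bruteFactor β ≤ 1 := by
  have h0 : 0 < β := by linarith
  rw [bruteFactor, Real.exp_le_one_iff]
  have := Real.binEntropy_nonneg (p := 1 / β) (by positivity) ((div_le_one h0).2 hβ.le)
  nlinarith

/-- Equivalently `B / (1 + B) < 1 / β` for `B = bruteFactor β`. At the mode of the expansion of `(1
+ B) ^ n` a linear number of elements therefore remains beyond `β * k`; extensions profit from this
room. -/
theorem bruteFactor_mul_lt {β : ℝ} (hβ : 1 < β) : bruteFactor β * (β - 1) < 1 := by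
  have h1 : 0 < β - 1 := by linarith
  rw [bruteFactor_eq hβ, mul_right_comm, inv_mul_cancel₀ h1.ne', one_mul]
  have : 0 < (β - 1)⁻¹ := inv_pos.2 h1
  exact Real.rpow_lt_one_of_one_lt_of_neg (by linarith) (by linarith)

/-- A lower bound on `m.choose (k - ℓ)` for `m` close to `β * k - α * ℓ`. -/
theorem bruteFactor_le_choose {α β xl xh : ℝ} (hα : 0 ≤ α) (hβ : 1 < β) (hxl : 0 < xl) {m k ℓ : ℕ}
    (hℓ : ℓ ≤ k) (hm : k - ℓ < m) (hml : β * k - α * ℓ - 1 ≤ m)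
    (hl : xl ≤ ((k - ℓ : ℕ) : ℝ) / ((m : ℝ) - (k - ℓ : ℕ)))
    (hh : ((k - ℓ : ℕ) : ℝ) / ((m : ℝ) - (k - ℓ : ℕ)) ≤ xh) :
    (xl / (1 + xh) ^ α) ^ ℓ ≤
      bruteFactor β ^ k * ((1 + xh) * (m + 1) * m.choose (k - ℓ)) := by
  have h1 := one_add_pow_le_choose hm
  set j := k - ℓ with hj
  set x := (j : ℝ) / ((m : ℝ) - j) with hx
  have hx0 : 0 < x := hxl.trans_le hl
  have hxh : 0 < xh := hx0.trans_le hh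
  -- The `- 1` is the loss from rounding `m` down and costs one factor `1 + x`.
  have h2 : (1 + x) ^ (β * k - α * ℓ - 1) ≤ (1 + x) ^ m := by
    rw [← Real.rpow_natCast]
    exact Real.rpow_le_rpow_of_exponent_le (by linarith) hml
  have h3 : (1 + x) ^ (β * k - α * ℓ - 1) =
      ((1 + x) ^ β) ^ k / (((1 + x) ^ α) ^ ℓ * (1 + x)) := by
    rw [Real.rpow_sub (by linarith), Real.rpow_sub (by linarith), Real.rpow_one, div_div,
      Real.rpow_mul (by linarith), Real.rpow_mul (by linarith), Real.rpow_natCast,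
      Real.rpow_natCast]
  rw [h3] at h2
  have h4 := h2.trans h1
  have hD : 0 < ((1 + x) ^ α) ^ ℓ * (1 + x) := by positivity
  rw [div_le_iff₀ hD] at h4
  -- Since `j = k - ℓ`, the factor `x ^ j` of `x ^ k` cancels against the binomial estimate, and `x
  -- ^ ℓ` is left.
  have h5 : x ^ k ≤ bruteFactor β ^ k * ((1 + x) ^ β) ^ k := by
    rw [← mul_pow]
    exact pow_le_pow_left₀ hx0.le (le_bruteFactor_mul hβ hx0.le) k
  have h6 : x ^ k = x ^ j * x ^ ℓ := by rw [← pow_add, hj, Nat.sub_add_cancel hℓ]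
  have hB := pow_pos (bruteFactor_pos β) k
  have h7 : x ^ ℓ ≤ bruteFactor β ^ k * (((m : ℝ) + 1) * m.choose j *
      (((1 + x) ^ α) ^ ℓ * (1 + x))) := by
    refine le_of_mul_le_mul_left ?_ (pow_pos hx0 j)
    rw [← h6]
    refine h5.trans ((mul_le_mul_of_nonneg_left h4 hB.le).trans (le_of_eq ?_))
    ring
  rw [div_pow, div_le_iff₀ (by positivity)]
  refine (pow_le_pow_left₀ hxl.le hl ℓ).trans (h7.trans ?_)
  have h8 : (1 + x) ^ α ≤ (1 + xh) ^ α := Real.rpow_le_rpow (by positivity) (by linarith) hα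
  calc _ ≤ bruteFactor β ^ k * (((m : ℝ) + 1) * m.choose j *
      (((1 + xh) ^ α) ^ ℓ * (1 + xh))) := by gcongr
    _ = _ := by ring

/-- The terms of the binomial expansion of `(1 + B) ^ n` beyond the mode are exponentially small. -/
theorem exists_choose_mul_pow_le {B κ : ℝ} (hB : 0 < B) (hκ : B / (1 + B) < κ) :
    ∃ d, 0 < d ∧ d < 1 + B ∧ ∀ n k : ℕ, κ * n ≤ k → n.choose k * B ^ k ≤ d ^ n := by
  set q := B / (1 + B) with hq
  have hq0 : 0 < q := by positivity
  -- A Chernoff bound: tilting by `exp u` gives `(1 + B * exp u) ^ n * exp (-u * k)`. Relative to `1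
  -- + B` the base grows at rate `q` in `u`, while `k ≥ κ * n` brings the decay rate `κ`; `u` is so
  -- small that the quadratic error does not close the gap.
  obtain ⟨u, hu0, hu1, huκ⟩ : ∃ u : ℝ, 0 < u ∧ u ≤ 1 ∧ q * (1 + u) < κ := by
    refine ⟨min 1 ((κ - q) / (2 * q)), lt_min one_pos (div_pos (by linarith) (by linarith)),
      min_le_left _ _, ?_⟩
    have h1 : min 1 ((κ - q) / (2 * q)) ≤ (κ - q) / (2 * q) := min_le_right _ _
    rw [le_div_iff₀ (by linarith)] at h1
    nlinarith
  refine ⟨(1 + B * Real.exp u) * Real.exp (-(κ * u)), by positivity, ?_, ?_⟩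
  · have h1 : 1 + B * Real.exp u = (1 + B) * (1 + q * (Real.exp u - 1)) := by
      rw [hq]; field_simp; ring
    have h2 : Real.exp u - 1 ≤ u + u ^ 2 := by
      have := Real.abs_exp_sub_one_sub_id_le (x := u) (by rw [abs_of_pos hu0]; exact hu1)
      linarith [(abs_le.1 this).2]
    have h3 : q * (Real.exp u - 1) < κ * u := by
      calc q * (Real.exp u - 1) ≤ q * (u + u ^ 2) := by gcongr
        _ = q * (1 + u) * u := by ring
        _ < κ * u := by gcongr
    have h4 : 1 + q * (Real.exp u - 1) < Real.exp (κ * u) := by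
      have := Real.add_one_le_exp (κ * u)
      linarith
    rw [h1, Real.exp_neg, ← div_eq_mul_inv, div_lt_iff₀ (Real.exp_pos _)]
    gcongr
  · intro n k hk
    have h1 := choose_mul_pow_le n k (x := B * Real.exp u) (by positivity)
    rw [mul_pow (1 + B * Real.exp u), ← Real.exp_nat_mul]
    have h2 : Real.exp (-(u * k)) ≤ Real.exp (n * -(κ * u)) := by
      apply Real.exp_le_exp.2
      nlinarith
    have h3 : (B ^ k : ℝ) = (B * Real.exp u) ^ k * Real.exp (-(u * k)) := by
      rw [mul_pow, ← Real.exp_nat_mul, mul_assoc, ← Real.exp_add]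
      rw [show (k : ℝ) * u + -(u * k) = 0 by ring, Real.exp_zero, mul_one]
    rw [h3, ← mul_assoc]
    gcongr

/-! ### Parameters that beat the brute force -/

/-- Parameters `s` and `ℓ` for which random sets of size `s` together with extensions of size `ℓ`
find solutions for instances with optimum `k`. -/
structure GoodParams (α β M Q d : ℝ) (n k s ℓ : ℕ) : Prop where
  one_le : 1 ≤ s
  le_opt : ℓ ≤ k
  opt_le : k ≤ s + ℓ
  add_le : s + ℓ ≤ n
  ratio : s + α * ℓ ≤ β * k
  -- Divided by `n.choose k`, the last product is the probability that a random `s`-set misses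
  -- exactly `ℓ` elements of a fixed `k`-set. So up to `Q * (n + 1)` this probability is at least `M
  -- ^ ℓ / d ^ n`, and about `d ^ n / M ^ ℓ` trials suffice.
  estimate : M ^ ℓ * n.choose k ≤ Q * (n + 1) * d ^ n * (s.choose (k - ℓ) * (n - s).choose ℓ)

/-- For bounded `k` the coefficient `n.choose k` is polynomial in `n`. Using half the brute-force
factor as weight costs only a constant and makes the base smaller than `brute β`. -/
theorem goodParams_of_small {α β M : ℝ} (hβ : 1 < β) (k₀ : ℕ) {n k : ℕ}
    (hk : 1 ≤ k) (hk₀ : k ≤ k₀) (hn : β * k < n) :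
    GoodParams α β M ((bruteFactor β / 2) ^ k₀)⁻¹ (1 + bruteFactor β / 2) n k ⌊β * k⌋₊ 0 := by
  have hB := bruteFactor_pos β
  have hk1 : (1 : ℝ) ≤ k := by exact_mod_cast hk
  have hle : k ≤ ⌊β * k⌋₊ := Nat.le_floor (by nlinarith)
  have hfl : (⌊β * k⌋₊ : ℝ) ≤ β * k := Nat.floor_le (by positivity)
  refine ⟨hk.trans hle, Nat.zero_le _, by simpa using hle, ?_, by simpa using hfl, ?_⟩
  · exact_mod_cast (hfl.trans hn.le)
  · have h1 := choose_mul_pow_le n k (x := bruteFactor β / 2) (by positivity)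
    have h2 : (bruteFactor β / 2) ^ k₀ ≤ (bruteFactor β / 2) ^ k :=
      pow_le_pow_of_le_one (by positivity) (by linarith [bruteFactor_le_one hβ]) hk₀
    have h3 : (1 : ℝ) ≤ (⌊β * k⌋₊.choose k : ℝ) := by
      exact_mod_cast Nat.choose_pos hle
    have h4 : (n.choose k : ℝ) ≤ ((bruteFactor β / 2) ^ k₀)⁻¹ * (1 + bruteFactor β / 2) ^ n := by
      rw [← div_eq_inv_mul, le_div_iff₀ (by positivity)]
      exact (mul_le_mul_of_nonneg_left h2 (by positivity)).trans h1
    have hpos : 0 ≤ ((bruteFactor β / 2) ^ k₀)⁻¹ * (1 + bruteFactor β / 2) ^ n := by positivity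
    have h5 : (1 : ℝ) ≤ (n + 1) * (⌊β * k⌋₊.choose k : ℝ) :=
      one_le_mul_of_one_le_of_one_le (by linarith [(Nat.cast_nonneg n : (0:ℝ) ≤ n)]) h3
    simp only [pow_zero, one_mul, Nat.sub_zero, Nat.choose_zero_right, Nat.cast_one, mul_one]
    refine h4.trans ((le_mul_of_one_le_right hpos h5).trans (le_of_eq ?_))
    ring

theorem GoodParams.mono {α β M Q Q' d d' : ℝ} {n k s ℓ : ℕ} (h : GoodParams α β M Q d n k s ℓ)
    (hQ : 0 ≤ Q) (hQ' : Q ≤ Q') (hd : 0 ≤ d) (hd' : d ≤ d') : GoodParams α β M Q' d' n k s ℓ :=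
  { h with
    estimate := h.estimate.trans (mul_le_mul_of_nonneg_right (mul_le_mul
      (mul_le_mul_of_nonneg_right hQ' (by positivity)) (pow_le_pow_left₀ hd hd' n)
      (by positivity) (mul_nonneg (hQ.trans hQ') (by positivity))) (by positivity)) }

/-- Bounds that hold for the parameters of both remaining cases. -/
theorem choose_floor_bound {α β ε : ℝ} (hα : 1 ≤ α) (hβ : 1 < β) (hε0 : 0 ≤ ε) (hε : ε ≤ 1 / 2)
    (hεα : ε * (4 * α) ≤ β - 1) {k : ℕ} (hk : 1 ≤ k) (hk4 : 4 ≤ (β - 1) * k) :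
    k - ⌊ε * k⌋₊ < ⌊β * k - α * ⌊ε * k⌋₊⌋₊ ∧ ⌊ε * k⌋₊ ≤ k ∧
    ((⌊β * k - α * ⌊ε * k⌋₊⌋₊ : ℕ) : ℝ) + α * ⌊ε * k⌋₊ ≤ β * k ∧
    ((1 / (2 * (β - 1))) / (1 + 2 / (β - 1)) ^ α) ^ ⌊ε * k⌋₊ ≤
      bruteFactor β ^ k * ((1 + 2 / (β - 1)) * ((⌊β * k - α * ⌊ε * k⌋₊⌋₊ : ℕ) + 1) *
        (⌊β * k - α * ⌊ε * k⌋₊⌋₊.choose (k - ⌊ε * k⌋₊))) := by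
  have hk1 : (1 : ℝ) ≤ k := by exact_mod_cast hk
  have hb : 0 < β - 1 := by linarith
  set ℓ := ⌊ε * k⌋₊ with hℓ
  have hl : (ℓ : ℝ) ≤ ε * k := Nat.floor_le (by positivity)
  have hl0 : (0 : ℝ) ≤ ℓ := Nat.cast_nonneg _
  have hlk2 : (ℓ : ℝ) ≤ k / 2 := by nlinarith
  have hlk : ℓ ≤ k := by
    have : (ℓ : ℝ) ≤ k := by linarith
    exact_mod_cast this
  have hαl : α * ℓ ≤ (β - 1) * k / 4 := by nlinarith
  have hnn : 0 ≤ β * k - α * ℓ := by nlinarith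
  set m := ⌊β * k - α * ℓ⌋₊ with hm
  have hm1 : (m : ℝ) ≤ β * k - α * ℓ := Nat.floor_le hnn
  have hm2 : β * k - α * ℓ - 1 < m := by linarith [Nat.lt_floor_add_one (β * k - α * ℓ)]
  have hj : ((k - ℓ : ℕ) : ℝ) = k - ℓ := Nat.cast_sub hlk
  -- Both `α * ℓ` and the rounding error are at most a quarter of `(β - 1) * k`. Hence `m - (k - ℓ)`
  -- lies between `(β - 1) * k / 2` and `(β - 1) * k`, while `k - ℓ` lies between `k / 2` and `k`;
  -- this gives the two bounds on the ratio.
  have hdiff : (β - 1) * k / 2 ≤ (m : ℝ) - (k - ℓ : ℕ) := by rw [hj]; nlinarith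
  have hdiff' : (m : ℝ) - (k - ℓ : ℕ) ≤ (β - 1) * k := by rw [hj]; nlinarith
  have hlt : k - ℓ < m := by
    have : ((k - ℓ : ℕ) : ℝ) < m := by nlinarith
    exact_mod_cast this
  have hdpos : 0 < (m : ℝ) - (k - ℓ : ℕ) := by nlinarith
  refine ⟨hlt, hlk, by linarith, ?_⟩
  refine bruteFactor_le_choose (by linarith) hβ (by positivity) hlk hlt hm2.le ?_ ?_
  · rw [div_le_div_iff₀ (by positivity) hdpos, hj]
    rw [hj] at hdiff'
    nlinarith
  · rw [div_le_div_iff₀ hdpos hb, hj]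
    rw [hj] at hdiff
    nlinarith

/-- Beyond the mode the brute force is exponentially faster than its worst case, so sampling sets of
size `⌊β * k⌋₊` without extension is enough. -/
theorem goodParams_of_large {α β M κ d : ℝ} (hα : 1 ≤ α) (hβ : 1 < β) (hd0 : 0 < d)
    (hd : ∀ n k : ℕ, κ * n ≤ k → n.choose k * bruteFactor β ^ k ≤ d ^ n) {n k : ℕ}
    (hk : 1 ≤ k) (hk4 : 4 ≤ (β - 1) * k) (hn : β * k < n) (hκ : κ * n ≤ k) :
    GoodParams α β M (1 + 2 / (β - 1)) d n k ⌊β * k⌋₊ 0 := by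
  obtain ⟨h1, -, h2, h3⟩ := choose_floor_bound (ε := 0) hα hβ le_rfl (by norm_num)
    (by linarith) hk hk4
  simp only [zero_mul, Nat.floor_zero, Nat.sub_zero, Nat.cast_zero, mul_zero, sub_zero, add_zero,
    pow_zero] at h1 h2 h3
  have hb : 0 < β - 1 := by linarith
  have hsn : ⌊β * k⌋₊ ≤ n := by exact_mod_cast h2.trans hn.le
  refine ⟨by omega, Nat.zero_le _, by omega, by simpa using hsn, by simpa using h2, ?_⟩
  have hB := pow_pos (bruteFactor_pos β) k
  have h4 := hd n k hκ
  simp only [pow_zero, one_mul, Nat.sub_zero, Nat.choose_zero_right, Nat.cast_one, mul_one]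
  have h5 : (n.choose k : ℝ) ≤ n.choose k * (bruteFactor β ^ k * ((1 + 2 / (β - 1)) *
      (⌊β * k⌋₊ + 1) * ⌊β * k⌋₊.choose k)) := le_mul_of_one_le_right (by positivity) h3
  refine h5.trans ?_
  calc _ = (n.choose k * bruteFactor β ^ k) * ((1 + 2 / (β - 1)) *
      (⌊β * k⌋₊ + 1) * ⌊β * k⌋₊.choose k) := by ring
    _ ≤ d ^ n * ((1 + 2 / (β - 1)) * (n + 1) * ⌊β * k⌋₊.choose k) := by gcongr
    _ = _ := by ring

/-- The only case that needs the oracle. Shrinking `s` by about `α * ℓ` loses a factor `θ ^ ℓ`, and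
a query costs up to `M ^ ℓ`. But `n - s - ℓ ≥ η * k` is much larger than `ℓ ≤ ε * k`, so `(n -
s).choose ℓ` pays for both and leaves a gain of `2 ^ ℓ`. -/
theorem goodParams_of_medium {α β M η ε : ℝ} (hα : 1 ≤ α) (hβ : 1 < β) (hM : 1 ≤ M)
    (hε0 : 0 < ε) (hε : ε ≤ 1 / 2) (hεα : ε * (4 * α) ≤ β - 1) (hεη : 2 * ε ≤ η)
    (hεM : 4 * M * ε ≤ η * ((1 / (2 * (β - 1))) / (1 + 2 / (β - 1)) ^ α)) {n k : ℕ}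
    (hk : 1 ≤ k) (hk4 : 4 ≤ (β - 1) * k) (hkε : 2 ≤ ε * k) (hn : (β + η) * k ≤ n) :
    GoodParams α β M (1 + 2 / (β - 1)) (1 + bruteFactor β / 2 ^ (ε / 2)) n k
      ⌊β * k - α * ⌊ε * k⌋₊⌋₊ ⌊ε * k⌋₊ := by
  obtain ⟨h1, h2, h3, h4⟩ := choose_floor_bound hα hβ hε0.le hε hεα hk hk4
  have hk1 : (1 : ℝ) ≤ k := by exact_mod_cast hk
  have hb : 0 < β - 1 := by linarith
  have hη : 0 < η := by linarith
  set ℓ := ⌊ε * k⌋₊ with hℓ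
  set s := ⌊β * k - α * ℓ⌋₊ with hs
  set θ := (1 / (2 * (β - 1))) / (1 + 2 / (β - 1)) ^ α with hθ
  have hθ0 : 0 < θ := by positivity
  have hl : (ℓ : ℝ) ≤ ε * k := Nat.floor_le (by positivity)
  have hl' : ε * k / 2 ≤ ℓ := by linarith [Nat.lt_floor_add_one (ε * k)]
  have hl0 : (0 : ℝ) ≤ ℓ := Nat.cast_nonneg _
  have hsl : (s : ℝ) + ℓ ≤ β * k := by nlinarith
  have hsln : s + ℓ ≤ n := by
    have : (s : ℝ) + ℓ ≤ n := by nlinarith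
    exact_mod_cast this
  refine ⟨by omega, h2, by omega, hsln, h3, ?_⟩
  have h5 : (2 * M / θ) ^ ℓ ≤ (n - s).choose ℓ := by
    refine pow_le_choose_of_mul_le (by positivity) (by omega) ?_
    rw [Nat.cast_sub (by omega), div_mul_eq_mul_div, div_le_iff₀ hθ0]
    have h6 : η * k ≤ (n : ℝ) - s - ℓ := by nlinarith
    calc 2 * M * ℓ ≤ 2 * M * (ε * k) := by gcongr
      _ = 4 * M * ε * k / 2 := by ring
      _ ≤ η * θ * k / 2 := by gcongr
      _ ≤ η * k * θ := by nlinarith [mul_pos (mul_pos hη hθ0) (show (0:ℝ) < k by linarith)]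
      _ ≤ _ := by gcongr
  have hB := pow_pos (bruteFactor_pos β) k
  set G : ℝ := 2 ^ (ε / 2) with hG
  have hG0 : 0 < G := by positivity
  -- As `ℓ ≥ ε * k / 2`, the gain is at least `G ^ k`: it divides the brute-force factor of each of
  -- the `k` elements by `G`.
  have h6 : G ^ k ≤ 2 ^ ℓ := by
    rw [hG, ← Real.rpow_natCast, ← Real.rpow_mul (by norm_num), ← Real.rpow_natCast]
    refine Real.rpow_le_rpow_of_exponent_le (by norm_num) ?_
    linarith
  have h7 := choose_mul_pow_le n k (x := bruteFactor β / G)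
    (div_nonneg (bruteFactor_pos β).le hG0.le)
  rw [div_pow, ← mul_div_assoc, div_le_iff₀ (by positivity)] at h7
  set W : ℝ := (1 + 2 / (β - 1)) * (s + 1) * s.choose (k - ℓ) with hW
  have hW0 : 0 ≤ W := by positivity
  have h8 : (2 * M) ^ ℓ ≤ bruteFactor β ^ k * (W * (n - s).choose ℓ) := by
    calc (2 * M) ^ ℓ = θ ^ ℓ * (2 * M / θ) ^ ℓ := by
          rw [← mul_pow]; congr 1; field_simp
      _ ≤ (bruteFactor β ^ k * W) * (n - s).choose ℓ := by gcongr
      _ = _ := by ring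
  have h2pos : (0 : ℝ) < 2 ^ ℓ := by positivity
  refine le_of_mul_le_mul_left ?_ h2pos
  calc (2 : ℝ) ^ ℓ * (M ^ ℓ * n.choose k) = (2 * M) ^ ℓ * n.choose k := by rw [mul_pow]; ring
    _ ≤ bruteFactor β ^ k * (W * (n - s).choose ℓ) * n.choose k := by gcongr
    _ = (n.choose k * bruteFactor β ^ k) * (W * (n - s).choose ℓ) := by ring
    _ ≤ ((1 + bruteFactor β / G) ^ n * G ^ k) * (W * (n - s).choose ℓ) := by gcongr
    _ ≤ ((1 + bruteFactor β / G) ^ n * 2 ^ ℓ) * ((1 + 2 / (β - 1)) * (n + 1) * s.choose (k - ℓ) *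
        (n - s).choose ℓ) := by
      have := bruteFactor_pos β
      rw [hW]
      gcongr
      omega
    _ = _ := by ring

/-- Oracles allow to improve on the brute force for every size of the optimum. -/
theorem exists_goodParams {α β M : ℝ} (hα : 1 ≤ α) (hβ : 1 < β) (hM : 1 ≤ M) :
    ∃ Q d : ℝ, 0 < Q ∧ 1 ≤ d ∧ d < brute β ∧ ∀ n k : ℕ, 1 ≤ k → β * k < n →
      ∃ s ℓ, GoodParams α β M Q d n k s ℓ := by
  have hB := bruteFactor_pos β
  have hb : 0 < β - 1 := by linarith
  have hbr : brute β = 1 + bruteFactor β := rfl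
  -- The threshold between the last two cases lies above the mode, so that the tail is small, and
  -- below `1 / β`, so that `k < κ * n` forces `n > (β + η) * k`.
  obtain ⟨κ, hκ1, hκ2⟩ : ∃ κ, bruteFactor β / (1 + bruteFactor β) < κ ∧ κ < 1 / β := by
    refine exists_between ?_
    rw [div_lt_div_iff₀ (by linarith) (by linarith)]
    linarith [bruteFactor_mul_lt hβ]
  have hκ0 : 0 < κ := lt_trans (by positivity) hκ1
  obtain ⟨d₁, hd₁0, hd₁, hd₁'⟩ := exists_choose_mul_pow_le hB hκ1
  set η := 1 / κ - β with hη
  have hη0 : 0 < η := by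
    rw [hη, sub_pos, lt_div_iff₀ hκ0, mul_comm]
    rwa [lt_div_iff₀ (by linarith)] at hκ2
  set θ := (1 / (2 * (β - 1))) / (1 + 2 / (β - 1)) ^ α with hθ
  have hθ0 : 0 < θ := by positivity
  obtain ⟨ε, hε0, hε1, hε2, hε3, hε4⟩ : ∃ ε : ℝ, 0 < ε ∧ ε ≤ 1 / 2 ∧ ε ≤ (β - 1) / (4 * α) ∧
      ε ≤ η / 2 ∧ ε ≤ η * θ / (4 * M) := by
    refine ⟨min (min (1 / 2) ((β - 1) / (4 * α))) (min (η / 2) (η * θ / (4 * M))), ?_, ?_, ?_, ?_,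
      ?_⟩
    · refine lt_min (lt_min (by norm_num) (by positivity)) (lt_min (by positivity) (by positivity))
    · exact (min_le_left _ _).trans (min_le_left _ _)
    · exact (min_le_left _ _).trans (min_le_right _ _)
    · exact (min_le_right _ _).trans (min_le_left _ _)
    · exact (min_le_right _ _).trans (min_le_right _ _)
  rw [le_div_iff₀ (by positivity)] at hε2 hε4
  have hε5 : 2 * ε ≤ η := by linarith
  have hε6 : 4 * M * ε ≤ η * ((1 / (2 * (β - 1))) / (1 + 2 / (β - 1)) ^ α) := by
    rw [← hθ]
    linarith
  -- From `k₀ / (β - 1)`-independent thresholds on: rounding `β * k - α * ℓ` is harmless for `k ≥ 4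
  -- / (β - 1)`, and rounding `ε * k` at most halves it for `k ≥ 2 / ε`.
  obtain ⟨k₀, hk₀⟩ := exists_nat_ge (max (4 / (β - 1)) (2 / ε))
  have hk₁ := (le_max_left _ _).trans hk₀
  have hk₂ := (le_max_right _ _).trans hk₀
  rw [div_le_iff₀ hb] at hk₁
  rw [div_le_iff₀ hε0] at hk₂
  set G : ℝ := 2 ^ (ε / 2) with hG
  have hG1 : 1 < G := Real.one_lt_rpow (by norm_num) (by positivity)
  set Q₁ := ((bruteFactor β / 2) ^ k₀)⁻¹ with hQ₁
  have hQ₁0 : 0 < Q₁ := by positivity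
  set Q₂ := 1 + 2 / (β - 1) with hQ₂
  have hQ₂0 : 0 < Q₂ := by positivity
  refine ⟨max Q₁ Q₂, max (max (1 + bruteFactor β / 2) d₁) (1 + bruteFactor β / G),
    lt_max_of_lt_left hQ₁0, ?_, ?_, ?_⟩
  · exact le_max_of_le_right (by linarith [div_pos hB (zero_lt_one.trans hG1)])
  · rw [hbr]
    refine max_lt (max_lt (by linarith) hd₁) ?_
    have := div_lt_self hB hG1
    linarith
  · intro n k hk hn
    rcases le_or_gt k k₀ with h | h
    · exact ⟨_, _, (goodParams_of_small hβ k₀ hk h hn).mono hQ₁0.le (le_max_left _ _)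
        (by linarith) ((le_max_left _ _).trans (le_max_left _ _))⟩
    have hkr : (k₀ : ℝ) ≤ k := by exact_mod_cast h.le
    have hk4 : 4 ≤ (β - 1) * k := by nlinarith
    have hkε : 2 ≤ ε * k := by nlinarith
    rcases le_or_gt (κ * n) k with h' | h'
    · exact ⟨_, _, (goodParams_of_large hα hβ hd₁0 hd₁' hk hk4 hn h').mono hQ₂0.le
        (le_max_right _ _) hd₁0.le ((le_max_right _ _).trans (le_max_left _ _))⟩
    · refine ⟨_, _, (goodParams_of_medium hα hβ hM hε0 hε1 hε2 hε5 hε6 hk hk4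
        hkε ?_).mono hQ₂0.le (le_max_right _ _)
        (by linarith [div_pos hB (zero_lt_one.trans hG1)]) (le_max_right _ _)⟩
      rw [hη, add_sub_cancel, div_mul_eq_mul_div, one_mul, div_le_iff₀ hκ0]
      linarith

/-! ### Random sets that almost contain a given set -/

/-- Both sides count the pairs of a `k`-set and an `s`-set with exactly `k - ℓ` common elements,
according to which set is chosen first. The proof clears factorials. -/
theorem choose_mul_choose_mul_choose {n k s ℓ : ℕ} (h1 : ℓ ≤ k) (h2 : k ≤ s + ℓ) (h3 : s + ℓ ≤ n) :
    n.choose k * (k.choose (k - ℓ) * (n - k).choose (s - (k - ℓ))) =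
      n.choose s * (s.choose (k - ℓ) * (n - s).choose ℓ) := by
  obtain ⟨a, rfl⟩ := Nat.exists_eq_add_of_le' h1
  obtain ⟨b, rfl⟩ : ∃ b, s = a + b := Nat.exists_eq_add_of_le (by omega)
  obtain ⟨r, rfl⟩ := Nat.exists_eq_add_of_le h3
  have e1 : a + b + ℓ + r = (a + ℓ) + (b + r) := by ring
  have e2 : a + b + ℓ + r = (a + b) + (ℓ + r) := by ring
  rw [Nat.add_sub_cancel, Nat.add_sub_cancel_left]
  have f1 : a + b + ℓ + r - (a + ℓ) = b + r := by omega
  have f2 : a + b + ℓ + r - (a + b) = ℓ + r := by omega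
  rw [f1, f2]
  have hg : ∀ i j : ℕ, (i + j).choose i * i.factorial * j.factorial = (i + j).factorial := by
    intro i j
    have := Nat.choose_mul_factorial_mul_factorial (Nat.le_add_right i j)
    rwa [Nat.add_sub_cancel_left] at this
  have g1 := hg (a + ℓ) (b + r)
  have g2 := hg (a + b) (ℓ + r)
  have g3 := hg a ℓ
  have g4 := hg b r
  have g5 := hg a b
  have g6 := hg ℓ r
  rw [← e1] at g1
  rw [← e2] at g2
  have hpos : 0 < a.factorial * ℓ.factorial * b.factorial * r.factorial := by positivity
  refine Nat.eq_of_mul_eq_mul_right hpos ?_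
  calc _ = (a + b + ℓ + r).choose (a + ℓ) * ((a + ℓ).choose a * a.factorial * ℓ.factorial) *
        ((b + r).choose b * b.factorial * r.factorial) := by ring
    _ = (a + b + ℓ + r).choose (a + b) * ((a + b).choose a * a.factorial * b.factorial) *
        ((ℓ + r).choose ℓ * ℓ.factorial * r.factorial) := by
      rw [g3, g4, g5, g6, g1, g2]
    _ = _ := by ring

/-- The sets of size `s` that contain all but at most `ℓ` elements of `S`. -/
def almostSupersets {n : ℕ} (S : Finset (Fin n)) (s ℓ : ℕ) : Finset (Finset (Fin n)) :=
  (Finset.univ.powersetCard s).filter fun A => (S \ A).card ≤ ℓ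

/-- It is enough to count the sets that miss exactly `ℓ` elements of `S`; they are determined by
their parts inside and outside `S`. -/
theorem card_almostSupersets {n k s ℓ : ℕ} (S : Finset (Fin n)) (hS : S.card = k)
    (h1 : ℓ ≤ k) (h2 : k ≤ s + ℓ) :
    k.choose (k - ℓ) * (n - k).choose (s - (k - ℓ)) ≤ (almostSupersets S s ℓ).card := by
  have hc : Sᶜ.card = n - k := by rw [Finset.card_compl, hS, Fintype.card_fin]
  rw [← hc, ← hS, ← Finset.card_powersetCard, ← Finset.card_powersetCard, ← Finset.card_product]
  refine Finset.card_le_card_of_injOn (fun q => q.1 ∪ q.2) ?_ ?_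
  · rintro ⟨A, B⟩ hq
    simp only [Finset.coe_product, Set.mem_prod, Finset.mem_coe, Finset.mem_powersetCard] at hq
    obtain ⟨⟨hA, hAc⟩, hB, hBc⟩ := hq
    have hdis : Disjoint A B := Finset.disjoint_left.2 fun x hx hx' =>
      Finset.mem_compl.1 (hB hx') (hA hx)
    simp only [almostSupersets, Finset.coe_filter, Set.mem_ofPred_eq, Finset.mem_powersetCard]
    refine ⟨⟨Finset.subset_univ _, ?_⟩, ?_⟩
    · rw [Finset.card_union_of_disjoint hdis, hAc, hBc, hS]
      omega
    · refine (Finset.card_le_card (Finset.sdiff_subset_sdiff le_rfl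
        Finset.subset_union_left)).trans ?_
      rw [Finset.card_sdiff_of_subset hA, hAc]
      omega
  · rintro ⟨A, B⟩ hq ⟨A', B'⟩ hq' he
    simp only [Finset.coe_product, Set.mem_prod, Finset.mem_coe, Finset.mem_powersetCard] at hq hq'
    simp only at he
    have key : ∀ A B : Finset (Fin n), A ⊆ S → B ⊆ Sᶜ → (A ∪ B) ∩ S = A ∧ (A ∪ B) ∩ Sᶜ = B := by
      intro A B hA hB
      constructor
      · ext x
        have := @hA x
        have := @hB x
        simp only [Finset.mem_inter, Finset.mem_union, Finset.mem_compl] at *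
        tauto
      · ext x
        have := @hA x
        have := @hB x
        simp only [Finset.mem_inter, Finset.mem_union, Finset.mem_compl] at *
        tauto
    have k1 := key A B hq.1.1 hq.2.1
    have k2 := key A' B' hq'.1.1 hq'.2.1
    rw [he] at k1
    exact Prod.ext (k1.1.symm.trans k2.1) (k1.2.symm.trans k2.2)

/-- The bias with which the algorithm samples elements: a dyadic approximation of `s / n`. -/
def bias (n s : ℕ) : ℝ := ((s * 2 ^ n / n : ℕ) : ℝ) / 2 ^ n

theorem bias_nonneg (n s : ℕ) : 0 ≤ bias n s := by unfold bias; positivity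

theorem bias_le (n s : ℕ) : bias n s ≤ s / n := by
  have : ((s * 2 ^ n / n : ℕ) : ℝ) ≤ ((s * 2 ^ n : ℕ) : ℝ) / n := Nat.cast_div_le
  rw [bias, div_le_iff₀ (by positivity)]
  refine this.trans (le_of_eq ?_)
  push_cast
  ring

/-- Rounding `s / n` down to a multiple of `2 ^ (-n)` has relative error at most `n / (s * 2 ^ n)`.
By Bernoulli's inequality the `s`-th power keeps at least the fraction `1 - n / 2 ^ n ≥ 1 / 2`. -/
theorem half_le_bias_pow {n s : ℕ} (hs : 1 ≤ s) (hn : s ≤ n) :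
    ((s : ℝ) / n) ^ s ≤ 2 * bias n s ^ s := by
  have hn0 : (0 : ℝ) < n := by exact_mod_cast hs.trans hn
  have hs0 : (0 : ℝ) < s := by exact_mod_cast hs
  have h2n : (2 * n : ℝ) ≤ 2 ^ n := by
    obtain ⟨m, rfl⟩ := Nat.exists_eq_add_of_le' (hs.trans hn)
    have : m + 1 ≤ 2 ^ m := Nat.lt_two_pow_self
    have h : (((m + 1 : ℕ) : ℕ) : ℝ) ≤ 2 ^ m := by exact_mod_cast this
    rw [pow_succ]
    linarith
  have hp : (0 : ℝ) < 2 ^ n := by positivity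
  set a : ℝ := -(n / (s * 2 ^ n)) with ha
  have h1 : (s : ℝ) / n * (1 + a) ≤ bias n s := by
    have h3 : s * 2 ^ n < (s * 2 ^ n / n + 1) * n := by
      rw [mul_comm _ n]
      exact Nat.lt_mul_div_succ _ (hs.trans hn)
    have h4 : (s * 2 ^ n : ℝ) < ((s * 2 ^ n / n : ℕ) + 1) * n := by exact_mod_cast h3
    rw [bias, le_div_iff₀ hp, ha]
    have h5 : (s : ℝ) / n * (1 + -(n / (s * 2 ^ n))) * 2 ^ n = s * 2 ^ n / n - 1 := by
      field_simp
      ring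
    rw [h5, sub_le_iff_le_add, div_le_iff₀ hn0]
    exact h4.le
  have ha1 : 0 ≤ 1 + a := by
    have : n / (s * 2 ^ n) ≤ (1 : ℝ) := by
      rw [div_le_one (by positivity)]
      have : (1 : ℝ) ≤ s := by exact_mod_cast hs
      nlinarith
    linarith
  have h2 : 1 / 2 ≤ (1 + a) ^ s := by
    refine le_trans ?_ (one_add_mul_le_pow (by linarith) s)
    have : (s : ℝ) * a = -(n / 2 ^ n) := by rw [ha]; field_simp
    rw [this]
    have : (n : ℝ) / 2 ^ n ≤ 1 / 2 := by
      rw [div_le_div_iff₀ hp (by norm_num)]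
      linarith
    linarith
  have h6 : ((s : ℝ) / n * (1 + a)) ^ s ≤ bias n s ^ s :=
    pow_le_pow_left₀ (by positivity) h1 s
  rw [mul_pow] at h6
  have h7 : 0 ≤ ((s : ℝ) / n) ^ s := by positivity
  nlinarith

/-- The last factor is the probability that a biased sample has size exactly `s` and almost contains
`S`. Size `s` is the mode for bias `s / n`, which costs `n + 1`, and rounding the bias costs `2`.
All `s`-sets are equally likely, so double counting reduces the rest to `estimate`. -/
theorem GoodParams.le_prob {α β M Q d : ℝ} {n k s ℓ : ℕ} (h : GoodParams α β M Q d n k s ℓ)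
    (hM : 0 ≤ M) (hQ : 0 ≤ Q) (hd : 0 ≤ d) (S : Finset (Fin n)) (hS : S.card = k) :
    M ^ ℓ ≤ 2 * Q * (n + 1) ^ 2 * d ^ n *
      ((almostSupersets S s ℓ).card * (bias n s ^ s * (1 - bias n s) ^ (n - s))) := by
  have hsn : s ≤ n := by have := h.add_le; omega
  have hn0 : (0 : ℝ) < n := by exact_mod_cast h.one_le.trans hsn
  have hkn : k ≤ n := by rw [← hS]; simpa using Finset.card_le_univ S
  have h1 : (n.choose s * (s.choose (k - ℓ) * (n - s).choose ℓ) : ℝ) ≤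
      n.choose k * (almostSupersets S s ℓ).card := by
    have := choose_mul_choose_mul_choose h.le_opt h.opt_le h.add_le
    have h2 := Nat.mul_le_mul_left (n.choose k) (card_almostSupersets S hS h.le_opt h.opt_le)
    rw [this] at h2
    exact_mod_cast h2
  have hk0 : (0 : ℝ) < n.choose k := by exact_mod_cast Nat.choose_pos hkn
  have h2 : M ^ ℓ * n.choose s ≤ Q * (n + 1) * d ^ n * (almostSupersets S s ℓ).card := by
    refine le_of_mul_le_mul_right ?_ hk0
    calc M ^ ℓ * n.choose s * n.choose k = n.choose s * (M ^ ℓ * n.choose k) := by ring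
      _ ≤ n.choose s * (Q * (n + 1) * d ^ n * (s.choose (k - ℓ) * (n - s).choose ℓ)) :=
        mul_le_mul_of_nonneg_left h.estimate (by positivity)
      _ = Q * (n + 1) * d ^ n * (n.choose s * (s.choose (k - ℓ) * (n - s).choose ℓ)) := by ring
      _ ≤ Q * (n + 1) * d ^ n * (n.choose k * (almostSupersets S s ℓ).card) := by gcongr
      _ = _ := by ring
  set p := bias n s with hp
  have hp0 : 0 ≤ p := bias_nonneg n s
  have hp1 : 1 - (s : ℝ) / n ≤ 1 - p := by linarith [bias_le n s]
  have hsn' : 0 ≤ 1 - (s : ℝ) / n := by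
    rw [sub_nonneg, div_le_one hn0]
    exact_mod_cast hsn
  have h3 : 1 ≤ (n + 1) * (n.choose s * (2 * p ^ s * (1 - p) ^ (n - s))) := by
    have h4 : ((n ^ n : ℕ) : ℝ) ≤ (((n + 1) * (n.choose s * s ^ s * (n - s) ^ (n - s)) : ℕ) : ℝ) :=
      Nat.cast_le.2 (pow_self_le_choose hsn)
    push_cast [Nat.cast_sub hsn] at h4
    have h5 : ((s : ℝ) / n) ^ s * (1 - (s : ℝ) / n) ^ (n - s) =
        (s : ℝ) ^ s * ((n : ℝ) - s) ^ (n - s) / (n : ℝ) ^ n := by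
      rw [show 1 - (s : ℝ) / n = ((n : ℝ) - s) / n by field_simp, div_pow, div_pow,
        div_mul_div_comm, ← pow_add, Nat.add_sub_cancel' hsn]
    have h6 : 1 ≤ (n + 1) * (n.choose s * (((s : ℝ) / n) ^ s * (1 - (s : ℝ) / n) ^ (n - s))) := by
      rw [h5, ← mul_div_assoc, ← mul_div_assoc, le_div_iff₀ (by positivity), one_mul]
      refine h4.trans (le_of_eq ?_)
      ring
    refine h6.trans ?_
    gcongr
    exact half_le_bias_pow h.one_le hsn
  have h1p : 0 ≤ 1 - p := by linarith
  calc M ^ ℓ ≤ M ^ ℓ * ((n + 1) * (n.choose s * (2 * p ^ s * (1 - p) ^ (n - s)))) :=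
        le_mul_of_one_le_right (by positivity) h3
    _ = M ^ ℓ * n.choose s * ((n + 1) * (2 * p ^ s * (1 - p) ^ (n - s))) := by ring
    _ ≤ Q * (n + 1) * d ^ n * (almostSupersets S s ℓ).card *
        ((n + 1) * (2 * p ^ s * (1 - p) ^ (n - s))) := by gcongr
    _ = _ := by ring

/-! ### A program logic -/

infixr:65 " ;; " => Prog.seq

/-- The program does not write into register `r` (and does not use indirect addressing). -/
def Prog.keeps {ι : Type} (r : ℕ) : Prog ι → Bool
  | .const z _ => r != z
  | .op _ z _ _ => r != z
  | .load z _ => r != z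
  | .store _ _ => false
  | .flip z => r != z
  | .query _ z _ _ => r != z
  | .seq p q => p.keeps r && q.keeps r
  | .ite _ p q => p.keeps r && q.keeps r
  | .loop _ p => p.keeps r

section Logic

variable {n : ℕ} {L : Finset (ℝ × ℝ)} {F : Set (Finset (Fin n))}
  (O : ∀ j : L, ExtOracle F j.1.1) (fuel : ℕ)

theorem runLoop_invariant {x : ℕ} {b : Config → PMF (Option Config)} {P : Config → Prop}
    (hb : ∀ s t, P s → some t ∈ (b s).support → P t) (hpay : ∀ s a, P s → P (s.pay a)) :
    ∀ fuel s t, P s → some t ∈ (runLoop x b fuel s).support → P t := by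
  intro fuel
  induction fuel with
  | zero => intro s t _ h; simp [runLoop] at h
  | succ fuel ih =>
    intro s t hs h
    simp only [runLoop] at h
    split_ifs at h
    · simp only [PMF.support_pure, Set.mem_singleton_iff, Option.some.injEq] at h
      exact h ▸ hpay s _ hs
    · obtain ⟨a, ha, hat⟩ := some_mem_support_andThen.1 h
      exact ih a t (hb _ a (hpay s _ hs) ha) hat

theorem exec_keeps {r : ℕ} {p : Prog L} (hp : p.keeps r = true) {s t : Config}
    (h : some t ∈ (exec O fuel p s).support) : t.mem r = s.mem r := by
  induction p generalizing s t with
  | const z k =>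
    simp only [exec, PMF.support_pure, Set.mem_singleton_iff, Option.some.injEq] at h
    simp only [Prog.keeps, bne_iff_ne] at hp
    rw [h]; simp [Config.write, Function.update_of_ne hp]
  | op o z x y =>
    simp only [exec, PMF.support_pure, Set.mem_singleton_iff, Option.some.injEq] at h
    simp only [Prog.keeps, bne_iff_ne] at hp
    rw [h]; simp [Config.write, Function.update_of_ne hp]
  | load z x =>
    simp only [exec, PMF.support_pure, Set.mem_singleton_iff, Option.some.injEq] at h
    simp only [Prog.keeps, bne_iff_ne] at hp
    rw [h]; simp [Config.write, Function.update_of_ne hp]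
  | store x y => simp [Prog.keeps] at hp
  | flip z =>
    simp only [exec, PMF.support_map, Set.mem_image, Option.some.injEq] at h
    simp only [Prog.keeps, bne_iff_ne] at hp
    obtain ⟨b, -, rfl⟩ := h
    simp [Config.write, Function.update_of_ne hp]
  | query j z x y =>
    simp only [exec, PMF.support_map, Set.mem_image, Option.some.injEq] at h
    simp only [Prog.keeps, bne_iff_ne] at hp
    obtain ⟨b, -, rfl⟩ := h
    simp [Config.write, Function.update_of_ne hp]
  | seq p q ihp ihq =>
    simp only [Prog.keeps, Bool.and_eq_true] at hp
    obtain ⟨a, ha, hat⟩ := some_mem_support_andThen.1 h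
    rw [ihq hp.2 hat, ihp hp.1 ha]
  | ite x p q ihp ihq =>
    simp only [Prog.keeps, Bool.and_eq_true] at hp
    simp only [exec] at h
    split_ifs at h
    · exact ihq hp.2 (s := s.pay _) h
    · exact ihp hp.1 (s := s.pay _) h
  | loop x p ihp =>
    exact runLoop_invariant (P := fun u => u.mem r = s.mem r)
      (fun u v hu hv => (ihp hp hv).trans hu) (fun u a hu => hu) fuel s t rfl h

/-- Every execution of `p` from registers `m` halts with registers that satisfy `Q`, at a cost of
at most `K`. -/
def Spec (p : Prog L) (m : ℕ → ℕ) (K : ℝ) (Q : (ℕ → ℕ) → Prop) : Prop :=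
  ∀ c : ℝ, ∀ o ∈ (exec O fuel p ⟨m, c⟩).support,
    ∃ m' c', o = some ⟨m', c'⟩ ∧ Q m' ∧ c' ≤ c + K

/-- With probability at least `q`, running `p` from registers `m` results in registers that
satisfy `Q`. -/
def Pr (p : Prog L) (m : ℕ → ℕ) (q : ℝ) (Q : (ℕ → ℕ) → Prop) : Prop :=
  ∀ c : ℝ, ENNReal.ofReal q ≤
    expect (exec O fuel p ⟨m, c⟩) 0 (Set.indicator {s | Q s.mem} 1)

variable {O fuel} {p q : Prog L} {m : ℕ → ℕ} {K K' : ℝ} {Q R : (ℕ → ℕ) → Prop}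

theorem Spec.mono (h : Spec O fuel p m K Q) (hK : K ≤ K') (hQ : ∀ m', Q m' → R m') :
    Spec O fuel p m K' R := by
  intro c o ho
  obtain ⟨m', c', h1, h2, h3⟩ := h c o ho
  exact ⟨m', c', h1, hQ _ h2, by linarith⟩

/-- A syntactic frame rule: specifications need to mention only the registers that a program
changes. -/
theorem Spec.frame (h : Spec O fuel p m K Q) :
    Spec O fuel p m K (fun m' => Q m' ∧ ∀ r, p.keeps r = true → m' r = m r) := by
  intro c o ho
  obtain ⟨m', c', rfl, h2, h3⟩ := h c o ho
  exact ⟨m', c', rfl, ⟨h2, fun r hr => exec_keeps O fuel hr ho⟩, h3⟩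

theorem spec_seq (h : Spec O fuel p m K Q)
    (h' : ∀ m', Q m' → (∀ r, p.keeps r = true → m' r = m r) → Spec O fuel q m' K' R) :
    Spec O fuel (p ;; q) m (K + K') R := by
  intro c o ho
  cases o with
  | none =>
    rcases none_mem_support_andThen.1 ho with ha | ⟨a, ha, hat⟩
    · obtain ⟨m', c', h1, -⟩ := h.frame c _ ha
      simp at h1
    · obtain ⟨m', c', h1, ⟨h2, h2'⟩, h3⟩ := h.frame c _ ha
      obtain rfl := Option.some.inj h1
      obtain ⟨m'', c'', h4, -⟩ := h' m' h2 h2' c' _ hat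
      simp at h4
  | some t =>
    obtain ⟨a, ha, hat⟩ := some_mem_support_andThen.1 ho
    obtain ⟨m', c', h1, ⟨h2, h2'⟩, h3⟩ := h.frame c _ ha
    obtain rfl := Option.some.inj h1
    obtain ⟨m'', c'', h4, h5, h6⟩ := h' m' h2 h2' c' _ hat
    exact ⟨m'', c'', h4, h5, by linarith⟩

theorem size_le_of_lt {v W : ℕ} (h : v < 2 ^ W) : (Nat.size v : ℝ) ≤ W := by
  exact_mod_cast Nat.size_le.2 h

/-- The uniform price `3 * W + 1` of an elementary operation is one plus the lengths of at most
three words of `W` bits. -/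
theorem spec_const {z k W : ℕ} (hk : k < 2 ^ W) (h : Q (Function.update m z k)) :
    Spec O fuel (.const z k) m (3 * W + 1) Q := by
  intro c o ho
  simp only [exec, PMF.support_pure, Set.mem_singleton_iff] at ho
  have := size_le_of_lt hk
  exact ⟨_, _, ho, h, by simp only; nlinarith [(Nat.cast_nonneg W : (0 : ℝ) ≤ W)]⟩

theorem spec_op {o : Op} {z x y W : ℕ} (hx : m x < 2 ^ W) (hy : m y < 2 ^ W)
    (hv : o.eval (m x) (m y) < 2 ^ W) (h : Q (Function.update m z (o.eval (m x) (m y)))) :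
    Spec O fuel (.op o z x y) m (3 * W + 1) Q := by
  intro c o ho
  simp only [exec, PMF.support_pure, Set.mem_singleton_iff] at ho
  have h1 := size_le_of_lt hx
  have h2 := size_le_of_lt hy
  have h3 := size_le_of_lt hv
  exact ⟨_, _, ho, h, by simp only; linarith⟩

theorem spec_flip {z W : ℕ} (h : ∀ b : Bool, Q (Function.update m z b.toNat)) :
    Spec O fuel (.flip z) m (3 * W + 1) Q := by
  intro c o ho
  simp only [exec, PMF.support_map, Set.mem_image] at ho
  obtain ⟨b, -, rfl⟩ := ho
  exact ⟨_, _, rfl, h b, by simp only; nlinarith [(Nat.cast_nonneg W : (0 : ℝ) ≤ W)]⟩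

theorem sum_toNat_mul_two_pow {n : ℕ} (f : Fin n → Bool) :
    ∑ i, (f i).toNat * 2 ^ (i : ℕ) = Nat.ofBits f := by
  induction n with
  | zero => simp
  | succ n ih =>
    rw [Fin.sum_univ_succ, Nat.ofBits_succ, ← ih, Finset.mul_sum, add_comm]
    simp [pow_succ]
    exact Finset.sum_congr rfl fun i _ => by ring

theorem encode_lt_and_testBit {n : ℕ} (S : Finset (Fin n)) :
    encode S < 2 ^ n ∧ ∀ i : Fin n, (encode S).testBit i = decide (i ∈ S) := by
  have h1 : encode S = Nat.ofBits fun i => decide (i ∈ S) := by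
    rw [← sum_toNat_mul_two_pow, encode, ← Finset.sum_subset (Finset.subset_univ S)]
    · exact Finset.sum_congr rfl fun i hi => by simp [hi]
    · intro i _ hi
      simp [hi]
  rw [h1]
  refine ⟨Nat.ofBits_lt_two_pow _, fun i => ?_⟩
  rw [Nat.testBit_ofBits_lt _ _ i.2]

theorem encode_lt {n : ℕ} (S : Finset (Fin n)) : encode S < 2 ^ n := (encode_lt_and_testBit S).1

theorem decode_encode {n : ℕ} (S : Finset (Fin n)) : decode n (encode S) = S := by
  ext i
  simp [decode, (encode_lt_and_testBit S).2 i]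

theorem decode_lor {n : ℕ} (a b : ℕ) : decode n (a ||| b) = decode n a ∪ decode n b := by
  ext i
  simp [decode]

theorem spec_query {j : L} {z x y W : ℕ} (hx : m x < 2 ^ W) (hy : m y < 2 ^ W) (hn : n ≤ W)
    (h : ∀ S, decode n (m x) ∪ S ∈ F → Q (Function.update m z (encode S))) :
    Spec O fuel (.query j z x y) m (j.1.2 ^ m y + (3 * W + 1)) Q := by
  intro c o ho
  simp only [exec, PMF.support_map, Set.mem_image] at ho
  obtain ⟨r, -, rfl⟩ := ho
  have h1 := size_le_of_lt hx
  have h2 := size_le_of_lt hy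
  have h3 := size_le_of_lt ((encode_lt ((O j).ans (decode n (m x)) (m y) r)).trans_le
    (Nat.pow_le_pow_right (by norm_num) hn))
  exact ⟨_, _, rfl, h _ ((O j).ans_mem _ _ _), by simp only; linarith⟩

theorem spec_ite {x W : ℕ} (hx : m x < 2 ^ W) (h0 : m x = 0 → Spec O fuel q m K Q)
    (h1 : m x ≠ 0 → Spec O fuel p m K Q) :
    Spec O fuel (.ite x p q) m (3 * W + 1 + K) Q := by
  intro c o ho
  have hs := size_le_of_lt hx
  have hW : (0 : ℝ) ≤ W := Nat.cast_nonneg W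
  simp only [exec] at ho
  split_ifs at ho with h
  · obtain ⟨m', c', e, hQ, hc⟩ := h0 h _ o ho
    exact ⟨m', c', e, hQ, by linarith⟩
  · obtain ⟨m', c', e, hQ, hc⟩ := h1 h _ o ho
    exact ⟨m', c', e, hQ, by linarith⟩

/-- All loops count register `x` down, so `i` is the number of iterations left. The final test,
which finds zero, uses fuel as well (hence `N < fuel`) and is the last summand of the cost. -/
theorem spec_loop {x N W : ℕ} {I : ℕ → (ℕ → ℕ) → Prop} (hN : m x = N) (hf : N < fuel)
    (hW : N < 2 ^ W) (hI : I N m)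
    (h : ∀ i m', i < N → I (i + 1) m' → m' x = i + 1 → (∀ r, p.keeps r = true → m' r = m r) →
      Spec O fuel p m' K fun m'' => I i m'' ∧ m'' x = i) :
    Spec O fuel (.loop x p) m (N * (K + (3 * W + 1)) + (3 * W + 1))
      fun m' => I 0 m' ∧ m' x = 0 := by
  have hW0 : (0 : ℝ) ≤ W := Nat.cast_nonneg W
  have key : ∀ i ≤ N, ∀ (f : ℕ) (m' : ℕ → ℕ), i < f → I i m' → m' x = i →
      (∀ r, p.keeps r = true → m' r = m r) → ∀ c : ℝ,
      ∀ o ∈ (runLoop x (exec O fuel p) f ⟨m', c⟩).support, ∃ m'' c', o = some ⟨m'', c'⟩ ∧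
        (I 0 m'' ∧ m'' x = 0) ∧ c' ≤ c + (i * (K + (3 * W + 1)) + (3 * W + 1)) := by
    intro i
    induction i with
    | zero =>
      intro _ f m' hf' hI' hx hk c o ho
      obtain ⟨f, rfl⟩ := Nat.exists_eq_add_of_le' (Nat.succ_le_of_lt hf')
      simp only [runLoop, hx, if_true, PMF.support_pure, Set.mem_singleton_iff] at ho
      exact ⟨_, _, ho, ⟨hI', hx⟩, by simp⟩
    | succ i ih =>
      intro hi f m' hf' hI' hx hk c o ho
      obtain ⟨f, rfl⟩ : ∃ g, f = g + 1 := ⟨f - 1, by omega⟩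
      simp only [runLoop, hx, Nat.add_one_ne_zero, if_false] at ho
      have hb := (h i m' hi hI' hx hk).frame
      have hsz : (Nat.size (i + 1) : ℝ) ≤ W := size_le_of_lt (hi.trans_lt hW)
      cases o with
      | none =>
        rcases none_mem_support_andThen.1 ho with ha | ⟨a, ha, hat⟩
        · obtain ⟨_, _, h1, -⟩ := hb _ _ ha
          simp at h1
        · obtain ⟨m₁, c₁, h1, ⟨⟨hI₁, hx₁⟩, hk₁⟩, hc₁⟩ := hb _ _ ha
          obtain rfl := Option.some.inj h1
          obtain ⟨_, _, h4, -⟩ := ih (by omega) f m₁ (by omega) hI₁ hx₁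
            (fun r hr => (hk₁ r hr).trans (hk r hr)) c₁ _ hat
          simp at h4
      | some t =>
        obtain ⟨a, ha, hat⟩ := some_mem_support_andThen.1 ho
        obtain ⟨m₁, c₁, h1, ⟨⟨hI₁, hx₁⟩, hk₁⟩, hc₁⟩ := hb _ _ ha
        obtain rfl := Option.some.inj h1
        obtain ⟨m₂, c₂, h4, h5, h6⟩ := ih (by omega) f m₁ (by omega) hI₁ hx₁
          (fun r hr => (hk₁ r hr).trans (hk r hr)) c₁ _ hat
        refine ⟨m₂, c₂, h4, h5, ?_⟩
        push_cast
        nlinarith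
  exact fun c o ho => key N le_rfl fuel m hf hI hN (fun _ _ => rfl) c o ho

theorem Pr.mono {a b : ℝ} (h : Pr O fuel p m a Q) (hab : b ≤ a) (hQ : ∀ m', Q m' → R m') :
    Pr O fuel p m b R := by
  intro c
  refine (ENNReal.ofReal_le_ofReal hab).trans ((h c).trans (expect_mono _ _ fun s _ => ?_))
  exact Set.indicator_le_indicator_of_subset (fun s hs => hQ _ hs) (fun _ => zero_le) s

theorem Spec.pr (h : Spec O fuel p m K Q) : Pr O fuel p m 1 Q := by
  intro c
  rw [ENNReal.ofReal_one, expect, ← (exec O fuel p ⟨m, c⟩).tsum_coe]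
  refine ENNReal.tsum_le_tsum fun o => ?_
  by_cases ho : o ∈ (exec O fuel p ⟨m, c⟩).support
  · obtain ⟨m', c', rfl, hQ, -⟩ := h c o ho
    simp [hQ]
  · rw [PMF.mem_support_iff, not_not] at ho
    simp [ho]

theorem Pr.and {a : ℝ} (h : Pr O fuel p m a Q) (h' : Spec O fuel p m K R) :
    Pr O fuel p m a (fun m' => Q m' ∧ R m') := by
  intro c
  refine (h c).trans (expect_mono _ _ fun s hs => ?_)
  obtain ⟨m', c', e, hR, -⟩ := h' c _ hs
  obtain rfl := Option.some.inj e
  by_cases hQ : Q m' <;> simp [hQ, hR]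

theorem expect_mul_const {A : Type} (D : PMF (Option A)) (φ : A → ENNReal) (w : ENNReal) :
    expect D 0 (fun a => φ a * w) = expect D 0 φ * w := by
  rw [expect, expect, ← ENNReal.tsum_mul_right]
  refine tsum_congr ?_
  rintro (_ | a) <;> simp [mul_assoc]

theorem le_expect_andThen {D : PMF (Option Config)} {f : Config → PMF (Option Config)}
    {φ : Config → ENNReal} {a b : ℝ} (ha : 0 ≤ a)
    (h : ENNReal.ofReal a ≤ expect D 0 (Set.indicator {s | Q s.mem} 1))
    (h' : ∀ s, some s ∈ D.support → Q s.mem → ENNReal.ofReal b ≤ expect (f s) 0 φ) :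
    ENNReal.ofReal (a * b) ≤ expect (andThen D f) 0 φ := by
  rw [expect_andThen, ENNReal.ofReal_mul ha]
  refine (mul_le_mul' h le_rfl).trans ?_
  rw [← expect_mul_const]
  refine expect_mono _ _ fun s hs => ?_
  by_cases hQ : Q s.mem
  · simpa [hQ] using h' s hs hQ
  · simp [hQ]

theorem pr_seq {a b : ℝ} (ha : 0 ≤ a) (h : Pr O fuel p m a Q)
    (h' : ∀ m', Q m' → (∀ r, p.keeps r = true → m' r = m r) → Pr O fuel q m' b R) :
    Pr O fuel (p ;; q) m (a * b) R := by
  intro c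
  exact le_expect_andThen ha (h c) fun s hs hQ =>
    h' s.mem hQ (fun r hr => exec_keeps O fuel hr hs) s.cost

theorem pr_seq_spec {b : ℝ} (h : Spec O fuel p m K Q)
    (h' : ∀ m', Q m' → (∀ r, p.keeps r = true → m' r = m r) → Pr O fuel q m' b R) :
    Pr O fuel (p ;; q) m b R :=
  one_mul b ▸ pr_seq zero_le_one h.pr h'

theorem pr_flip {z : ℕ} (b : Bool) (h : Q (Function.update m z b.toNat)) :
    Pr O fuel (.flip z) m (1 / 2) Q := by
  intro c
  simp only [exec]
  rw [expect_bind_pure, tsum_fintype]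
  refine le_trans ?_ (Finset.single_le_sum (fun _ _ => zero_le) (Finset.mem_univ b))
  have : (Config.write ⟨m, c⟩ z b.toNat 1).mem = Function.update m z b.toNat := rfl
  simp [this, h]

theorem pr_query {j : L} {z x y : ℕ} (hex : ∃ S, IsExtension F (m y) (decode n (m x)) S)
    (h : ∀ S, IsExtension F (j.1.1 * m y) (decode n (m x)) S →
      Q (Function.update m z (encode S))) :
    Pr O fuel (.query j z x y) m (1 / 2) Q := by
  classical
  intro c
  simp only [exec]
  rw [expect_bind_pure, tsum_fintype]
  have h1 := (O j).ans_good (decode n (m x)) (m y) hex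
  set G : Finset (Fin (O j).bits → Bool) := Finset.univ.filter fun r =>
    IsExtension F (j.1.1 * m y) (decode n (m x)) ((O j).ans (decode n (m x)) (m y) r) with hG
  have h2 : Nat.card {r : Fin (O j).bits → Bool //
      IsExtension F (j.1.1 * m y) (decode n (m x)) ((O j).ans (decode n (m x)) (m y) r)} =
      G.card := by
    rw [Nat.card_eq_fintype_card, Fintype.card_subtype]
  rw [h2, Nat.card_eq_fintype_card] at h1
  set N := Fintype.card (Fin (O j).bits → Bool) with hN
  have hN0 : (0 : ℝ) < N := by exact_mod_cast Fintype.card_pos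
  calc ENNReal.ofReal (1 / 2) ≤ ENNReal.ofReal (G.card * (N : ℝ)⁻¹) := by
        refine ENNReal.ofReal_le_ofReal ?_
        rw [← div_eq_mul_inv, le_div_iff₀ hN0]
        exact h1
    _ = ∑ r ∈ G, (N : ENNReal)⁻¹ := by
        rw [Finset.sum_const, nsmul_eq_mul, ENNReal.ofReal_mul (by positivity),
          ENNReal.ofReal_natCast, ENNReal.ofReal_inv_of_pos hN0, ENNReal.ofReal_natCast]
    _ ≤ _ := by
        refine le_trans (Finset.sum_le_sum fun r hr => ?_)
          (Finset.sum_le_sum_of_subset (Finset.subset_univ G))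
        have hr := h _ (Finset.mem_filter.1 hr).2
        rw [PMF.uniformOfFintype_apply, Set.indicator_of_mem]
        · simp [hN]
        · exact hr

theorem pr_sum {ι : Type} (S : Finset ι) {a : ι → ℝ} {P : ι → (ℕ → ℕ) → Prop}
    (ha : ∀ i ∈ S, 0 ≤ a i) (h : ∀ i ∈ S, Pr O fuel p m (a i) (P i))
    (hdis : ∀ i j m', P i m' → P j m' → i = j) (hQ : ∀ i ∈ S, ∀ m', P i m' → Q m') :
    Pr O fuel p m (∑ i ∈ S, a i) Q := by
  classical
  intro c
  rw [ENNReal.ofReal_sum_of_nonneg ha]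
  refine (Finset.sum_le_sum fun i hi => h i hi c).trans ?_
  simp only [expect]
  rw [← Summable.tsum_finsetSum (fun _ _ => ENNReal.summable)]
  refine ENNReal.tsum_le_tsum fun o => ?_
  rw [← Finset.mul_sum]
  gcongr
  rcases o with _ | s
  · simp
  · simp only [Option.elim]
    by_cases hs : ∃ i ∈ S, P i s.mem
    · obtain ⟨i, hi, hP⟩ := hs
      rw [Finset.sum_eq_single i]
      · simp [hP, hQ i hi _ hP]
      · intro j _ hj
        have : ¬ P j s.mem := fun hP' => hj (hdis _ _ _ hP' hP)
        simp [this]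
      · exact fun h => absurd hi h
    · rw [Finset.sum_eq_zero]
      · exact zero_le
      · intro i hi
        have : ¬ P i s.mem := fun h => hs ⟨i, hi, h⟩
        simp [this]

theorem pr_loop {x N : ℕ} {I : ℕ → (ℕ → ℕ) → Prop} {w : ℕ → ℝ} (hN : m x = N) (hf : N < fuel)
    (hI : I N m) (hw : ∀ i < N, 0 ≤ w i)
    (h : ∀ i m', i < N → I (i + 1) m' → m' x = i + 1 → (∀ r, p.keeps r = true → m' r = m r) →
      Pr O fuel p m' (w i) fun m'' => I i m'' ∧ m'' x = i) :
    Pr O fuel (.loop x p) m (∏ i ∈ Finset.range N, w i) (I 0) := by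
  have key : ∀ i ≤ N, ∀ (f : ℕ) (m' : ℕ → ℕ), i < f → I i m' → m' x = i →
      (∀ r, p.keeps r = true → m' r = m r) → ∀ c : ℝ,
      ENNReal.ofReal (∏ i ∈ Finset.range i, w i) ≤
        expect (runLoop x (exec O fuel p) f ⟨m', c⟩) 0 (Set.indicator {s | I 0 s.mem} 1) := by
    intro i
    induction i with
    | zero =>
      intro _ f m' hf' hI' hx hk c
      obtain ⟨f, rfl⟩ := Nat.exists_eq_add_of_le' (Nat.succ_le_of_lt hf')
      simp [runLoop, hx, expect_pure, Config.pay, hI']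
    | succ i ih =>
      intro hi f m' hf' hI' hx hk c
      obtain ⟨f, rfl⟩ : ∃ g, f = g + 1 := ⟨f - 1, by omega⟩
      simp only [runLoop, hx, Nat.add_one_ne_zero, if_false]
      rw [Finset.prod_range_succ, mul_comm]
      refine le_expect_andThen (Q := fun m'' => I i m'' ∧ m'' x = i) (hw i hi)
        (h i m' hi hI' hx hk _) ?_
      intro s hs hQ
      exact ih (by omega) f s.mem (by omega) hQ.1 hQ.2
        (fun r hr => (exec_keeps O fuel hr hs).trans (hk r hr)) s.cost
  exact fun c => key N le_rfl fuel m hf hI hN (fun _ _ => rfl) c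

/-- Success in the first stage persists, and otherwise the second stage still succeeds with
probability at least `b`: the failures multiply, as if they were independent. -/
theorem le_expect_andThen_absorb {D : PMF (Option Config)} {f : Config → PMF (Option Config)}
    {φ : Config → ENNReal} {a b : ℝ} (hb0 : 0 ≤ b) (hb : b ≤ 1)
    (hD : none ∉ D.support)
    (h : ENNReal.ofReal a ≤ expect D 0 (Set.indicator {s | Q s.mem} 1))
    (h1 : ∀ s, some s ∈ D.support → Q s.mem → 1 ≤ expect (f s) 0 φ)
    (h' : ∀ s, some s ∈ D.support → ENNReal.ofReal b ≤ expect (f s) 0 φ) :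
    ENNReal.ofReal (1 - (1 - a) * (1 - b)) ≤ expect (andThen D f) 0 φ := by
  have e : 1 - (1 - a) * (1 - b) = b + a * (1 - b) := by ring
  have hle : ENNReal.ofReal (1 - (1 - a) * (1 - b)) ≤
      ENNReal.ofReal b + ENNReal.ofReal a * ENNReal.ofReal (1 - b) := by
    rw [e]
    refine ENNReal.ofReal_add_le.trans (add_le_add le_rfl ?_)
    rcases le_total 0 a with h0 | h0
    · rw [ENNReal.ofReal_mul h0]
    · rw [ENNReal.ofReal_of_nonpos (mul_nonpos_of_nonpos_of_nonneg h0 (by linarith))]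
      exact zero_le
  have hb1 : ENNReal.ofReal b + ENNReal.ofReal (1 - b) = 1 := by
    rw [← ENNReal.ofReal_add hb0 (by linarith)]
    simp
  refine hle.trans ?_
  rw [expect_andThen]
  refine (add_le_add le_rfl (mul_le_mul' h le_rfl)).trans ?_
  rw [← expect_mul_const]
  have hconst : ENNReal.ofReal b = ∑' o, D o * ENNReal.ofReal b := by
    rw [ENNReal.tsum_mul_right, PMF.tsum_coe, one_mul]
  rw [hconst]
  unfold expect
  rw [← ENNReal.tsum_add]
  refine ENNReal.tsum_le_tsum ?_
  rintro (_ | s)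
  · rw [PMF.mem_support_iff, not_not] at hD
    simp [hD]
  · rw [← mul_add]
    by_cases hs : some s ∈ D.support
    · refine mul_le_mul' le_rfl ?_
      by_cases hQ : Q s.mem
      · simpa [hQ, hb1, expect] using h1 s hs hQ
      · simpa [hQ, expect] using h' s hs
    · rw [PMF.mem_support_iff, not_not] at hs
      simp [hs]

/-- If `G` is preserved by the body of a loop, and is reached by the `i`-th iteration with
probability at least `a i`, then it holds in the end unless all iterations fail. -/
theorem pr_loop_absorb {x N : ℕ} {I : ℕ → (ℕ → ℕ) → Prop} {G : (ℕ → ℕ) → Prop} {a : ℕ → ℝ}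
    (hN : m x = N) (hf : N < fuel)
    (hI : I N m) (ha0 : ∀ i < N, 0 ≤ a i) (ha1 : ∀ i < N, a i ≤ 1)
    (hs : ∀ i m', i < N → I (i + 1) m' → m' x = i + 1 → (∀ r, p.keeps r = true → m' r = m r) →
      Spec O fuel p m' K fun m'' => (I i m'' ∧ m'' x = i) ∧ (G m' → G m''))
    (h : ∀ i m', i < N → I (i + 1) m' → m' x = i + 1 → (∀ r, p.keeps r = true → m' r = m r) →
      Pr O fuel p m' (a i) G) :
    Pr O fuel (.loop x p) m (1 - ∏ i ∈ Finset.range N, (1 - a i)) G := by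
  have key : ∀ i ≤ N, ∀ (f : ℕ) (m' : ℕ → ℕ), i < f → I i m' → m' x = i →
      (∀ r, p.keeps r = true → m' r = m r) → ∀ c : ℝ,
      (G m' → 1 ≤ expect (runLoop x (exec O fuel p) f ⟨m', c⟩) 0
        (Set.indicator {s | G s.mem} 1)) ∧
      ENNReal.ofReal (1 - ∏ i ∈ Finset.range i, (1 - a i)) ≤
        expect (runLoop x (exec O fuel p) f ⟨m', c⟩) 0 (Set.indicator {s | G s.mem} 1) := by
    intro i
    induction i with
    | zero =>
      intro _ f m' hf' hI' hx hk c
      obtain ⟨f, rfl⟩ := Nat.exists_eq_add_of_le' (Nat.succ_le_of_lt hf')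
      refine ⟨fun hG => ?_, by simp⟩
      simp [runLoop, hx, expect_pure, Config.pay, hG]
    | succ i ih =>
      intro hi f m' hf' hI' hx hk c
      obtain ⟨f, rfl⟩ : ∃ g, f = g + 1 := ⟨f - 1, by omega⟩
      simp only [runLoop, hx, Nat.add_one_ne_zero, if_false]
      have hb := hs i m' hi hI' hx hk
      have hnone : none ∉ (exec O fuel p (Config.pay ⟨m', c⟩ (1 + Nat.size (i + 1)))).support := by
        intro h0
        obtain ⟨_, _, h1, -⟩ := hb _ _ h0
        simp at h1
      have hnext : ∀ s, some s ∈ (exec O fuel p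
          (Config.pay ⟨m', c⟩ (1 + Nat.size (i + 1)))).support →
          (G m' → G s.mem) ∧ (G s.mem → 1 ≤ expect (runLoop x (exec O fuel p) f s) 0
            (Set.indicator {s | G s.mem} 1)) ∧
          ENNReal.ofReal (1 - ∏ i ∈ Finset.range i, (1 - a i)) ≤
            expect (runLoop x (exec O fuel p) f s) 0 (Set.indicator {s | G s.mem} 1) := by
        intro s hss
        obtain ⟨m₁, c₁, h1, ⟨⟨hI₁, hx₁⟩, hG₁⟩, -⟩ := hb _ _ hss
        obtain rfl := Option.some.inj h1
        have hk' : ∀ r, p.keeps r = true → m₁ r = m r := fun r hr =>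
          (exec_keeps O fuel hr hss).trans (hk r hr)
        exact ⟨hG₁, ih (by omega) f m₁ (by omega) hI₁ hx₁ hk' c₁⟩
      constructor
      · intro hG
        have h1 : Spec O fuel p m' K G := hb.mono le_rfl fun m'' hm => hm.2 hG
        have h2 := le_expect_andThen (Q := G) (b := 1) zero_le_one (h1.pr _) (f :=
          runLoop x (exec O fuel p) f)
          (φ := Set.indicator {s | G s.mem} 1) fun s hss hGs => by
            simpa using (hnext s hss).2.1 hGs
        rwa [one_mul, ENNReal.ofReal_one] at h2
      · rw [Finset.prod_range_succ, mul_comm]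
        have hp0 : 0 ≤ ∏ j ∈ Finset.range i, (1 - a j) := Finset.prod_nonneg fun j hj => by
          have := ha1 j ((Finset.mem_range.1 hj).trans (by omega))
          linarith
        have hp1 : ∏ j ∈ Finset.range i, (1 - a j) ≤ 1 := Finset.prod_le_one
          (fun j hj => by
            have := ha1 j ((Finset.mem_range.1 hj).trans (by omega))
            linarith)
          (fun j hj => by
            have := ha0 j ((Finset.mem_range.1 hj).trans (by omega))
            linarith)
        have := le_expect_andThen_absorb (Q := G) (a := a i)
          (b := 1 - ∏ j ∈ Finset.range i, (1 - a j)) (by linarith) (by linarith)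
          hnone (h i m' hi hI' hx hk _) (fun s hss => (hnext s hss).2.1)
          (fun s hss => (hnext s hss).2.2)
        rwa [sub_sub_cancel] at this
  exact fun c => (key N le_rfl fuel m hf hI hN (fun _ _ => rfl) c).2

end Logic

/-! ### Sampling a random set from coin flips -/

section Sampling

variable {n : ℕ} {L : Finset (ℝ × ℝ)} {F : Set (Finset (Fin n))}
  {O : ∀ j : L, ExtOracle F j.1.1} {fuel : ℕ} {p q : Prog L} {m : ℕ → ℕ} {K : ℝ}
  {Q : (ℕ → ℕ) → Prop} {W : ℕ}

theorem spec_op_seq {o : Op} {z x y : ℕ} (hx : m x < 2 ^ W) (hy : m y < 2 ^ W)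
    (hv : o.eval (m x) (m y) < 2 ^ W)
    (h : Spec O fuel q (Function.update m z (o.eval (m x) (m y))) K Q) :
    Spec O fuel (.op o z x y ;; q) m ((3 * W + 1) + K) Q :=
  spec_seq (spec_op hx hy hv (Q := fun m' => m' = Function.update m z (o.eval (m x) (m y))) rfl)
    fun _ hm' _ => hm' ▸ h

theorem spec_const_seq {z k : ℕ} (hk : k < 2 ^ W)
    (h : Spec O fuel q (Function.update m z k) K Q) :
    Spec O fuel (.const z k ;; q) m ((3 * W + 1) + K) Q :=
  spec_seq (spec_const hk (Q := fun m' => m' = Function.update m z k) rfl)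
    fun _ hm' _ => hm' ▸ h

/-! ### The algorithm

Throughout, register `0` holds `n`, register `1` holds `1` and register `2` holds `0`. -/

/-- Append the bit in register `16` to the number in register `14`. -/
def appendBit {ι : Type} : Prog ι :=
  .op .add 14 14 14 ;; .op .add 14 14 16 ;; .op .sub 15 15 1

/-- Write a uniformly random number below `2 ^ n` into register `14`. -/
def randomBits {ι : Type} : Prog ι :=
  .const 14 0 ;; .op .add 15 0 2 ;; .loop 15 (.flip 16 ;; appendBit)

/-- The registers with constants have the right contents. -/
structure Base (n : ℕ) (m : ℕ → ℕ) : Prop where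
  zero : m 0 = n
  one : m 1 = 1
  two : m 2 = 0

theorem Base.of_keeps {m m' : ℕ → ℕ} (h : Base n m) (hk : ∀ r, p.keeps r = true → m' r = m r)
    (h0 : p.keeps 0 = true := by rfl) (h1 : p.keeps 1 = true := by rfl)
    (h2 : p.keeps 2 = true := by rfl) : Base n m' :=
  ⟨(hk 0 h0).trans h.zero, (hk 1 h1).trans h.one, (hk 2 h2).trans h.two⟩

theorem lt_two_pow_of_le {n W : ℕ} (h : n ≤ W) : n < 2 ^ W :=
  h.trans_lt Nat.lt_two_pow_self

theorem spec_appendBit (h1 : m 1 = 1) (h14 : 2 * m 14 + m 16 < 2 ^ W) (h16 : m 16 ≤ 1)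
    (h15 : m 15 < 2 ^ W) (hW : 1 ≤ W) :
    Spec O fuel appendBit m (3 * (3 * W + 1))
      fun m' => m' 14 = 2 * m 14 + m 16 ∧ m' 15 = m 15 - 1 := by
  have hW1 : 1 < 2 ^ W := lt_two_pow_of_le hW
  unfold appendBit
  refine (spec_op_seq (W := W) ?_ ?_ ?_ (spec_op_seq (W := W) ?_ ?_ ?_
    (spec_op (W := W) (Q := fun m' => m' 14 = 2 * m 14 + m 16 ∧ m' 15 = m 15 - 1)
      ?_ ?_ ?_ ?_))).mono (by linarith) fun _ h => h
  all_goals try simp [Op.eval, h1]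
  all_goals omega

theorem spec_randomBits (hm : Base n m) (hf : n < fuel) (hW : n + 1 ≤ W) :
    Spec O fuel randomBits m ((5 * n + 3) * (3 * W + 1)) fun m' => m' 14 < 2 ^ n := by
  have hn : n < 2 ^ W := lt_two_pow_of_le (by omega)
  have h0 := hm.zero
  have h1 := hm.one
  have h2 := hm.two
  unfold randomBits
  -- An iteration pays for the flip, three operations and the test; two initial operations and the
  -- final test account for the `3`.
  refine (spec_const_seq (W := W) (by positivity) (spec_op_seq (W := W) ?_ ?_ ?_
    (spec_loop (x := 15) (N := n) (W := W) (I := fun i m' => m' 14 < 2 ^ (n - i)) (K := 4 *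
      (3 * W + 1))
      ?_ hf hn ?_ ?_))).mono (by linarith) ?_
  · simp [h0, hn]
  · simp [h2]
  · simp [h0, h2, Op.eval, hn]
  · simp [h0, h2, Op.eval]
  · simp
  · intro i m' hi h14 h15 hk
    have e1 : m' 1 = 1 := by rw [hk 1 rfl]; simp [h1]
    refine (spec_seq (spec_flip (W := W) (m := m') (Q := fun m'' => m'' 16 ≤ 1 ∧ m'' 14 = m' 14 ∧
      m'' 15 = m' 15) ?_) ?_ (K' := 3 * (3 * W + 1))).mono (by linarith) fun _ h => h
    · intro b
      cases b <;> simp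
    · rintro m'' ⟨e16, e14, e15⟩ hk'
      have hpow : 2 ^ (n - i) = 2 * 2 ^ (n - (i + 1)) := by
        rw [← pow_succ']; congr 1; omega
      have hle : 2 ^ (n - i) ≤ 2 ^ W := Nat.pow_le_pow_right (by norm_num) (by omega)
      refine (spec_appendBit (W := W) ?_ ?_ e16 ?_ (by omega)).mono le_rfl ?_
      · rw [hk' 1 rfl, e1]
      · omega
      · omega
      · rintro u ⟨u1, u2⟩
        omega
  · rintro m' ⟨h, -⟩
    simpa using h

theorem testBit_toNat_add (E i : ℕ) : E / 2 ^ i = 2 * (E / 2 ^ (i + 1)) + (E.testBit i).toNat := by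
  rw [Nat.toNat_testBit, pow_succ, ← Nat.div_div_eq_div_mul]
  omega

/-- Bits arrive with the most significant one first: with `i` iterations left the register must hold
`r / 2 ^ i`, and each flip gives the right digit with probability `1 / 2`. -/
theorem pr_randomBits (hm : Base n m) (hf : n < fuel) {r : ℕ} (hr : r < 2 ^ n) :
    Pr O fuel randomBits m ((1 / 2) ^ n) fun m' => m' 14 = r := by
  have h0 := hm.zero
  have h1 := hm.one
  have h2 := hm.two
  have hW : n < 2 ^ (n + 1) := lt_two_pow_of_le (by omega)
  unfold randomBits
  refine pr_seq_spec (spec_const (W := n + 1) (by positivity)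
    (Q := fun m' => m' = Function.update m 14 0) rfl) ?_
  rintro _ rfl -
  refine pr_seq_spec (spec_op (W := n + 1) (Q := fun m' => m' 14 = 0 ∧ m' 15 = n)
    (by simp [h0, hW]) (by simp [h2])
    (by simp [h0, h2, Op.eval, hW])
    (by simp [h0, h2, Op.eval])) ?_
  rintro m₁ ⟨e14, e15⟩ hk₁
  have e1 : m₁ 1 = 1 := by rw [hk₁ 1 rfl]; simp [h1]
  have key := pr_loop (O := O) (p := (.flip 16 ;; appendBit)) (x := 15) (N := n) (m := m₁)
    (I := fun i m' => m' 14 = r / 2 ^ i) (w := fun _ => 1 / 2)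
    e15 hf (by rw [e14, Nat.div_eq_of_lt hr]) (fun _ _ => by norm_num) ?_
  · rw [Finset.prod_const, Finset.card_range] at key
    exact key.mono le_rfl fun m' h => by simpa using h
  · intro i m' hi h14 h15 hk
    have hb : ∀ b : Bool, b.toNat ≤ 1 := fun b => by cases b <;> simp
    rw [← mul_one (1 / 2 : ℝ)]
    refine pr_seq (by norm_num) (pr_flip (r.testBit i) (Q := fun m'' => m'' 16 =
      (r.testBit i).toNat ∧
      m'' 14 = m' 14 ∧ m'' 15 = m' 15) (by simp)) ?_
    rintro m'' ⟨f16, f14, f15⟩ hk'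
    have hb' := hb (r.testBit i)
    have hdiv := testBit_toNat_add r i
    have hle : r / 2 ^ i ≤ r := Nat.div_le_self _ _
    have hp : 2 ^ n ≤ 2 ^ (n + 1) := Nat.pow_le_pow_right (by norm_num) (by omega)
    refine ((spec_appendBit (W := n + 1) ?_ ?_ ?_ ?_ (by omega)).mono le_rfl ?_).pr
    · rw [hk' 1 rfl, hk 1 rfl, e1]
    · omega
    · omega
    · omega
    · rintro u ⟨u1, u2⟩
      omega

theorem pr_randomBits_mem (hm : Base n m) (hf : n < fuel) (S : Finset ℕ) (hS : ∀ r ∈ S, r < 2 ^ n) :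
    Pr O fuel randomBits m (S.card / 2 ^ n) fun m' => m' 14 ∈ S := by
  have h := pr_sum (O := O) (fuel := fuel) (p := randomBits) (m := m) S
    (a := fun _ => (1 / 2) ^ n) (P := fun r m' => m' 14 = r) (Q := fun m' => m' 14 ∈ S)
    (fun _ _ => by positivity) (fun r hr => pr_randomBits hm hf (hS r hr))
    (fun i j m' h1 h2 => h1.symm.trans h2) (fun i hi m' h => h ▸ hi)
  rw [Finset.sum_const, nsmul_eq_mul] at h
  refine h.mono (le_of_eq ?_) fun _ h => h
  rw [one_div, inv_pow, div_eq_mul_inv]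

/-- Append to register `12` the bit that says whether register `14` is below register `10`. -/
def appendComparison {ι : Type} : Prog ι :=
  -- Truncated subtraction is nonzero exactly if register `14` is below register `10`; `.const 18 0`
  -- serves as a no-op.
  .op .sub 18 10 14 ;; .op .add 12 12 12 ;; .ite 18 (.op .add 12 12 1) (.const 18 0)

/-- Write the code of a random set into register `12`; the `n` elements are independently chosen
with probability `t / 2 ^ n`, where `t` is the number in register `10`. -/
def randomSet {ι : Type} : Prog ι :=
  .const 12 0 ;; .op .add 13 0 2 ;; .loop 13 (.op .sub 13 13 1 ;; randomBits ;; appendComparison)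

theorem spec_appendComparison (h1 : m 1 = 1) (h12 : 2 * m 12 + 1 < 2 ^ W) (h10 : m 10 < 2 ^ W)
    (h14 : m 14 < 2 ^ W) :
    Spec O fuel appendComparison m (4 * (3 * W + 1))
      fun m' => m' 12 = 2 * m 12 + (decide (m 14 < m 10)).toNat := by
  unfold appendComparison
  refine (spec_op_seq (W := W) h10 h14 (lt_of_le_of_lt (Nat.sub_le _ _) h10)
    (spec_op_seq (W := W) ?_ ?_ ?_
    (spec_ite (W := W) (K := 3 * W + 1) ?_ ?_ ?_))).mono (by linarith) fun _ h => h
  · simp; omega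
  · simp; omega
  · simp [Op.eval]; omega
  · simp [Op.eval]; omega
  · intro h
    simp [Op.eval] at h
    refine spec_const (by positivity) ?_
    simp [Op.eval]
    rw [decide_eq_false (by omega)]
    simp
    omega
  · intro h
    simp [Op.eval] at h
    refine spec_op (W := W) ?_ ?_ ?_ ?_
    · simp [Op.eval]; omega
    · simp [h1]; rintro rfl; simp at h12
    · simp [Op.eval, h1]; omega
    · simp [Op.eval, h1]
      rw [decide_eq_true (by omega)]
      simp
      omega

theorem spec_randomSet (hm : Base n m) (hf : n < fuel) (hW : n + 1 ≤ W) (h10 : m 10 < 2 ^ W) :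
    Spec O fuel randomSet m ((n * (5 * n + 9) + 3) * (3 * W + 1)) fun m' => m' 12 < 2 ^ n := by
  have hn : n < 2 ^ W := lt_two_pow_of_le (by omega)
  have h0 := hm.zero
  have h1 := hm.one
  have h2 := hm.two
  unfold randomSet
  refine (spec_const_seq (W := W) (by positivity) (spec_op_seq (W := W) ?_ ?_ ?_
    (spec_loop (x := 13) (N := n) (W := W) (I := fun i m' => m' 12 < 2 ^ (n - i))
      (K := (5 * n + 8) * (3 * W + 1)) ?_ hf hn ?_ ?_))).mono (by linarith) ?_
  · simp [h0, hn]
  · simp [h2]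
  · simp [h0, h2, Op.eval, hn]
  · simp [h0, h2, Op.eval]
  · simp
  · intro i m' hi h12 h13 hk
    have e0 : m' 0 = n := by rw [hk 0 rfl]; simp [h0]
    have e1 : m' 1 = 1 := by rw [hk 1 rfl]; simp [h1]
    have e2 : m' 2 = 0 := by rw [hk 2 rfl]; simp [h2]
    have e10 : m' 10 = m 10 := by rw [hk 10 rfl]; simp
    have hW1 : 1 < 2 ^ W := lt_two_pow_of_le (by omega)
    refine (spec_op_seq (W := W) (by omega) (by omega) (by simp [Op.eval]; omega)
      (spec_seq (spec_randomBits (n := n) (W := W) ?_ hf hW) ?_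
        (K' := 4 * (3 * W + 1)))).mono (by linarith) fun _ h => h
    · exact ⟨by simp [e0], by simp [e1],
        by simp [e2]⟩
    · intro m'' e14 hk'
      have f1 : m'' 1 = 1 := by rw [hk' 1 rfl]; simp [e1]
      have f10 : m'' 10 = m 10 := by rw [hk' 10 rfl]; simp [e10]
      have f12 : m'' 12 = m' 12 := by rw [hk' 12 rfl]; simp
      have f13 : m'' 13 = i := by rw [hk' 13 rfl]; simp [h13, e1, Op.eval]
      have hpow : 2 ^ (n - i) = 2 * 2 ^ (n - (i + 1)) := by
        rw [← pow_succ']; congr 1; omega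
      have hle : 2 ^ (n - i) ≤ 2 ^ W := Nat.pow_le_pow_right (by norm_num) (by omega)
      have hle' : 2 ^ n ≤ 2 ^ W := Nat.pow_le_pow_right (by norm_num) (by omega)
      refine (spec_appendComparison (W := W) f1 ?_ ?_ ?_).frame.mono le_rfl ?_
      · omega
      · omega
      · omega
      · rintro u ⟨u1, u2⟩
        have hb : (decide (m'' 14 < m'' 10)).toNat ≤ 1 := Bool.toNat_le _
        refine ⟨by omega, ?_⟩
        rw [u2 13 rfl, f13]
  · rintro m' ⟨h, -⟩
    simpa using h

/-- The probability of a particular random set. -/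
theorem prod_bias (S : Finset (Fin n)) (a : ℝ) :
    ∏ i ∈ Finset.range n, (if (encode S).testBit i = true then a else 1 - a) =
      a ^ S.card * (1 - a) ^ (n - S.card) := by
  rw [Finset.prod_range]
  simp only [(encode_lt_and_testBit S).2, decide_eq_true_eq]
  rw [Finset.prod_ite, Finset.prod_const, Finset.prod_const]
  congr 2
  · congr 1
    ext i
    simp
  · have : (Finset.univ.filter fun i => i ∉ S) = Sᶜ := by ext i; simp
    rw [this, Finset.card_compl, Fintype.card_fin]

/-- The code is again built from its top digit: with `i` iterations left the register must hold
`encode S / 2 ^ i`. Each digit uses fresh random bits, so the probabilities multiply. -/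
theorem pr_randomSet (hm : Base n m) (hf : n < fuel) (h10 : m 10 ≤ 2 ^ n) (S : Finset (Fin n)) :
    Pr O fuel randomSet m ((m 10 / 2 ^ n) ^ S.card * (1 - m 10 / 2 ^ n) ^ (n - S.card))
      fun m' => m' 12 = encode S := by
  have h0 := hm.zero
  have h1 := hm.one
  have h2 := hm.two
  set W := n + 1 with hW
  have hn : n < 2 ^ W := lt_two_pow_of_le (by omega)
  set a : ℝ := m 10 / 2 ^ n with ha
  have ha0 : 0 ≤ a := by positivity
  have ha1 : a ≤ 1 := by
    rw [ha, div_le_one (by positivity)]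
    exact_mod_cast h10
  unfold randomSet
  refine pr_seq_spec (spec_const (W := W) (by positivity)
    (Q := fun m' => m' = Function.update m 12 0) rfl) ?_
  rintro _ rfl -
  refine pr_seq_spec (spec_op (W := W) (Q := fun m' => m' 12 = 0 ∧ m' 13 = n)
    (by simp [h0, hn]) (by simp [h2])
    (by simp [h0, h2, Op.eval, hn])
    (by simp [h0, h2, Op.eval])) ?_
  rintro m₁ ⟨e12, e13⟩ hk₁
  have e0 : m₁ 0 = n := by rw [hk₁ 0 rfl]; simp [h0]
  have e1 : m₁ 1 = 1 := by rw [hk₁ 1 rfl]; simp [h1]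
  have e2 : m₁ 2 = 0 := by rw [hk₁ 2 rfl]; simp [h2]
  have e10 : m₁ 10 = m 10 := by rw [hk₁ 10 rfl]; simp
  set E := encode S with hE
  have hElt : E < 2 ^ n := encode_lt S
  have key := pr_loop (O := O) (p := (.op .sub 13 13 1 ;; randomBits ;; appendComparison)) (x := 13)
    (N := n) (m := m₁) (I := fun i m' => m' 12 = E / 2 ^ i)
    (w := fun i => if E.testBit i = true then a else 1 - a)
    e13 hf (by rw [e12, Nat.div_eq_of_lt hElt])
    (fun i _ => by split_ifs <;> linarith) ?_
  · rw [prod_bias] at key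
    exact key.mono le_rfl fun m' h => by simpa using h
  · intro i m' hi h12 h13 hk
    have f0 : m' 0 = n := by rw [hk 0 rfl, e0]
    have f1 : m' 1 = 1 := by rw [hk 1 rfl, e1]
    have f2 : m' 2 = 0 := by rw [hk 2 rfl, e2]
    have f10 : m' 10 = m 10 := by rw [hk 10 rfl, e10]
    have hW1 : 1 < 2 ^ W := lt_two_pow_of_le (by omega)
    refine pr_seq_spec (spec_op (W := W)
      (Q := fun m'' => m'' = Function.update m' 13 (Op.eval .sub (m' 13) (m' 1)))
      (by omega) (by omega) (by simp [Op.eval]; omega) rfl) ?_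
    rintro _ rfl -
    rw [← mul_one (ite _ _ _)]
    -- The random numbers whose comparison with register `10` produces the wanted digit.
    set T : Finset ℕ := (Finset.range (2 ^ n)).filter fun r =>
      decide (r < m 10) = E.testBit i with hT
    have hTc : (if E.testBit i = true then a else 1 - a) = T.card / 2 ^ n := by
      by_cases hb : E.testBit i = true
      · have : T = Finset.range (m 10) := by
          ext r
          simp only [hT, hb, Finset.mem_filter, Finset.mem_range, decide_eq_true_eq]
          omega
        rw [if_pos hb, this, Finset.card_range, ha]
      · rw [Bool.not_eq_true] at hb
        have : T = Finset.Ico (m 10) (2 ^ n) := by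
          ext r
          simp only [hT, hb, Finset.mem_filter, Finset.mem_range, decide_eq_false_iff_not,
            Finset.mem_Ico]
          omega
        rw [hb, if_neg (by simp), this, Nat.card_Ico, ha, Nat.cast_sub h10]
        field_simp
        push_cast
        ring
    rw [hTc]
    refine pr_seq (by positivity) (pr_randomBits_mem (n := n) ?_ hf T fun r hr => by
      simpa using (Finset.mem_filter.1 hr).1) ?_
    · exact ⟨by simp [f0], by simp [f1],
        by simp [f2]⟩
    · intro m'' hm'' hk'
      obtain ⟨g14, g14'⟩ := Finset.mem_filter.1 hm''
      have g14 := Finset.mem_range.1 g14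
      have g1 : m'' 1 = 1 := by rw [hk' 1 rfl]; simp [f1]
      have g10 : m'' 10 = m 10 := by rw [hk' 10 rfl]; simp [f10]
      have g12 : m'' 12 = m' 12 := by rw [hk' 12 rfl]; simp
      have g13 : m'' 13 = i := by rw [hk' 13 rfl]; simp [h13, f1, Op.eval]
      have hdiv := testBit_toNat_add E i
      have hle : E / 2 ^ i ≤ E := Nat.div_le_self _ _
      have hp : 2 ^ W = 2 * 2 ^ n := by rw [hW, pow_succ']
      refine (spec_appendComparison (W := W) g1 ?_ ?_ ?_).frame.pr.mono le_rfl ?_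
      · have : E / 2 ^ (i + 1) ≤ E := Nat.div_le_self _ _
        omega
      · omega
      · omega
      · rintro u ⟨u1, u2⟩
        refine ⟨?_, ?_⟩
        · rw [u1, g10, g14', g12, h12, hdiv]
        · rw [u2 13 rfl, g13]

end Sampling

/-! ### One trial: sample, extend, keep the smaller set -/

section Trial

variable {n : ℕ} {L : Finset (ℝ × ℝ)} {F : Set (Finset (Fin n))}
  {O : ∀ j : L, ExtOracle F j.1.1} {fuel : ℕ} {m : ℕ → ℕ} {W : ℕ}

/-- The number of ones among the `k` lowest binary digits. -/
def popcount (k w : ℕ) : ℕ := ∑ i ∈ Finset.range k, w / 2 ^ i % 2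

theorem popcount_le (k w : ℕ) : popcount k w ≤ k := by
  refine (Finset.sum_le_card_nsmul _ _ 1 fun i _ => ?_).trans (by simp)
  omega

theorem popcount_eq_card (n w : ℕ) : popcount n w = (decode n w).card := by
  rw [popcount, Finset.sum_range, decode, Finset.card_filter]
  refine Finset.sum_congr rfl fun i _ => ?_
  rw [← Nat.toNat_testBit]
  cases w.testBit i <;> simp

/-- One step of the comparison: the lowest digits of registers `18` and `24` are moved into the
balance in register `19`. -/
def balanceStep {ι : Type} : Prog ι :=
  .op .land 25 18 1 ;; .op .add 19 19 25 ;; .op .land 25 24 1 ;; .op .sub 19 19 25 ;;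
  .op .shr 18 18 1 ;; .op .shr 24 24 1 ;; .op .sub 13 13 1

/-- Replace the candidate in register `4` by the one in register `17` if that is smaller. -/
def keepSmaller {ι : Type} : Prog ι :=
  -- The balance starts at `n`, so that no subtraction in the loop is truncated. Subtracting `n`
  -- afterwards leaves a nonzero number exactly if the old candidate has more elements.
  .op .add 18 4 2 ;; .op .add 24 17 2 ;; .op .add 19 0 2 ;; .op .add 13 0 2 ;;
  .loop 13 balanceStep ;; .op .sub 19 19 0 ;; .ite 19 (.op .add 4 17 2) (.const 18 0)

theorem spec_balanceStep (h1 : m 1 = 1) (h18 : m 18 < 2 ^ W) (h24 : m 24 < 2 ^ W)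
    (h19 : m 19 + 1 < 2 ^ W) (h13 : m 13 < 2 ^ W) :
    Spec O fuel balanceStep m (7 * (3 * W + 1)) fun m' => m' 18 = m 18 / 2 ∧ m' 24 = m 24 / 2 ∧
      m' 19 = m 19 + m 18 % 2 - m 24 % 2 ∧ m' 13 = m 13 - 1 := by
  have hW : W ≠ 0 := by
    rintro rfl
    simp at h19
  unfold balanceStep
  refine (spec_op_seq (W := W) ?_ ?_ ?_ (spec_op_seq (W := W) ?_ ?_ ?_
    (spec_op_seq (W := W) ?_ ?_ ?_ (spec_op_seq (W := W) ?_ ?_ ?_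
    (spec_op_seq (W := W) ?_ ?_ ?_ (spec_op_seq (W := W) ?_ ?_ ?_
    (spec_op (W := W) ?_ ?_ ?_ ?_))))))).mono (by linarith) fun _ h => h
  all_goals try simp [Op.eval, h1, Nat.and_one_is_mod, Nat.shiftRight_eq_div_pow]
  all_goals omega

theorem spec_keepSmaller (hm : Base n m) (hf : n < fuel) (hW : n + 2 ≤ W) (h4 : m 4 < 2 ^ n)
    (h17 : m 17 < 2 ^ n) :
    Spec O fuel keepSmaller m ((8 * n + 8) * (3 * W + 1)) fun m' =>
      m' 4 = if (decode n (m 17)).card < (decode n (m 4)).card then m 17 else m 4 := by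
  have h0 := hm.zero
  have h1 := hm.one
  have h2 := hm.two
  have hn' : n < 2 ^ n := Nat.lt_two_pow_self
  have hWn : 4 * 2 ^ n ≤ 2 ^ W := by
    calc 4 * 2 ^ n = 2 ^ (n + 2) := by rw [pow_add]; ring
      _ ≤ 2 ^ W := Nat.pow_le_pow_right (by norm_num) hW
  unfold keepSmaller
  refine (spec_op_seq (W := W) ?_ ?_ ?_ (spec_op_seq (W := W) ?_ ?_ ?_
    (spec_op_seq (W := W) ?_ ?_ ?_ (spec_op_seq (W := W) ?_ ?_ ?_
    (spec_seq (spec_loop (x := 13) (N := n) (W := W) (K := 7 * (3 * W + 1))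
      (I := fun i m' => m' 18 = m 4 / 2 ^ (n - i) ∧ m' 24 = m 17 / 2 ^ (n - i) ∧
        m' 19 + popcount (n - i) (m 17) = n + popcount (n - i) (m 4)) ?_ hf ?_ ?_ ?_) ?_
      (K' := 3 * (3 * W + 1))))))).mono (by linarith) fun _ h => h
  case refine_15 =>
    simp [popcount, Op.eval, h0, h2]
  case refine_16 =>
    rintro i m' hi ⟨e18, e24, e19⟩ e13 hk
    have e1 : m' 1 = 1 := by rw [hk 1 rfl]; simp [h1]
    have hp1 := popcount_le (n - (i + 1)) (m 17)
    have hp2 := popcount_le (n - (i + 1)) (m 4)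
    have hd1 : m 4 / 2 ^ (n - (i + 1)) ≤ m 4 := Nat.div_le_self _ _
    have hd2 : m 17 / 2 ^ (n - (i + 1)) ≤ m 17 := Nat.div_le_self _ _
    refine (spec_balanceStep (W := W) e1 ?_ ?_ ?_ ?_).mono le_rfl ?_
    · omega
    · omega
    · omega
    · omega
    · rintro u ⟨u18, u24, u19, u13⟩
      have hni : n - i = n - (i + 1) + 1 := by omega
      refine ⟨⟨?_, ?_, ?_⟩, by omega⟩
      · rw [u18, e18, Nat.div_div_eq_div_mul, hni, pow_succ]
      · rw [u24, e24, Nat.div_div_eq_div_mul, hni, pow_succ]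
      · have s1 : popcount (n - i) (m 17) = popcount (n - (i + 1)) (m 17) + m' 24 % 2 := by
          rw [hni, popcount, Finset.sum_range_succ, e24]; rfl
        have s2 : popcount (n - i) (m 4) = popcount (n - (i + 1)) (m 4) + m' 18 % 2 := by
          rw [hni, popcount, Finset.sum_range_succ, e18]; rfl
        omega
  case refine_17 =>
    rintro m' ⟨⟨-, -, e19⟩, -⟩ hk
    simp only [Nat.sub_zero] at e19
    have e0 : m' 0 = n := by rw [hk 0 rfl]; simp [h0]
    have e2 : m' 2 = 0 := by rw [hk 2 rfl]; simp [h2]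
    have e4 : m' 4 = m 4 := by rw [hk 4 rfl]; simp
    have e17 : m' 17 = m 17 := by rw [hk 17 rfl]; simp
    have hp1 := popcount_le n (m 17)
    have hp2 := popcount_le n (m 4)
    rw [← popcount_eq_card, ← popcount_eq_card]
    refine (spec_op_seq (W := W) (by omega) (by omega) (by simp [Op.eval]; omega)
      (spec_ite (W := W) (K := 3 * W + 1) (by simp [Op.eval]; omega) ?_ ?_)).mono (by linarith)
      fun _ h => h
    · intro h
      simp [Op.eval] at h
      refine spec_const (by positivity) ?_
      rw [if_neg (by omega)]
      simp [e4]
    · intro h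
      simp [Op.eval] at h
      refine spec_op ?_ ?_ ?_ ?_
      · simp; omega
      · simp [e2]
      · simp [Op.eval, e2]; omega
      · rw [if_pos (by omega)]
        simp [Op.eval, e2, e17]
  all_goals try simp [Op.eval, h0, h2]
  all_goals omega

/-- Sample a set, extend it, and keep the result if it is smaller than the candidate. -/
def trial {ι : Type} (j : ι) : Prog ι :=
  randomSet ;; .query j 17 12 7 ;; .op .lor 17 17 12 ;; keepSmaller

/-- Register `4` holds the code of a member of `F`. -/
def Candidate (F : Set (Finset (Fin n))) (m : ℕ → ℕ) : Prop :=
  m 4 < 2 ^ n ∧ decode n (m 4) ∈ F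

theorem spec_trial (j : L) (hm : Base n m) (hf : n < fuel) (hW : n + 2 ≤ W) (h10 : m 10 ≤ 2 ^ n)
    (h7 : m 7 < 2 ^ W) (hc : Candidate F m) :
    Spec O fuel (trial j) m (j.1.2 ^ m 7 + (5 * n ^ 2 + 17 * n + 13) * (3 * W + 1)) fun m' =>
      Candidate F m' ∧ (decode n (m' 4)).card ≤ (decode n (m 4)).card := by
  have hWn : 4 * 2 ^ n ≤ 2 ^ W := by
    calc 4 * 2 ^ n = 2 ^ (n + 2) := by rw [pow_add]; ring
      _ ≤ 2 ^ W := Nat.pow_le_pow_right (by norm_num) hW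
  have hpos : 0 < 2 ^ n := by positivity
  unfold trial
  refine (spec_seq (spec_randomSet (W := W) hm hf (by omega) (by omega)) ?_
    (K' := j.1.2 ^ m 7 + (8 * n + 10) * (3 * W + 1))).mono (by linarith) fun _ h => h
  intro m₁ e12 hk
  have e7 : m₁ 7 = m 7 := hk 7 rfl
  have e4 : m₁ 4 = m 4 := hk 4 rfl
  refine (spec_seq (spec_query (W := W) (Q := fun m' => m' 17 < 2 ^ n ∧
    decode n (m' 17) ∪ decode n (m₁ 12) ∈ F) (by omega) (by omega) (by omega) ?_) ?_
    (K' := (8 * n + 9) * (3 * W + 1))).mono (by rw [e7]; linarith) fun _ h => h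
  · intro S hS
    simp only [Function.update_self, decode_encode]
    exact ⟨encode_lt S, by rwa [Finset.union_comm]⟩
  rintro m₂ ⟨e17, hF⟩ hk'
  have f12 : m₂ 12 = m₁ 12 := hk' 12 rfl
  have f4 : m₂ 4 = m 4 := (hk' 4 rfl).trans e4
  have hlor : m₂ 17 ||| m₂ 12 < 2 ^ n := Nat.or_lt_two_pow e17 (by omega)
  refine (spec_op_seq (W := W) (by omega) (by omega) (by simp only [Op.eval]; omega)
    (spec_keepSmaller (W := W) (n := n) ?_ hf hW ?_ ?_)).mono (by linarith) ?_
  · have hb : Base n m₂ := (hm.of_keeps hk).of_keeps hk'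
    exact ⟨by simp [hb.zero], by simp [hb.one], by simp [hb.two]⟩
  · simpa [f4] using hc.1
  · simpa [Op.eval] using hlor
  · intro m₃ hm₃
    simp only [Function.update_self, Op.eval, ne_eq, Nat.reduceEqDiff, not_false_eq_true,
      Function.update_of_ne, f4] at hm₃
    unfold Candidate
    rw [hm₃]
    split_ifs with h
    · refine ⟨⟨hlor, ?_⟩, h.le⟩
      rw [decode_lor, f12]
      exact hF
    · exact ⟨hc, le_rfl⟩

/-- If the sample `A` misses at most `ℓ` elements of `S`, then `S \ A` is an `ℓ`-extension of `A`.
So at least half of the answers have at most `α * ℓ` elements, and the candidate kept in the end is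
no larger than the union. -/
theorem pr_trial (j : L) (hF : IsMonotone F) (hm : Base n m) (hf : n < fuel)
    (hc : Candidate F m) {S : Finset (Fin n)} (hS : S ∈ F) {s ℓ : ℕ}
    (hs : s ≤ n) (h10 : m 10 = s * 2 ^ n / n) (h7 : m 7 = ℓ) :
    Pr O fuel (trial j) m ((almostSupersets S s ℓ).card *
      (bias n s ^ s * (1 - bias n s) ^ (n - s)) * (1 / 2))
      fun m' => ((decode n (m' 4)).card : ℝ) ≤ s + j.1.1 * ℓ := by
  have h10' : m 10 ≤ 2 ^ n := by
    rw [h10]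
    rcases Nat.eq_zero_or_pos n with rfl | hn
    · simp
    · exact Nat.div_le_of_le_mul (Nat.mul_le_mul_right _ hs)
  have hb1 : bias n s ≤ 1 := by
    rw [bias, ← h10, div_le_one (by positivity)]
    exact_mod_cast h10'
  have hb0 := bias_nonneg n s
  have hA0 : 0 ≤ bias n s ^ s * (1 - bias n s) ^ (n - s) :=
    mul_nonneg (pow_nonneg hb0 _) (pow_nonneg (by linarith) _)
  have h1 : Pr O fuel randomSet m ((almostSupersets S s ℓ).card *
      (bias n s ^ s * (1 - bias n s) ^ (n - s)))
      fun m' => ∃ A ∈ almostSupersets S s ℓ, m' 12 = encode A := by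
    have h := pr_sum (O := O) (fuel := fuel) (p := randomSet) (m := m) (almostSupersets S s ℓ)
      (a := fun _ => bias n s ^ s * (1 - bias n s) ^ (n - s)) (P := fun A m' => m' 12 = encode A)
      (Q := fun m' => ∃ A ∈ almostSupersets S s ℓ, m' 12 = encode A)
      (fun _ _ => hA0) (fun A hA => ?_) (fun A B m' h1 h2 => ?_) (fun A hA m' h => ⟨A, hA, h⟩)
    · rwa [Finset.sum_const, nsmul_eq_mul] at h
    · have hA : A.card = s :=
        (Finset.mem_powersetCard.1 (Finset.mem_filter.1 hA).1).2
      have h2 := pr_randomSet (O := O) hm hf h10' A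
      rw [hA, h10] at h2
      exact h2
    · have h3 : encode A = encode B := h1.symm.trans h2
      rw [← decode_encode A, h3, decode_encode]
  unfold trial
  refine pr_seq (by positivity) h1 ?_
  rintro m₁ ⟨A, hA, e12⟩ hk
  obtain ⟨hA1, hA2⟩ := Finset.mem_filter.1 hA
  have hAc : A.card = s := (Finset.mem_powersetCard.1 hA1).2
  have e7 : m₁ 7 = ℓ := (hk 7 rfl).trans h7
  have e4 : m₁ 4 = m 4 := hk 4 rfl
  rw [← mul_one (1 / 2 : ℝ)]
  refine pr_seq (by norm_num) (pr_query (j := j) (Q := fun m' => m' 17 < 2 ^ n ∧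
    ((decode n (m' 17)).card : ℝ) ≤ j.1.1 * ℓ) ?_ ?_) ?_
  · refine ⟨S \ A, ?_, ?_⟩
    · rw [e12, decode_encode]
      exact hF.2 S _ (fun x hx => by by_cases h : x ∈ A <;> simp [h, hx]) hS
    · rw [e7]
      exact_mod_cast hA2
  · rintro T ⟨-, hT⟩
    simp only [Function.update_self, decode_encode]
    rw [e7] at hT
    exact ⟨encode_lt T, hT⟩
  rintro m₂ ⟨e17, hcard⟩ hk'
  have f12 : m₂ 12 = encode A := (hk' 12 rfl).trans e12
  have f4 : m₂ 4 = m 4 := (hk' 4 rfl).trans e4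
  have hEA := encode_lt A
  have hlor : m₂ 17 ||| m₂ 12 < 2 ^ n := Nat.or_lt_two_pow e17 (by omega)
  have hp : 2 ^ n ≤ 2 ^ (n + 2) := Nat.pow_le_pow_right (by norm_num) (by omega)
  refine ((spec_op_seq (W := n + 2) (by omega) (by omega) (by simp only [Op.eval]; omega)
    (spec_keepSmaller (W := n + 2) (n := n) ?_ hf le_rfl ?_ ?_)).mono le_rfl ?_).pr
  · have hb : Base n m₂ := (hm.of_keeps hk).of_keeps hk'
    exact ⟨by simp [hb.zero], by simp [hb.one], by simp [hb.two]⟩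
  · simpa [f4] using hc.1
  · simpa [Op.eval] using hlor
  · intro m₃ hm₃
    simp only [Function.update_self, Op.eval, ne_eq, Nat.reduceEqDiff, not_false_eq_true,
      Function.update_of_ne, f4] at hm₃
    have hle : ((decode n (m₂ 17 ||| m₂ 12)).card : ℝ) ≤ s + j.1.1 * ℓ := by
      have := Finset.card_union_le (decode n (m₂ 17)) (decode n (m₂ 12))
      rw [← decode_lor, f12, decode_encode, hAc] at this
      have h2 : ((decode n (m₂ 17 ||| m₂ 12)).card : ℝ) ≤ (decode n (m₂ 17)).card + s := by
        rw [f12]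
        exact_mod_cast this
      linarith
    rw [hm₃]
    split_ifs with h
    · exact hle
    · refine le_trans ?_ hle
      exact_mod_cast not_lt.1 h

end Trial

/-! ### Repeated trials for one set size -/

section Algorithm

variable {n : ℕ} {L : Finset (ℝ × ℝ)} {F : Set (Finset (Fin n))}
  {O : ∀ j : L, ExtOracle F j.1.1} {fuel : ℕ} {m : ℕ → ℕ} {W : ℕ}

/-- A single good iteration suffices: this is `pr_loop_absorb` with success probability zero in all
other iterations. -/
theorem pr_loop_once {p : Prog L} {x N : ℕ} {I : ℕ → (ℕ → ℕ) → Prop} {G : (ℕ → ℕ) → Prop}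
    {a K : ℝ} (hN : m x = N) (hf : N < fuel) (hI : I N m) (ha0 : 0 ≤ a) (ha1 : a ≤ 1)
    (hs : ∀ i m', i < N → I (i + 1) m' → m' x = i + 1 → (∀ r, p.keeps r = true → m' r = m r) →
      Spec O fuel p m' K fun m'' => (I i m'' ∧ m'' x = i) ∧ (G m' → G m''))
    {i₀ : ℕ} (hi₀ : i₀ < N)
    (h : ∀ m', I (i₀ + 1) m' → m' x = i₀ + 1 → (∀ r, p.keeps r = true → m' r = m r) →
      Pr O fuel p m' a G) :
    Pr O fuel (.loop x p) m a G := by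
  have := pr_loop_absorb (O := O) (G := G) (a := fun i => if i = i₀ then a else 0) hN hf hI
    (fun i _ => by split_ifs <;> simp [ha0]) (fun i _ => by split_ifs <;> simp [ha1]) hs ?_
  · refine this.mono (le_of_eq ?_) fun _ h => h
    rw [Finset.prod_eq_single i₀]
    · simp
    · intro i _ hi
      simp [hi]
    · intro hi
      exact absurd (Finset.mem_range.2 hi₀) hi
  · intro i m' _ h1 h2 h3
    by_cases hi : i = i₀
    · subst hi
      simpa using h m' h1 h2 h3
    · intro c
      simp [hi]

/-- Compute the sampling probability for the set size in register `9`. -/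
def prepareTrials {ι : Type} : Prog ι :=
  .op .mul 10 9 3 ;; .op .div 10 10 0 ;; .op .add 11 8 2

/-- Make the number of trials in register `8` with sets of size about the number in
register `9`. -/
def trials {ι : Type} (j : ι) : Prog ι :=
  prepareTrials ;; .loop 11 (trial j ;; .op .sub 11 11 1) ;; .op .sub 9 9 1

/-- Compute the number of trials for the extension size in register `7`. -/
def prepareRound {ι : Type} : Prog ι :=
  .op .div 8 5 6 ;; .op .add 9 0 2

/-- Proceed to the next extension size. -/
def finishRound {ι : Type} : Prog ι :=
  .op .mul 6 6 21 ;; .op .add 7 7 1 ;; .op .sub 20 20 1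

/-- Make the trials for all set sizes with extensions of the size in register `7`. -/
def round {ι : Type} (j : ι) : Prog ι :=
  prepareRound ;; .loop 9 (trials j) ;; finishRound

/-- Register `4` holds a candidate that is at most as large as the one of `m`. -/
def Better (F : Set (Finset (Fin n))) (m m' : ℕ → ℕ) : Prop :=
  Candidate F m' ∧ (decode n (m' 4)).card ≤ (decode n (m 4)).card

theorem Better.refl (h : Candidate F m) : Better F m m := ⟨h, le_rfl⟩

theorem Better.trans {m₁ m₂ m₃ : ℕ → ℕ} (h : Better F m₁ m₂) (h' : Better F m₂ m₃) :
    Better F m₁ m₃ := ⟨h'.1, h'.2.trans h.2⟩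

theorem Better.congr_right {m₁ m₂ m₃ : ℕ → ℕ} (h : Better F m₁ m₂) (h4 : m₃ 4 = m₂ 4) :
    Better F m₁ m₃ := by
  unfold Better Candidate at *
  rwa [h4]

theorem Candidate.congr {m₁ m₂ : ℕ → ℕ} (h : Candidate F m₁) (h4 : m₂ 4 = m₁ 4) :
    Candidate F m₂ := by
  unfold Candidate at *
  rwa [h4]

/-- The cost of a trial with extensions of size `ℓ`, for the word size `W`. -/
def trialCost (c : ℝ) (n W ℓ : ℕ) : ℝ := c ^ ℓ + (5 * n ^ 2 + 17 * n + 13) * (3 * W + 1)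

theorem spec_trialStep (j : L) (hm : Base n m) (hf : n < fuel) (hW : n + 2 ≤ W)
    (h10 : m 10 ≤ 2 ^ n) (h7 : m 7 < 2 ^ W) (hc : Candidate F m) (h11 : m 11 < 2 ^ W) :
    Spec O fuel (trial j ;; .op .sub 11 11 1) m (trialCost j.1.2 n W (m 7) + (3 * W + 1))
      fun m' => Better F m m' ∧ m' 11 = m 11 - 1 := by
  refine spec_seq (spec_trial (W := W) j hm hf hW h10 h7 hc) ?_
  intro m₁ hB hk
  have e1 : m₁ 1 = 1 := (hk 1 rfl).trans hm.one
  have e11 : m₁ 11 = m 11 := hk 11 rfl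
  have hW1 : 1 < 2 ^ W := lt_two_pow_of_le (by omega)
  refine spec_op (W := W) (by omega) (by omega) (by simp [Op.eval]; omega) ⟨?_, ?_⟩
  · exact Better.congr_right hB (by simp)
  · simp [Op.eval, e1, e11]

/-- The state before the trials for one set size. -/
structure TrialsPre (F : Set (Finset (Fin n))) (W : ℕ) (m : ℕ → ℕ) : Prop where
  base : Base n m
  three : m 3 = 2 ^ n
  seven : m 7 < 2 ^ W
  eight : m 8 < 2 ^ W
  nine : m 9 ≤ n
  candidate : Candidate F m

theorem TrialsPre.facts (h : TrialsPre F W m) (hW : 2 * n + 2 ≤ W) :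
    m 9 * 2 ^ n < 2 ^ W ∧ m 9 * 2 ^ n / n ≤ 2 ^ n ∧ 2 ^ n < 2 ^ W ∧ 1 < 2 ^ W ∧ n < 2 ^ W := by
  refine ⟨?_, ?_, Nat.pow_lt_pow_right (by norm_num) (by omega), lt_two_pow_of_le (by omega),
    lt_two_pow_of_le (by omega)⟩
  · calc m 9 * 2 ^ n ≤ n * 2 ^ n := Nat.mul_le_mul_right _ h.nine
      _ < 2 ^ n * 2 ^ n := Nat.mul_lt_mul_of_pos_right Nat.lt_two_pow_self (by positivity)
      _ = 2 ^ (n + n) := (pow_add 2 n n).symm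
      _ ≤ 2 ^ W := Nat.pow_le_pow_right (by norm_num) (by omega)
  · exact Nat.div_le_of_le_mul (Nat.mul_le_mul_right _ h.nine)

theorem spec_prepareTrials (h : TrialsPre F W m) (hW : 2 * n + 2 ≤ W) :
    Spec O fuel prepareTrials m (3 * (3 * W + 1)) fun m' =>
      m' 10 = m 9 * 2 ^ n / n ∧ m' 11 = m 8 := by
  obtain ⟨f1, f2, f3, f4, f5⟩ := h.facts hW
  have h0 := h.base.zero
  have h2 := h.base.two
  have h3 := h.three
  have h8 := h.eight
  have h9 := h.nine
  unfold prepareTrials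
  refine (spec_op_seq (W := W) ?_ ?_ ?_ (spec_op_seq (W := W) ?_ ?_ ?_
    (spec_op (W := W) ?_ ?_ ?_ ?_))).mono (by linarith) fun _ h => h
  all_goals try simp [Op.eval, h0, h2, h3]
  all_goals omega

/-- The invariant of the trial loop. -/
structure TrialLoop (F : Set (Finset (Fin n))) (m₀ m : ℕ → ℕ) : Prop where
  base : Base n m
  seven : m 7 = m₀ 7
  ten : m 10 = m₀ 9 * 2 ^ n / n
  better : Better F m₀ m

theorem spec_trialLoop_body (j : L) (hpre : TrialsPre F W m) (hf : n < fuel)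
    (hW : 2 * n + 2 ≤ W) {i : ℕ} {m' : ℕ → ℕ} (hi : i < m 8) (hI : TrialLoop F m m')
    (h11 : m' 11 = i + 1) :
    Spec O fuel (trial j ;; .op .sub 11 11 1) m' (trialCost j.1.2 n W (m 7) + (3 * W + 1))
      fun m'' => (TrialLoop F m m'' ∧ m'' 11 = i) ∧ Better F m' m'' := by
  obtain ⟨f1, f2, f3, f4, f5⟩ := hpre.facts hW
  have h7 := hpre.seven
  have h8 := hpre.eight
  have e7 := hI.seven
  have e10 := hI.ten
  rw [← e7]
  refine (spec_trialStep (W := W) j hI.base hf (by omega) (by omega) (by omega) hI.better.1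
    (by omega)).frame.mono le_rfl ?_
  rintro u ⟨⟨u1, u2⟩, hk⟩
  exact ⟨⟨⟨hI.base.of_keeps hk, (hk 7 rfl).trans e7, (hk 10 rfl).trans e10, hI.better.trans u1⟩,
    by omega⟩, u1⟩

theorem TrialLoop.start (hpre : TrialsPre F W m) {m₁ : ℕ → ℕ}
    (h10 : m₁ 10 = m 9 * 2 ^ n / n)
    (hk : ∀ r, (prepareTrials : Prog L).keeps r = true → m₁ r = m r) : TrialLoop F m m₁ :=
  ⟨hpre.base.of_keeps hk, hk 7 rfl, h10,
    (Better.refl hpre.candidate).congr_right (hk 4 rfl)⟩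

theorem spec_trials (j : L) (hpre : TrialsPre F W m) (hf : n < fuel) (hf8 : m 8 < fuel)
    (hW : 2 * n + 2 ≤ W) :
    Spec O fuel (trials j) m
      (5 * (3 * W + 1) + m 8 * (trialCost j.1.2 n W (m 7) + 2 * (3 * W + 1)))
      fun m' => Better F m m' ∧ m' 9 = m 9 - 1 := by
  obtain ⟨f1, f2, f3, f4, f5⟩ := hpre.facts hW
  have h9 := hpre.nine
  unfold trials
  refine (spec_seq (spec_prepareTrials (W := W) hpre hW) ?_
    (K' := (m 8 * (trialCost j.1.2 n W (m 7) + (3 * W + 1) + (3 * W + 1)) + (3 * W + 1)) +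
      (3 * W + 1))).mono (by linarith) fun _ h => h
  rintro m₁ ⟨e10, e11⟩ hk
  refine spec_seq (spec_loop (x := 11) (N := m 8) (W := W) (I := fun _ m' => TrialLoop F m m')
    e11 hf8 hpre.eight (TrialLoop.start hpre e10 hk) ?_) ?_
  · intro i m' hi hI h11 _
    exact (spec_trialLoop_body (W := W) j hpre hf hW hi hI h11).mono le_rfl fun _ h => h.1
  · rintro m₂ ⟨hI, -⟩ hk'
    have e9 : m₂ 9 = m 9 := (hk' 9 rfl).trans (hk 9 rfl)
    have e1 := hI.base.one
    refine spec_op (W := W) (by omega) (by omega) (by simp [Op.eval]; omega) ⟨?_, ?_⟩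
    · exact hI.better.congr_right (by simp)
    · simp [Op.eval, e9, e1]

/-- The candidate has size at most `b`. -/
def Small (n : ℕ) (b : ℝ) (m : ℕ → ℕ) : Prop := ((decode n (m 4)).card : ℝ) ≤ b

theorem Better.small {b : ℝ} {m' : ℕ → ℕ} (h : Better F m m') (hs : Small n b m) :
    Small n b m' :=
  le_trans (by exact_mod_cast h.2) hs

theorem Small.congr {b : ℝ} {m' : ℕ → ℕ} (h : Small n b m) (h4 : m' 4 = m 4) : Small n b m' := by
  unfold Small at *
  rwa [h4]

theorem one_sub_pow_le_half {q : ℝ} (hq1 : q ≤ 1) {N : ℕ} (h : 1 ≤ N * q) :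
    (1 - q) ^ N ≤ 1 / 2 := by
  have h1 : 1 - q ≤ Real.exp (-q) := by linarith [Real.add_one_le_exp (-q)]
  calc (1 - q) ^ N ≤ Real.exp (-q) ^ N := pow_le_pow_left₀ (by linarith) h1 N
    _ = Real.exp (-(N * q)) := by rw [← Real.exp_nat_mul]; ring_nf
    _ ≤ Real.exp (-1) := Real.exp_le_exp.2 (by linarith)
    _ ≤ 1 / 2 := by
      rw [Real.exp_neg, one_div]
      exact inv_anti₀ (by norm_num) (by linarith [Real.add_one_le_exp (1 : ℝ)])

/-- The candidate never grows, so a success is permanent; all trials fail with probability at most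
`(1 - q) ^ N ≤ 1 / 2`, since `N * q ≥ 1`. -/
theorem pr_trials (j : L) (hF : IsMonotone F) (hpre : TrialsPre F W m) (hf : n < fuel)
    (hf8 : m 8 < fuel) (hW : 2 * n + 2 ≤ W) {S : Finset (Fin n)} (hS : S ∈ F) {b : ℝ}
    (hb : m 9 + j.1.1 * m 7 ≤ b)
    (hq : 1 ≤ m 8 * ((almostSupersets S (m 9) (m 7)).card *
      (bias n (m 9) ^ m 9 * (1 - bias n (m 9)) ^ (n - m 9)) * (1 / 2)))
    (hq1 : (almostSupersets S (m 9) (m 7)).card *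
      (bias n (m 9) ^ m 9 * (1 - bias n (m 9)) ^ (n - m 9)) * (1 / 2) ≤ 1) :
    Pr O fuel (trials j) m (1 / 2) (Small n b) := by
  obtain ⟨f1, f2, f3, f4, f5⟩ := hpre.facts hW
  have h9 := hpre.nine
  set q := (almostSupersets S (m 9) (m 7)).card *
      (bias n (m 9) ^ m 9 * (1 - bias n (m 9)) ^ (n - m 9)) * (1 / 2) with hqd
  have hq0 : 0 ≤ q := by
    by_contra! h
    nlinarith [(Nat.cast_nonneg (m 8) : (0 : ℝ) ≤ m 8)]
  unfold trials
  refine pr_seq_spec (spec_prepareTrials (W := W) hpre hW) ?_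
  rintro m₁ ⟨e10, e11⟩ hk
  rw [← mul_one (1 / 2 : ℝ)]
  refine pr_seq (by norm_num) ((pr_loop_absorb (x := 11) (N := m 8) (G := Small n b)
    (I := fun _ m' => TrialLoop F m m') (a := fun _ => q)
    (K := trialCost j.1.2 n W (m 7) + (3 * W + 1)) e11 hf8 (TrialLoop.start hpre e10 hk)
    (fun _ _ => hq0) (fun _ _ => hq1) ?_ ?_).and (K := m 8 * (trialCost j.1.2 n W (m 7) +
      (3 * W + 1) + (3 * W + 1)) + (3 * W + 1)) (spec_loop (x := 11) (N := m 8) (W := W)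
    (I := fun _ m' => TrialLoop F m m')
    e11 hf8 hpre.eight (TrialLoop.start hpre e10 hk) ?_) |>.mono ?_ fun _ h => h) ?_
  · intro i m' hi hI h11 _
    exact (spec_trialLoop_body (W := W) j hpre hf hW hi hI h11).mono le_rfl
      fun _ h => ⟨h.1, h.2.small⟩
  · intro i m' hi hI h11 _
    rw [← mul_one q]
    refine pr_seq hq0 (Q := Small n b) ((pr_trial j hF hI.base hf hI.better.1 hS (s := m 9) (ℓ :=
      m 7)
      h9 hI.ten hI.seven).mono le_rfl ?_) ?_
    · intro u hu
      exact hu.trans hb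
    · intro u hu hk'
      have e1 : u 1 = 1 := (hk' 1 rfl).trans hI.base.one
      have e11' : u 11 = i + 1 := (hk' 11 rfl).trans h11
      have := hpre.eight
      refine (spec_op (W := W) (by omega) (by omega) (by simp [Op.eval]; omega) ?_).pr
      exact hu.congr (by simp)
  · intro i m' hi hI h11 _
    exact (spec_trialLoop_body (W := W) j hpre hf hW hi hI h11).mono le_rfl fun _ h => h.1
  · rw [Finset.prod_const, Finset.card_range]
    linarith [one_sub_pow_le_half hq1 hq]
  · rintro m₂ ⟨hs, hI, -⟩ hk'
    have e9 : m₂ 9 = m 9 := (hk' 9 rfl).trans (hk 9 rfl)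
    have e1 := hI.base.one
    refine (spec_op (W := W) (by omega) (by omega) (by simp [Op.eval]; omega) ?_).pr
    exact hs.congr (by simp)

end Algorithm

/-! ### Rounds over the extension sizes, and initialisation -/

section Rounds

variable {n : ℕ} {L : Finset (ℝ × ℝ)} {F : Set (Finset (Fin n))}
  {O : ∀ j : L, ExtOracle F j.1.1} {fuel : ℕ} {m : ℕ → ℕ} {W : ℕ}

/-- The state before the trials for one extension size. -/
structure RoundPre (F : Set (Finset (Fin n))) (W : ℕ) (m : ℕ → ℕ) : Prop where
  base : Base n m
  three : m 3 = 2 ^ n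
  five : m 5 < 2 ^ W
  six : m 6 < 2 ^ W
  seven : m 7 + 1 < 2 ^ W
  twenty : m 20 < 2 ^ W
  twentyone : m 21 < 2 ^ W
  mul : m 6 * m 21 < 2 ^ W
  candidate : Candidate F m

theorem spec_prepareRound (h : RoundPre F W m) (hW : 2 * n + 2 ≤ W) :
    Spec O fuel prepareRound m (2 * (3 * W + 1)) fun m' => m' 8 = m 5 / m 6 ∧ m' 9 = n := by
  have h0 := h.base.zero
  have h2 := h.base.two
  have h5 := h.five
  have h6 := h.six
  have hn : n < 2 ^ W := lt_two_pow_of_le (by omega)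
  have hd : m 5 / m 6 ≤ m 5 := Nat.div_le_self _ _
  unfold prepareRound
  refine (spec_op_seq (W := W) ?_ ?_ ?_ (spec_op (W := W) ?_ ?_ ?_ ?_)).mono
    (by linarith) fun _ h => h
  all_goals try simp [Op.eval, h0, h2]
  all_goals omega

/-- The invariant of the loop over the set sizes. -/
structure SizeLoop (F : Set (Finset (Fin n))) (m₀ m : ℕ → ℕ) : Prop where
  base : Base n m
  three : m 3 = 2 ^ n
  seven : m 7 = m₀ 7
  eight : m 8 = m₀ 5 / m₀ 6
  better : Better F m₀ m

theorem SizeLoop.start (hpre : RoundPre F W m) {m₁ : ℕ → ℕ} (h8 : m₁ 8 = m 5 / m 6)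
    (hk : ∀ r, (prepareRound : Prog L).keeps r = true → m₁ r = m r) : SizeLoop F m m₁ :=
  ⟨hpre.base.of_keeps hk, (hk 3 rfl).trans hpre.three, hk 7 rfl, h8,
    (Better.refl hpre.candidate).congr_right (hk 4 rfl)⟩

theorem SizeLoop.trialsPre (hpre : RoundPre F W m) {m' : ℕ → ℕ} (hI : SizeLoop F m m') {i : ℕ}
    (hi : i < n) (h9 : m' 9 = i + 1) : TrialsPre F W m' := by
  have e7 := hI.seven
  have e8 := hI.eight
  have h5 := hpre.five
  have h7 := hpre.seven
  have hd : m 5 / m 6 ≤ m 5 := Nat.div_le_self _ _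
  exact ⟨hI.base, hI.three, by omega, by omega, by omega, hI.better.1⟩

theorem spec_sizeLoop_body (j : L) (hpre : RoundPre F W m) (hf : n < fuel) (hf5 : m 5 < fuel)
    (hW : 2 * n + 2 ≤ W) {i : ℕ} {m' : ℕ → ℕ} (hi : i < n) (hI : SizeLoop F m m')
    (h9 : m' 9 = i + 1) :
    Spec O fuel (trials j) m' (5 * (3 * W + 1) + (m 5 / m 6 : ℕ) *
      (trialCost j.1.2 n W (m 7) + 2 * (3 * W + 1)))
      fun m'' => (SizeLoop F m m'' ∧ m'' 9 = i) ∧ Better F m' m'' := by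
  have e7 := hI.seven
  have e8 := hI.eight
  have hd : m 5 / m 6 ≤ m 5 := Nat.div_le_self _ _
  rw [← e7, ← e8]
  refine (spec_trials (W := W) j (hI.trialsPre hpre hi h9) hf (by omega) hW).frame.mono le_rfl ?_
  rintro u ⟨⟨u1, u2⟩, hk⟩
  exact ⟨⟨⟨hI.base.of_keeps hk, (hk 3 rfl).trans hI.three, (hk 7 rfl).trans e7,
    (hk 8 rfl).trans e8, hI.better.trans u1⟩, by omega⟩, u1⟩

theorem spec_finishRound (h1 : m 1 = 1) (h6 : m 6 < 2 ^ W) (h7 : m 7 + 1 < 2 ^ W)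
    (h20 : m 20 < 2 ^ W) (h21 : m 21 < 2 ^ W) (hmul : m 6 * m 21 < 2 ^ W) (hW : 1 ≤ W) :
    Spec O fuel finishRound m (3 * (3 * W + 1)) fun m' =>
      m' 4 = m 4 ∧ m' 6 = m 6 * m 21 ∧ m' 7 = m 7 + 1 ∧ m' 20 = m 20 - 1 := by
  unfold finishRound
  refine (spec_op_seq (W := W) ?_ ?_ ?_ (spec_op_seq (W := W) ?_ ?_ ?_
    (spec_op (W := W) ?_ ?_ ?_ ?_))).mono (by linarith) fun _ h => h
  all_goals try simp [Op.eval, h1]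
  all_goals omega

/-- The cost of the trials for one extension size `ℓ`, with `N` trials for each set size. -/
def roundCost (c : ℝ) (n W ℓ N : ℕ) : ℝ :=
  n * (N * (trialCost c n W ℓ + 2 * (3 * W + 1)) + 6 * (3 * W + 1)) + 6 * (3 * W + 1)

theorem spec_round (j : L) (hpre : RoundPre F W m) (hf : n < fuel) (hf5 : m 5 < fuel)
    (hW : 2 * n + 2 ≤ W) :
    Spec O fuel (round j) m (roundCost j.1.2 n W (m 7) (m 5 / m 6)) fun m' =>
      Better F m m' ∧ m' 6 = m 6 * m 21 ∧ m' 7 = m 7 + 1 ∧ m' 20 = m 20 - 1 := by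
  unfold round
  refine (spec_seq (spec_prepareRound (W := W) hpre hW) ?_
    (K' := (n * ((5 * (3 * W + 1) + (m 5 / m 6 : ℕ) *
      (trialCost j.1.2 n W (m 7) + 2 * (3 * W + 1))) + (3 * W + 1)) + (3 * W + 1)) +
      3 * (3 * W + 1))).mono (by unfold roundCost; linarith) fun _ h => h
  rintro m₁ ⟨e8, e9⟩ hk
  refine spec_seq (spec_loop (x := 9) (N := n) (W := W) (I := fun _ m' => SizeLoop F m m')
    e9 hf (lt_two_pow_of_le (by omega)) (SizeLoop.start hpre e8 hk) ?_) ?_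
  · intro i m' hi hI h9 _
    exact (spec_sizeLoop_body (W := W) j hpre hf hf5 hW hi hI h9).mono le_rfl fun _ h => h.1
  · rintro m₂ ⟨hI, -⟩ hk'
    have e6 : m₂ 6 = m 6 := (hk' 6 rfl).trans (hk 6 rfl)
    have e20 : m₂ 20 = m 20 := (hk' 20 rfl).trans (hk 20 rfl)
    have e21 : m₂ 21 = m 21 := (hk' 21 rfl).trans (hk 21 rfl)
    refine (spec_finishRound (W := W) hI.base.one (by rw [e6]; exact hpre.six)
      (by rw [hI.seven]; exact hpre.seven) (by rw [e20]; exact hpre.twenty)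
      (by rw [e21]; exact hpre.twentyone) (by rw [e6, e21]; exact hpre.mul) (by omega)).mono le_rfl
        ?_
    rintro u ⟨u4, u6, u7, u20⟩
    exact ⟨hI.better.congr_right u4, by rw [u6, e6, e21], by rw [u7, hI.seven], by rw [u20, e20]⟩

theorem pr_round (j : L) (hF : IsMonotone F) (hpre : RoundPre F W m) (hf : n < fuel)
    (hf5 : m 5 < fuel)
    (hW : 2 * n + 2 ≤ W) {S : Finset (Fin n)} (hS : S ∈ F) {b : ℝ} {s : ℕ} (hs1 : 1 ≤ s)
    (hsn : s ≤ n) (hb : s + j.1.1 * m 7 ≤ b)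
    (hq : 1 ≤ (m 5 / m 6 : ℕ) * ((almostSupersets S s (m 7)).card *
      (bias n s ^ s * (1 - bias n s) ^ (n - s)) * (1 / 2)))
    (hq1 : (almostSupersets S s (m 7)).card *
      (bias n s ^ s * (1 - bias n s) ^ (n - s)) * (1 / 2) ≤ 1) :
    Pr O fuel (round j) m (1 / 2) (Small n b) := by
  unfold round
  refine pr_seq_spec (spec_prepareRound (W := W) hpre hW) ?_
  rintro m₁ ⟨e8, e9⟩ hk
  rw [← mul_one (1 / 2 : ℝ)]
  -- Register `9` runs from `n` down to `1`, so size `s` is treated by the iteration that leaves `s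
  -- - 1`.
  refine pr_seq (by norm_num) ((pr_loop_once (x := 9) (N := n) (G := Small n b) (i₀ := s - 1)
    (I := fun _ m' => SizeLoop F m m') (K := 5 * (3 * W + 1) + (m 5 / m 6 : ℕ) *
      (trialCost j.1.2 n W (m 7) + 2 * (3 * W + 1))) e9 hf (SizeLoop.start hpre e8 hk)
    (by norm_num) (by norm_num) ?_ (by omega) ?_).and (spec_loop (x := 9) (N := n) (W := W)
    (I := fun _ m' => SizeLoop F m m') (K := 5 * (3 * W + 1) + (m 5 / m 6 : ℕ) *
      (trialCost j.1.2 n W (m 7) + 2 * (3 * W + 1)))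
    e9 hf (lt_two_pow_of_le (by omega)) (SizeLoop.start hpre e8 hk) ?_)) ?_
  · intro i m' hi hI h9 _
    exact (spec_sizeLoop_body (W := W) j hpre hf hf5 hW hi hI h9).mono le_rfl
      fun _ h => ⟨h.1, h.2.small⟩
  · intro m' hI h9 _
    have h9 : m' 9 = s := by omega
    have hd : m 5 / m 6 ≤ m 5 := Nat.div_le_self _ _
    have e8' := hI.eight
    refine pr_trials (W := W) j hF (hI.trialsPre hpre (i := s - 1) (by omega) (by omega)) hf
      (by omega) hW hS ?_ ?_ ?_
    · rw [h9, hI.seven]; exact hb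
    · rw [h9, hI.seven, hI.eight]; exact hq
    · rw [h9, hI.seven]; exact hq1
  · intro i m' hi hI h9 _
    exact (spec_sizeLoop_body (W := W) j hpre hf hf5 hW hi hI h9).mono le_rfl fun _ h => h.1
  · rintro m₂ ⟨hs, hI, -⟩ hk'
    have e6 : m₂ 6 = m 6 := (hk' 6 rfl).trans (hk 6 rfl)
    have e20 : m₂ 20 = m 20 := (hk' 20 rfl).trans (hk 20 rfl)
    have e21 : m₂ 21 = m 21 := (hk' 21 rfl).trans (hk 21 rfl)
    refine ((spec_finishRound (W := W) hI.base.one (by rw [e6]; exact hpre.six)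
      (by rw [hI.seven]; exact hpre.seven) (by rw [e20]; exact hpre.twenty)
      (by rw [e21]; exact hpre.twentyone) (by rw [e6, e21]; exact hpre.mul)
      (by omega)).mono le_rfl ?_).pr
    rintro u ⟨u4, -⟩
    exact hs.congr u4

/-! ### The whole algorithm -/

/-- Multiply register `5` by register `22` and register `6` by register `23`. -/
def powerStep {ι : Type} : Prog ι := .op .mul 5 5 22 ;; .op .mul 6 6 23 ;; .op .sub 13 13 1

/-- Compute the first candidate. -/
def firstCandidate {ι : Type} (j : ι) : Prog ι :=
  -- Register `3` becomes `2 ^ n`. Register `2` holds zero and codes both the empty set and `ℓ = 0`: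
  -- the query costs one, yields a member of the family, and finds the optimum with probability at
  -- least `1 / 2` if that is empty.
  .const 1 1 ;; .op .shl 3 1 0 ;; .query j 4 2 2

/-- Compute the constants `K * a ^ n` and `b ^ n` that determine the numbers of trials. -/
def setup {ι : Type} (K a b M : ℕ) : Prog ι :=
  .const 5 K ;; .const 6 1 ;; .const 21 M ;; .const 22 a ;; .const 23 b ;; .op .add 13 0 2 ;;
  .loop 13 powerStep ;; .op .add 20 0 1

/-- For all extension sizes `ℓ` and all set sizes, make `K * a ^ n / (b ^ n * M ^ ℓ)` trials. -/
def algorithm {ι : Type} (K a b M : ℕ) (j : ι) : Prog ι :=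
  firstCandidate j ;; setup K a b M ;; .loop 20 (round j) ;; .op .add 0 4 2

/-- All numbers that occur have at most `W` bits. -/
structure WordSize (n W K a b M : ℕ) : Prop where
  two_mul_le : 2 * n + 2 ≤ W
  constK : K < 2 ^ W
  consta : a < 2 ^ W
  constb : b < 2 ^ W
  constM : M < 2 ^ W
  num : ∀ i ≤ n, K * a ^ i < 2 ^ W
  -- The exponent `n + 1` occurs because the denominator is multiplied by `M` once more after the
  -- last round.
  den : ∀ i ≤ n, ∀ l ≤ n + 1, b ^ i * M ^ l < 2 ^ W

/-- The word length is linear in `n`, so the logarithmic cost criterion contributes only a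
polynomial factor. -/
theorem wordSize (n K a b M : ℕ) : WordSize n ((K + a + b + M + 2) * (n + 1)) K a b M := by
  have hpow : ∀ x i : ℕ, x ^ i ≤ 2 ^ (x * i) := fun x i => by
    rw [pow_mul]
    exact Nat.pow_le_pow_left Nat.lt_two_pow_self.le i
  have hW : (K + a + b + M + 2) * (n + 1) = K * n + a * n + b * n + M * n + K + a + b + M +
    (2 * n + 2) := by ring
  refine ⟨by rw [hW]; omega, ?_, ?_, ?_, ?_, ?_, ?_⟩
  · exact lt_two_pow_of_le (by rw [hW]; omega)
  · exact lt_two_pow_of_le (by rw [hW]; omega)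
  · exact lt_two_pow_of_le (by rw [hW]; omega)
  · exact lt_two_pow_of_le (by rw [hW]; omega)
  · intro i hi
    have h1 : a * i ≤ a * n := Nat.mul_le_mul_left _ hi
    calc K * a ^ i ≤ 2 ^ K * 2 ^ (a * i) := Nat.mul_le_mul Nat.lt_two_pow_self.le (hpow a i)
      _ = 2 ^ (K + a * i) := (pow_add 2 _ _).symm
      _ < _ := Nat.pow_lt_pow_right (by norm_num) (by rw [hW]; omega)
  · intro i hi l hl
    have h1 : b * i ≤ b * n := Nat.mul_le_mul_left _ hi
    have h2 : M * l ≤ M * n + M := by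
      have := Nat.mul_le_mul_left M hl
      rwa [Nat.mul_add, Nat.mul_one] at this
    calc b ^ i * M ^ l ≤ 2 ^ (b * i) * 2 ^ (M * l) := Nat.mul_le_mul (hpow b i) (hpow M l)
      _ = 2 ^ (b * i + M * l) := (pow_add 2 _ _).symm
      _ < _ := Nat.pow_lt_pow_right (by norm_num) (by rw [hW]; omega)

theorem spec_powerStep (h1 : m 1 = 1) (h5 : m 5 < 2 ^ W) (h22 : m 22 < 2 ^ W)
    (h522 : m 5 * m 22 < 2 ^ W) (h6 : m 6 < 2 ^ W) (h23 : m 23 < 2 ^ W)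
    (h623 : m 6 * m 23 < 2 ^ W) (h13 : m 13 < 2 ^ W) (hW : 1 ≤ W) :
    Spec O fuel powerStep m (3 * (3 * W + 1)) fun m' =>
      m' 5 = m 5 * m 22 ∧ m' 6 = m 6 * m 23 ∧ m' 13 = m 13 - 1 := by
  unfold powerStep
  refine (spec_op_seq (W := W) ?_ ?_ ?_ (spec_op_seq (W := W) ?_ ?_ ?_
    (spec_op (W := W) ?_ ?_ ?_ ?_))).mono (by linarith) fun _ h => h
  all_goals try simp [Op.eval, h1]
  all_goals omega

theorem spec_firstCandidate (j : L) (h0 : m 0 = n) (h2 : m 2 = 0) (hW : n + 1 ≤ W) :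
    Spec O fuel (firstCandidate j) m (1 + 3 * (3 * W + 1)) fun m' =>
      Base n m' ∧ m' 3 = 2 ^ n ∧ Candidate F m' := by
  have hn : n < 2 ^ W := lt_two_pow_of_le (by omega)
  have hp : 2 ^ n < 2 ^ W := Nat.pow_lt_pow_right (by norm_num) (by omega)
  have hW0 : W ≠ 0 := by omega
  unfold firstCandidate
  refine (spec_const_seq (W := W) ?_ (spec_op_seq (W := W) ?_ ?_ ?_
    (spec_query (W := W) ?_ ?_ (by omega) ?_))).mono (le_of_eq ?_) fun _ h => h
  case refine_7 =>
    intro S hS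
    have hd : decode n 0 = ∅ := by simp [decode]
    simp [h2, hd] at hS
    refine ⟨⟨by simp [h0], by simp, by simp [h2]⟩, by simp [Op.eval, h0, Nat.shiftLeft_eq], ?_⟩
    unfold Candidate
    simp [decode_encode, encode_lt, hS]
  case refine_8 =>
    simp [h2]
    ring
  all_goals simp [Op.eval, h0, h2, Nat.shiftLeft_eq]
  all_goals omega

theorem spec_setup {K a b M : ℕ} (hm : Base n m) (h : WordSize n W K a b M) (hf : n < fuel) :
    Spec O fuel (setup K a b M) m ((4 * n + 8) * (3 * W + 1)) fun m' =>
      m' 5 = K * a ^ n ∧ m' 6 = b ^ n ∧ m' 20 = n + 1 ∧ m' 21 = M := by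
  have hW := h.two_mul_le
  have hn : n < 2 ^ W := lt_two_pow_of_le (by omega)
  have hn1 : n + 1 < 2 ^ W := lt_two_pow_of_le (by omega)
  have hW0 : W ≠ 0 := by omega
  have h0 := hm.zero
  have h1 := hm.one
  have h2 := hm.two
  unfold setup
  refine (spec_const_seq (W := W) h.constK (spec_const_seq (W := W) ?_
    (spec_const_seq (W := W) h.constM (spec_const_seq (W := W) h.consta
    (spec_const_seq (W := W) h.constb (spec_op_seq (W := W) ?_ ?_ ?_
    (spec_seq (spec_loop (x := 13) (N := n) (W := W) (K := 3 * (3 * W + 1))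
      (I := fun i m' => m' 5 = K * a ^ (n - i) ∧ m' 6 = b ^ (n - i)) ?_ hf hn ?_ ?_) ?_
      (K' := 3 * W + 1)))))))).mono (by linarith) fun _ h => h
  · simp [hW0]
  · simp [h0, hn]
  · simp [h2]
  · simp [Op.eval, h0, h2, hn]
  · simp [Op.eval, h0, h2]
  · simp
  · rintro i m' hi ⟨e5, e6⟩ e13 hk
    have e1 : m' 1 = 1 := by rw [hk 1 rfl]; simp [h1]
    have e22 : m' 22 = a := by rw [hk 22 rfl]; simp
    have e23 : m' 23 = b := by rw [hk 23 rfl]; simp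
    have hni : n - i = n - (i + 1) + 1 := by omega
    have g5 : m' 5 * m' 22 = K * a ^ (n - i) := by rw [e5, e22, hni, pow_succ, mul_assoc]
    have g6 : m' 6 * m' 23 = b ^ (n - i) := by rw [e6, e23, hni, pow_succ]
    have hden : ∀ i ≤ n, b ^ i < 2 ^ W := fun i hi => by
      simpa using h.den i hi 0 (by omega)
    refine (spec_powerStep (W := W) e1 ?_ ?_ ?_ ?_ ?_ ?_ ?_ (by omega)).mono le_rfl ?_
    · rw [e5]; exact h.num _ (by omega)
    · rw [e22]; exact h.consta
    · rw [g5]; exact h.num _ (by omega)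
    · rw [e6]; exact hden _ (by omega)
    · rw [e23]; exact h.constb
    · rw [g6]; exact hden _ (by omega)
    · omega
    · rintro u ⟨u5, u6, u13⟩
      exact ⟨⟨u5.trans g5, u6.trans g6⟩, by omega⟩
  · rintro m' ⟨⟨e5, e6⟩, -⟩ hk
    simp only [Nat.sub_zero] at e5 e6
    have e0 : m' 0 = n := by rw [hk 0 rfl]; simp [h0]
    have e1 : m' 1 = 1 := by rw [hk 1 rfl]; simp [h1]
    have e21 : m' 21 = M := by rw [hk 21 rfl]; simp
    refine spec_op (W := W) (by omega) (by omega) (by simp [Op.eval, e0, e1, hn1]) ?_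
    simp [Op.eval, e0, e1, e5, e6, e21]

end Rounds

/-! ### Correctness of the whole algorithm -/

section Correctness

variable {n : ℕ} {L : Finset (ℝ × ℝ)} {F : Set (Finset (Fin n))}
  {O : ∀ j : L, ExtOracle F j.1.1} {fuel : ℕ} {m : ℕ → ℕ} {W K a b M : ℕ}

/-- The invariant of the loop over the extension sizes. -/
structure ExtensionLoop (F : Set (Finset (Fin n))) (K a b M : ℕ) (i : ℕ) (m : ℕ → ℕ) : Prop where
  base : Base n m
  three : m 3 = 2 ^ n
  five : m 5 = K * a ^ n
  six : m 6 = b ^ n * M ^ (n + 1 - i)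
  seven : m 7 = n + 1 - i
  twentyone : m 21 = M
  candidate : Candidate F m

theorem ExtensionLoop.roundPre (hw : WordSize n W K a b M) {i : ℕ} (hi : i < n + 1)
    (hI : ExtensionLoop F K a b M (i + 1) m) (h20 : m 20 = i + 1) : RoundPre F W m := by
  have hW := hw.two_mul_le
  have hn : n + 1 < 2 ^ W := lt_two_pow_of_le (by omega)
  have e7 := hI.seven
  refine ⟨hI.base, hI.three, ?_, ?_, by omega, by omega, ?_, ?_, hI.candidate⟩
  · rw [hI.five]; exact hw.num n le_rfl
  · rw [hI.six]; exact hw.den n le_rfl _ (by omega)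
  · rw [hI.twentyone]; exact hw.constM
  · rw [hI.six, hI.twentyone, mul_assoc, ← pow_succ]
    exact hw.den n le_rfl _ (by omega)

theorem spec_extensionLoop_body (j : L) (hw : WordSize n W K a b M) (hf : n < fuel)
    (hfK : K * a ^ n < fuel) {R : ℝ}
    (hR : ∀ ℓ ≤ n, roundCost j.1.2 n W ℓ (K * a ^ n / (b ^ n * M ^ ℓ)) ≤ R) {i : ℕ}
    (hi : i < n + 1) (hI : ExtensionLoop F K a b M (i + 1) m) (h20 : m 20 = i + 1) :
    Spec O fuel (round j) m R fun m' =>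
      (ExtensionLoop F K a b M i m' ∧ m' 20 = i) ∧ Better F m m' := by
  have e7 : m 7 = n - i := by rw [hI.seven]; omega
  have hni : n + 1 - (i + 1) = n - i := by omega
  have h := (spec_round (W := W) (O := O) j (hI.roundPre hw hi h20) hf (by rw [hI.five]; exact hfK)
    hw.two_mul_le).frame
  rw [hI.five, hI.six, e7, hI.twentyone, hni] at h
  refine h.mono (hR _ (by omega)) ?_
  rintro u ⟨⟨uB, u6, u7, u20⟩, hk⟩
  refine ⟨⟨⟨hI.base.of_keeps hk, (hk 3 rfl).trans hI.three, (hk 5 rfl).trans hI.five, ?_, ?_,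
    (hk 21 rfl).trans hI.twentyone, uB.1⟩, by omega⟩, uB⟩
  · rw [u6, show n + 1 - i = n - i + 1 by omega, pow_succ, mul_assoc]
  · omega

/-- The registers at the start of the algorithm. -/
def startMem (n : ℕ) : ℕ → ℕ := fun i => if i = 0 then n else 0

theorem ExtensionLoop.start {m₁ m₂ : ℕ → ℕ} (hB : Base n m₁) (h3 : m₁ 3 = 2 ^ n)
    (hC : Candidate F m₁) (h7 : m₁ 7 = 0)
    (h : m₂ 5 = K * a ^ n ∧ m₂ 6 = b ^ n ∧ m₂ 20 = n + 1 ∧ m₂ 21 = M)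
    (hk : ∀ r, r ∈ [0, 1, 2, 3, 4, 7] → m₂ r = m₁ r) : ExtensionLoop F K a b M (n + 1) m₂ := by
  obtain ⟨h5, h6, -, h21⟩ := h
  refine ⟨⟨?_, ?_, ?_⟩, ?_, h5, by simpa using h6, ?_, h21, hC.congr (hk 4 (by simp))⟩
  · rw [hk 0 (by simp), hB.zero]
  · rw [hk 1 (by simp), hB.one]
  · rw [hk 2 (by simp), hB.two]
  · rw [hk 3 (by simp), h3]
  · rw [hk 7 (by simp), h7]; simp

theorem setup_keeps (K a b M : ℕ) (r : ℕ) (hr : r ∈ [0, 1, 2, 3, 4, 7]) :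
    (setup K a b M : Prog L).keeps r = true := by
  fin_cases hr <;> rfl

theorem spec_extensionLoop (j : L) (hw : WordSize n W K a b M) (hf : n + 1 < fuel)
    (hfK : K * a ^ n < fuel) {R : ℝ}
    (hR : ∀ ℓ ≤ n, roundCost j.1.2 n W ℓ (K * a ^ n / (b ^ n * M ^ ℓ)) ≤ R)
    (hst : ExtensionLoop F K a b M (n + 1) m) (h20 : m 20 = n + 1) :
    Spec O fuel (.loop 20 (round j)) m ((n + 1 : ℕ) * (R + (3 * W + 1)) + (3 * W + 1))
      fun m' => ExtensionLoop F K a b M 0 m' := by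
  have hW := hw.two_mul_le
  refine (spec_loop (x := 20) (N := n + 1) (W := W) (I := fun i m' => ExtensionLoop F K a b M i m')
    h20 hf (lt_two_pow_of_le (by omega)) hst ?_).mono le_rfl fun _ h => h.1
  intro i m' hi hI h20 _
  exact (spec_extensionLoop_body j hw (by omega) hfK hR hi hI h20).mono le_rfl fun _ h => h.1

theorem spec_algorithm (j : L) (hw : WordSize n W K a b M) (hf : n + 1 < fuel)
    (hfK : K * a ^ n < fuel) {R : ℝ}
    (hR : ∀ ℓ ≤ n, roundCost j.1.2 n W ℓ (K * a ^ n / (b ^ n * M ^ ℓ)) ≤ R) :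
    Spec O fuel (algorithm K a b M j) (startMem n)
      ((n + 1) * (R + (3 * W + 1)) + (4 * n + 13) * (3 * W + 1) + 1)
      fun m' => decode n (m' 0) ∈ F := by
  have hW := hw.two_mul_le
  unfold algorithm
  refine (spec_seq (spec_firstCandidate (W := W) (n := n) j (by simp [startMem])
    (by simp [startMem]) (by omega)) ?_
    (K' := (4 * n + 8) * (3 * W + 1) + (((n + 1 : ℕ) * (R + (3 * W + 1)) + (3 * W + 1)) +
      (3 * W + 1)))).mono (by push_cast; linarith) fun _ h => h
  rintro m₁ ⟨hB, h3, hC⟩ hk₁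
  refine spec_seq (spec_setup (W := W) hB hw (by omega)) ?_
  intro m₂ h₂ hk₂
  have h7 : m₁ 7 = 0 := by rw [hk₁ 7 rfl]; simp [startMem]
  have hst : ExtensionLoop F K a b M (n + 1) m₂ := ExtensionLoop.start hB h3 hC h7 h₂
    fun r hr => hk₂ r (setup_keeps K a b M r hr)
  refine spec_seq (spec_extensionLoop j hw hf hfK hR hst h₂.2.2.1) ?_
  intro m₃ hI _
  have hC' := hI.candidate.1
  have h2 := hI.base.two
  have hp : 2 ^ n ≤ 2 ^ W := Nat.pow_le_pow_right (by norm_num) (by omega)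
  refine spec_op (W := W) (by omega) (by omega) (by simp [Op.eval]; omega) ?_
  simpa [Op.eval, h2] using hI.candidate.2

/-- The common frame of two ways to succeed: `P` records what the first candidate achieves, either
that it is small already or nothing at all. -/
theorem pr_algorithm (j : L) (hw : WordSize n W K a b M) (hf : n + 1 < fuel)
    (hfK : K * a ^ n < fuel) {R : ℝ}
    (hR : ∀ ℓ ≤ n, roundCost j.1.2 n W ℓ (K * a ^ n / (b ^ n * M ^ ℓ)) ≤ R)
    {P : (ℕ → ℕ) → Prop} (hP : ∀ m m' : ℕ → ℕ, P m → m' 4 = m 4 → P m') {B p v : ℝ}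
    (hp : 0 ≤ p) (hv : 0 ≤ v) (hfirst : Pr O fuel (firstCandidate j) (startMem n) p P)
    (hloop : ∀ m₂, ExtensionLoop F K a b M (n + 1) m₂ → m₂ 20 = n + 1 → P m₂ →
      Pr O fuel (.loop 20 (round j)) m₂ v (Small n B)) :
    Pr O fuel (algorithm K a b M j) (startMem n) (p * v)
      fun m' => ((decode n (m' 0)).card : ℝ) ≤ B := by
  have hW := hw.two_mul_le
  unfold algorithm
  refine pr_seq hp (hfirst.and (spec_firstCandidate (W := W) (n := n) j (by simp [startMem])
    (by simp [startMem]) (by omega))) ?_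
  rintro m₁ ⟨hP₁, hB, h3, hC⟩ hk₁
  refine pr_seq_spec (spec_setup (W := W) hB hw (by omega)) ?_
  intro m₂ h₂ hk₂
  have h7 : m₁ 7 = 0 := by rw [hk₁ 7 rfl]; simp [startMem]
  have hst : ExtensionLoop F K a b M (n + 1) m₂ := ExtensionLoop.start hB h3 hC h7 h₂
    fun r hr => hk₂ r (setup_keeps K a b M r hr)
  rw [← mul_one v]
  refine pr_seq hv ((hloop m₂ hst h₂.2.2.1 (hP _ _ hP₁ (hk₂ 4 rfl))).and
    (spec_extensionLoop j hw hf hfK hR hst h₂.2.2.1)) ?_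
  rintro m₃ ⟨hs, hI⟩ _
  have hC' := hI.candidate.1
  have h2 := hI.base.two
  have hpw : 2 ^ n ≤ 2 ^ W := Nat.pow_le_pow_right (by norm_num) (by omega)
  refine (spec_op (W := W) (by omega) (by omega) (by simp [Op.eval]; omega) ?_).pr
  simpa [Op.eval, h2, Small] using hs

/-- The algorithm keeps a small first candidate. -/
theorem pr_algorithm_of_first (j : L) (hw : WordSize n W K a b M) (hf : n + 1 < fuel)
    (hfK : K * a ^ n < fuel) {R : ℝ}
    (hR : ∀ ℓ ≤ n, roundCost j.1.2 n W ℓ (K * a ^ n / (b ^ n * M ^ ℓ)) ≤ R) {B p : ℝ}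
    (hp : 0 ≤ p) (hfirst : Pr O fuel (firstCandidate j) (startMem n) p (Small n B)) :
    Pr O fuel (algorithm K a b M j) (startMem n) p
      fun m' => ((decode n (m' 0)).card : ℝ) ≤ B := by
  have hW := hw.two_mul_le
  have h := pr_algorithm (B := B) (v := 1) j hw hf hfK hR (fun m m' hm h4 => hm.congr h4) hp
    zero_le_one hfirst ?_
  · rwa [mul_one] at h
  intro m₂ hst h20 hs
  refine ((spec_loop (x := 20) (N := n + 1) (W := W) (K := R)
    (I := fun i m' => ExtensionLoop F K a b M i m' ∧ Small n B m') h20 hf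
    (lt_two_pow_of_le (by omega)) ⟨hst, hs⟩ ?_).mono le_rfl fun _ h => h.1.2).pr
  rintro i m' hi ⟨hI, hs'⟩ h20' _
  exact (spec_extensionLoop_body j hw (by omega) hfK hR hi hI h20').mono le_rfl
    fun u h => ⟨⟨h.1.1, h.2.small hs'⟩, h.1.2⟩

theorem pr_firstCandidate_empty (j : L) (hF : ∅ ∈ F) :
    Pr O fuel (firstCandidate j) (startMem n) (1 / 2) (Small n 0) := by
  have hn : n < 2 ^ (n + 1) := lt_two_pow_of_le (by omega)
  have hp : 2 ^ n < 2 ^ (n + 1) := Nat.pow_lt_pow_right (by norm_num) (by omega)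
  have hd : decode n 0 = ∅ := by simp [decode]
  unfold firstCandidate
  refine pr_seq_spec (spec_const (W := n + 1) (by simp)
    (Q := fun m' => m' = Function.update (startMem n) 1 1) rfl) ?_
  rintro _ rfl -
  refine pr_seq_spec (spec_op (W := n + 1) (Q := fun m' => m' 2 = 0) (by simp)
    (by simp [startMem, hn]) (by simpa [startMem, Op.eval, Nat.shiftLeft_eq] using hp)
    (by simp [startMem])) ?_
  intro m₁ e2 _
  refine pr_query ?_ ?_
  · refine ⟨∅, ?_, by simp⟩
    rw [e2, hd]
    simpa using hF
  · rintro S ⟨-, hS⟩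
    rw [e2] at hS
    simp only [Small, Function.update_self, decode_encode]
    simpa using hS

theorem pr_algorithm_of_round (j : L) (hF : IsMonotone F) (hw : WordSize n W K a b M)
    (hf : n + 1 < fuel) (hfK : K * a ^ n < fuel) {R : ℝ}
    (hR : ∀ ℓ ≤ n, roundCost j.1.2 n W ℓ (K * a ^ n / (b ^ n * M ^ ℓ)) ≤ R) {B : ℝ}
    {S : Finset (Fin n)} (hS : S ∈ F) {s ℓ : ℕ} (hs1 : 1 ≤ s) (hsn : s + ℓ ≤ n)
    (hb : s + j.1.1 * ℓ ≤ B)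
    (hq : 1 ≤ (K * a ^ n / (b ^ n * M ^ ℓ) : ℕ) * ((almostSupersets S s ℓ).card *
      (bias n s ^ s * (1 - bias n s) ^ (n - s)) * (1 / 2)))
    (hq1 : (almostSupersets S s ℓ).card *
      (bias n s ^ s * (1 - bias n s) ^ (n - s)) * (1 / 2) ≤ 1) :
    Pr O fuel (algorithm K a b M j) (startMem n) (1 / 2)
      fun m' => ((decode n (m' 0)).card : ℝ) ≤ B := by
  have hW := hw.two_mul_le
  have h := pr_algorithm (O := O) (P := fun _ => True) (B := B) (v := 1 / 2) j hw hf hfK hR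
    (fun _ _ _ _ => trivial) zero_le_one (by norm_num)
    ((spec_firstCandidate (W := W) (n := n) j (by simp [startMem])
      (by simp [startMem]) (by omega)).mono le_rfl fun _ _ => trivial).pr ?_
  · rwa [one_mul] at h
  intro m₂ hst h20 _
  -- Extension sizes increase from `0` to `n`, so size `ℓ` is treated by the round that leaves `n -
  -- ℓ`.
  refine pr_loop_once (x := 20) (N := n + 1) (G := Small n B) (i₀ := n - ℓ) (K := R)
    (I := fun i m' => ExtensionLoop F K a b M i m') h20 hf hst (by norm_num) (by norm_num) ?_
    (by omega) ?_
  · intro i m' hi hI h20' _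
    exact (spec_extensionLoop_body j hw (by omega) hfK hR hi hI h20').mono le_rfl
      fun _ h => ⟨h.1, h.2.small⟩
  · intro m' hI h20' _
    have e7 : m' 7 = ℓ := by rw [hI.seven]; omega
    have hni : n + 1 - (n - ℓ + 1) = ℓ := by omega
    refine pr_round (W := W) (s := s) j hF (hI.roundPre hw (by omega) h20') (by omega)
      (by rw [hI.five]; exact hfK) hW hS hs1 (by omega) ?_ ?_ ?_
    · rw [e7]; exact hb
    · rw [hI.five, hI.six, e7, hni]; exact hq
    · rw [e7]; exact hq1

end Correctness

/-! ### The upper bound -/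

theorem card_almostSupersets_mul_le_one {n s ℓ : ℕ} (S : Finset (Fin n)) {p : ℝ} (hp0 : 0 ≤ p)
    (hp1 : p ≤ 1) : (almostSupersets S s ℓ).card * (p ^ s * (1 - p) ^ (n - s)) ≤ 1 := by
  have hq : 0 ≤ 1 - p := by linarith
  rcases le_or_gt s n with hs | hs
  · have h1 : (almostSupersets S s ℓ).card ≤ n.choose s := by
      refine (Finset.card_filter_le _ _).trans ?_
      rw [Finset.card_powersetCard, Finset.card_univ, Fintype.card_fin]
    have h1' : ((almostSupersets S s ℓ).card : ℝ) ≤ n.choose s := by exact_mod_cast h1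
    have h2 := Finset.single_le_sum (f := fun i => p ^ i * (1 - p) ^ (n - i) * (n.choose i : ℝ))
      (fun i _ => by positivity) (Finset.mem_range.2 (Nat.lt_succ_of_le hs))
    rw [← add_pow, add_sub_cancel, one_pow] at h2
    calc _ ≤ (n.choose s : ℝ) * (p ^ s * (1 - p) ^ (n - s)) := by gcongr
      _ ≤ 1 := by linarith
  · have h1 : almostSupersets S s ℓ = ∅ := by
      rw [almostSupersets, Finset.powersetCard_eq_empty.2 (by simpa using hs)]
      rfl
    simp [h1]

/-- Polynomial factors are dominated by exponential ones. -/
theorem exists_nat_mul_pow_le {d₀ d : ℝ} (h0 : 0 < d₀) (hd : d₀ < d) (Q : ℝ) (hQ : 0 ≤ Q) :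
    ∃ K : ℕ, ∀ n : ℕ, Q * ((n : ℝ) + 1) ^ 2 * d₀ ^ n ≤ K * d ^ n := by
  have hdp : 0 < d := h0.trans hd
  have hr0 : 0 < d₀ / d := by positivity
  have hr : d₀ / d < 1 := (div_lt_one hdp).2 hd
  have h2 : Tendsto (fun n : ℕ => (n : ℝ) ^ 2 * (d₀ / d) ^ n) atTop (𝓝 0) :=
    tendsto_pow_const_mul_const_pow_of_abs_lt_one 2 (by rwa [abs_of_pos hr0])
  obtain ⟨C, hC⟩ := h2.bddAbove_range
  obtain ⟨K, hK⟩ := exists_nat_ge (Q * (C / (d₀ / d)))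
  refine ⟨K, fun n => ?_⟩
  have h3 : ((n + 1 : ℕ) : ℝ) ^ 2 * (d₀ / d) ^ (n + 1) ≤ C := hC ⟨n + 1, rfl⟩
  rw [pow_succ (d₀ / d), ← mul_assoc, ← le_div_iff₀ hr0] at h3
  push_cast at h3
  rw [div_pow, ← mul_div_assoc, div_le_iff₀ (by positivity)] at h3
  calc Q * ((n : ℝ) + 1) ^ 2 * d₀ ^ n = Q * (((n : ℝ) + 1) ^ 2 * d₀ ^ n) := by ring
    _ ≤ Q * (C / (d₀ / d) * d ^ n) := by gcongr
    _ = Q * (C / (d₀ / d)) * d ^ n := by ring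
    _ ≤ K * d ^ n := by gcongr

/-- Rounding down loses less than one trial, hence less than one expected success. -/
theorem one_le_floor_mul {x q : ℝ} (hq0 : 0 ≤ q) (hq1 : q ≤ 1) (h : 2 ≤ x * q) :
    1 ≤ (⌊x⌋₊ : ℝ) * q := by
  have h1 : x - 1 < ⌊x⌋₊ := Nat.sub_one_lt_floor x
  nlinarith

theorem toOuterMeasure_eq_expect {A : Type} (D : PMF (Option A)) (P : A → Prop) :
    D.toOuterMeasure {o | ∃ a, o = some a ∧ P a} = expect D 0 (Set.indicator {a | P a} 1) := by
  rw [toOuterMeasure_some, expect, tsum_option]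
  simp

theorem exists_card_eq_opt {n : ℕ} {F : Set (Finset (Fin n))} (hF : IsMonotone F) :
    ∃ S ∈ F, S.card = opt F := Nat.sInf_mem ⟨_, Set.mem_image_of_mem _ hF.1⟩

theorem start_eq (n : ℕ) : start n = ⟨startMem n, 0⟩ := rfl

theorem isApprox_algorithm {L : Finset (ℝ × ℝ)} {β Q d₀ : ℝ} {K a b M : ℕ} (j : L)
    (hb : 0 < b) (hM : 1 ≤ M) (hQ : 0 < Q) (hd₀ : 0 ≤ d₀)
    (hgood : ∀ n k : ℕ, 1 ≤ k → β * k < n → ∃ s ℓ, GoodParams j.1.1 β M Q d₀ n k s ℓ)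
    (hK : ∀ n : ℕ, 8 * Q * ((n : ℝ) + 1) ^ 2 * d₀ ^ n ≤ K * ((a : ℝ) / b) ^ n) :
    IsApprox L β (algorithm K a b M j) := by
  intro n F hF O
  have hw := wordSize n K a b M
  set W := (K + a + b + M + 2) * (n + 1) with hWd
  set fuel := n + 2 + K * a ^ n with hfuel
  obtain ⟨R, hR⟩ : ∃ R, ∀ ℓ ≤ n, roundCost j.1.2 n W ℓ (K * a ^ n / (b ^ n * M ^ ℓ)) ≤ R := by
    obtain ⟨R, hR⟩ := ((Finset.range (n + 1)).image
      fun ℓ => roundCost j.1.2 n W ℓ (K * a ^ n / (b ^ n * M ^ ℓ))).bddAbove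
    exact ⟨R, fun ℓ hℓ => hR (by
      simp only [Finset.coe_image, Set.mem_image, Finset.mem_coe, Finset.mem_range]
      exact ⟨ℓ, by omega, rfl⟩)⟩
  have hf : n + 1 < fuel := by omega
  have hfK : K * a ^ n < fuel := by omega
  have hspec := spec_algorithm (O := O) j hw hf hfK hR
  refine ⟨fuel, ?_, ?_⟩
  · intro o ho
    obtain ⟨m', c', rfl, h, -⟩ := hspec 0 o ho
    exact ⟨_, rfl, h⟩
  have hpr : Pr O fuel (algorithm K a b M j) (startMem n) (1 / 2)
      fun m' => ((decode n (m' 0)).card : ℝ) ≤ β * opt F := by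
    obtain ⟨S, hS, hSk⟩ := exists_card_eq_opt hF
    -- The sampling parameters need `1 ≤ k` and `β * k < n`. An empty optimum is left to the first
    -- query, and for `n ≤ β * k` every set is good enough.
    rcases Nat.eq_zero_or_pos (opt F) with hk | hk
    · rw [hk] at hSk ⊢
      rw [Finset.card_eq_zero] at hSk
      refine (pr_algorithm_of_first (B := 0) j hw hf hfK hR (by norm_num)
        (pr_firstCandidate_empty j (hSk ▸ hS))).mono le_rfl fun _ h => ?_
      simpa using h
    rcases le_or_gt (n : ℝ) (β * opt F) with hn | hn
    · refine Pr.mono (hspec.pr) (by norm_num) fun m' _ => le_trans ?_ hn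
      have := Finset.card_le_univ (decode n (m' 0))
      rw [Fintype.card_fin] at this
      exact_mod_cast this
    · obtain ⟨s, ℓ, hg⟩ := hgood n (opt F) hk hn
      have hp0 := bias_nonneg n s
      have hn0 : (0 : ℝ) < n := by
        have := hg.one_le
        have := hg.add_le
        exact_mod_cast (by omega : 0 < n)
      have hp1 : bias n s ≤ 1 := by
        refine (bias_le n s).trans ?_
        rw [div_le_one hn0]
        have := hg.add_le
        exact_mod_cast (by omega : s ≤ n)
      have hprob := hg.le_prob (Nat.cast_nonneg M) hQ.le hd₀ S hSk
      have hle1 := card_almostSupersets_mul_le_one (s := s) (ℓ := ℓ) S hp0 hp1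
      set q := ((almostSupersets S s ℓ).card : ℝ) *
        (bias n s ^ s * (1 - bias n s) ^ (n - s)) with hq
      have hq0 : 0 ≤ q :=
        mul_nonneg (Nat.cast_nonneg _) (mul_nonneg (pow_nonneg hp0 _) (pow_nonneg (by linarith) _))
      refine pr_algorithm_of_round j hF hw hf hfK hR hS hg.one_le hg.add_le hg.ratio ?_
        (by rw [← hq]; linarith)
      rw [← hq, ← Nat.floor_div_eq_div (K := ℝ)]
      have hMℓ : (0 : ℝ) < (M : ℝ) ^ ℓ := by
        have : (0 : ℝ) < M := by exact_mod_cast hM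
        positivity
      have hbn : (0 : ℝ) < (b : ℝ) ^ n := by
        have : (0 : ℝ) < b := by exact_mod_cast hb
        positivity
      refine one_le_floor_mul (by linarith) (by linarith) ?_
      push_cast
      have h1 := mul_le_mul_of_nonneg_right (hK n) hq0
      rw [div_pow] at h1
      -- The `8` in `hK` is made up of a factor `2` from `le_prob`, one for the oracle's success
      -- probability and one for rounding the number of trials.
      have h2 : 4 * (M : ℝ) ^ ℓ ≤ K * (a ^ n / b ^ n) * q := by
        refine le_trans ?_ h1
        nlinarith
      have h3 : (K : ℝ) * a ^ n / (b ^ n * M ^ ℓ) * (q * (1 / 2)) =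
          K * (a ^ n / b ^ n) * q / (2 * M ^ ℓ) := by
        field_simp
      rw [h3, le_div_iff₀ (by positivity)]
      linarith
  have h := hpr 0
  rw [← toOuterMeasure_eq_expect, ← start_eq] at h
  refine le_trans (le_of_eq ?_) h
  rw [ENNReal.ofReal_div_of_pos (by norm_num)]
  simp

/-- The number of trials carries the factor `M ^ (-ℓ)`, which cancels the query price `c ^ ℓ ≤ M ^
ℓ`; the bound is therefore the same for all `ℓ`. -/
theorem roundCost_le {n W ℓ K a b M : ℕ} {c : ℝ} (hc : 0 ≤ c) (hb : 0 < b) (hM : 1 ≤ M)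
    (hcM : c ≤ M) :
    roundCost c n W ℓ (K * a ^ n / (b ^ n * M ^ ℓ)) ≤
      n * (K * ((a : ℝ) / b) ^ n * (1 + 17 * ((n : ℝ) + 1) ^ 2 * (3 * W + 1)) +
        6 * (3 * W + 1)) + 6 * (3 * W + 1) := by
  have hMℓ : (1 : ℝ) ≤ (M : ℝ) ^ ℓ := one_le_pow₀ (by exact_mod_cast hM)
  have hbn : (0 : ℝ) < (b : ℝ) ^ n := by
    have : (0 : ℝ) < b := by exact_mod_cast hb
    positivity
  have hN : ((K * a ^ n / (b ^ n * M ^ ℓ) : ℕ) : ℝ) ≤ K * ((a : ℝ) / b) ^ n / M ^ ℓ := by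
    refine Nat.cast_div_le.trans (le_of_eq ?_)
    rw [div_pow]
    push_cast
    field_simp
  have hcℓ : c ^ ℓ ≤ (M : ℝ) ^ ℓ := pow_le_pow_left₀ hc hcM ℓ
  have hn0 : (0 : ℝ) ≤ n := Nat.cast_nonneg n
  have hX0 : 0 ≤ K * ((a : ℝ) / b) ^ n := by positivity
  have hcost0 : 0 ≤ trialCost c n W ℓ + 2 * (3 * W + 1) := by
    unfold trialCost
    positivity
  unfold roundCost
  unfold trialCost at hcost0 ⊢
  generalize (K : ℝ) * ((a : ℝ) / b) ^ n = Y at *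
  generalize ((K * a ^ n / (b ^ n * M ^ ℓ) : ℕ) : ℝ) = N at *
  generalize (M : ℝ) ^ ℓ = m at *
  generalize c ^ ℓ = z at *
  have hu0 : (0 : ℝ) ≤ 3 * W + 1 := by positivity
  generalize (3 * (W : ℝ) + 1) = u at *
  generalize (n : ℝ) = x at *
  have hpoly : (5 * x ^ 2 + 17 * x + 13) * u + 2 * u ≤ 17 * (x + 1) ^ 2 * u := by
    have : 5 * x ^ 2 + 17 * x + 15 ≤ 17 * (x + 1) ^ 2 := by nlinarith
    nlinarith
  have hpos : 0 ≤ 17 * (x + 1) ^ 2 * u := by positivity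
  have hprod := mul_le_mul hN (show _ ≤ m * (1 + 17 * (x + 1) ^ 2 * u) by nlinarith) hcost0
    (by positivity)
  have hm : Y / m * (m * (1 + 17 * (x + 1) ^ 2 * u)) = Y * (1 + 17 * (x + 1) ^ 2 * u) := by
    field_simp
  rw [hm] at hprod
  gcongr

/-- The degree `5` comes from the rounds, the set sizes, the quadratic number of operations in a
trial, and the word length. -/
theorem algorithmCost_le {n x u D K X R : ℝ} (hn0 : 0 ≤ n) (hx : n + 1 = x) (hu0 : 0 ≤ u)
    (huD : u ≤ D * x) (hD : 0 ≤ D) (hK : 0 ≤ K) (hX : 1 ≤ X)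
    (hR : R = n * (K * X * (1 + 17 * x ^ 2 * u) + 6 * u) + 6 * u) :
    x * (R + u) + (4 * n + 13) * u + 1 ≤ X * ((K + 17 * K * D + 30 * D + 1) * x ^ 5) := by
  have hx1 : 1 ≤ x := by linarith
  have hnx : n ≤ x := by linarith
  have e1 : R ≤ x * (K * X * (1 + 17 * x ^ 2 * (D * x)) + 6 * (D * x)) + 6 * (D * x) := by
    rw [hR]
    gcongr
  have e2 : (4 * n + 13) * u ≤ 17 * x * (D * x) :=
    mul_le_mul (by linarith) huD hu0 (by linarith)
  have e3 : x * (R + u) + (4 * n + 13) * u + 1 ≤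
      x * ((x * (K * X * (1 + 17 * x ^ 2 * (D * x)) + 6 * (D * x)) + 6 * (D * x)) + D * x) +
        17 * x * (D * x) + 1 := by
    gcongr
  have h5 : x ^ 5 ≤ X * x ^ 5 := le_mul_of_one_le_left (by positivity) hX
  have p2 : x ^ 2 ≤ X * x ^ 5 := (pow_le_pow_right₀ hx1 (by norm_num)).trans h5
  have p3 : x ^ 3 ≤ X * x ^ 5 := (pow_le_pow_right₀ hx1 (by norm_num)).trans h5
  have p0 : 1 ≤ X * x ^ 5 := (one_le_pow₀ hx1).trans h5
  have p4 : X * x ^ 2 ≤ X * x ^ 5 :=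
    mul_le_mul_of_nonneg_left (pow_le_pow_right₀ hx1 (by norm_num)) (by linarith)
  calc _ ≤ _ := e3
    _ = K * (X * x ^ 2) + 17 * (K * D) * (X * x ^ 5) + 6 * D * x ^ 3 + 24 * D * x ^ 2 + 1 := by
        ring
    _ ≤ K * (X * x ^ 5) + 17 * (K * D) * (X * x ^ 5) + 6 * D * (X * x ^ 5) +
        24 * D * (X * x ^ 5) + X * x ^ 5 := by gcongr
    _ = _ := by ring

theorem hasCost_algorithm {L : Finset (ℝ × ℝ)} {K a b M : ℕ} (j : L) (hc : 0 ≤ j.1.2)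
    (hb : 0 < b) (hM : 1 ≤ M) (hcM : j.1.2 ≤ M) (hab : 1 ≤ (a : ℝ) / b) :
    ∃ C : ℕ, HasCost L (algorithm K a b M j)
      fun n => ((a : ℝ) / b) ^ n * (C * ((n : ℝ) + 1) ^ C) := by
  obtain ⟨D, hD⟩ : ∃ D : ℕ, D = 3 * (K + a + b + M + 2) + 1 := ⟨_, rfl⟩
  obtain ⟨C₀, hC₀⟩ : ∃ C₀ : ℕ, C₀ = K + 17 * K * D + 30 * D + 1 := ⟨_, rfl⟩
  refine ⟨C₀ + 5, ?_⟩
  suffices h : ∀ (n : ℕ) (F : Set (Finset (Fin n))), IsMonotone F →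
      ∀ O : (∀ j : L, ExtOracle F j.1.1), ∀ (fuel : ℕ) (s : Config),
      some s ∈ (exec O fuel (algorithm K a b M j) (start n)).support →
      s.cost ≤ ((a : ℝ) / b) ^ n * (C₀ * ((n : ℝ) + 1) ^ 5) by
    intro n m hmn F hF O fuel s hs
    refine (h m F hF O fuel s hs).trans ?_
    have h1 : (m : ℝ) ≤ n := by exact_mod_cast hmn
    have h2 : (1 : ℝ) ≤ (n : ℝ) + 1 := by linarith [(Nat.cast_nonneg n : (0 : ℝ) ≤ n)]
    have h3 : ((m : ℝ) + 1) ^ 5 ≤ ((n : ℝ) + 1) ^ (C₀ + 5) :=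
      (pow_le_pow_left₀ (by positivity) (by linarith) 5).trans
        (pow_le_pow_right₀ h2 (by omega))
    have h4 : (C₀ : ℝ) ≤ ((C₀ + 5 : ℕ) : ℝ) := by exact_mod_cast (by omega : C₀ ≤ C₀ + 5)
    exact mul_le_mul (pow_le_pow_right₀ hab hmn) (mul_le_mul h4 h3 (by positivity) (by positivity))
      (by positivity) (by positivity)
  intro n F hF O fuel₀ s hs
  have hw := wordSize n K a b M
  have hspec := fun fuel hf hfK => spec_algorithm (O := O) (fuel := fuel) j hw hf hfK
    (R := n * (K * ((a : ℝ) / b) ^ n * (1 + 17 * ((n : ℝ) + 1) ^ 2 *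
      (3 * ((K + a + b + M + 2) * (n + 1) : ℕ) + 1)) +
      6 * (3 * ((K + a + b + M + 2) * (n + 1) : ℕ) + 1)) +
      6 * (3 * ((K + a + b + M + 2) * (n + 1) : ℕ) + 1))
    fun ℓ _ => roundCost_le hc hb hM hcM
  -- The cost bound is required for every fuel: an outcome reached with little fuel is also reached
  -- with enough fuel, where the specification applies.
  obtain ⟨m', c', he, -, hcost⟩ := hspec (fuel₀ + (n + 2 + K * a ^ n)) (by omega)
    (by omega) 0 (some s) (by
      rw [← start_eq]
      exact exec_support_mono O (by omega) _ hs)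
  obtain rfl := Option.some.inj he
  rw [zero_add] at hcost
  refine hcost.trans ((algorithmCost_le (D := D) (K := K) (Nat.cast_nonneg n) rfl (by positivity)
    ?_ (Nat.cast_nonneg D) (Nat.cast_nonneg K) (one_le_pow₀ hab) rfl).trans (le_of_eq ?_))
  · rw [hD]
    push_cast
    have := Nat.cast_nonneg (α := ℝ) n
    linarith
  · rw [hC₀]
    push_cast
    ring

/-- Every specification list allows to improve on the brute force. -/
theorem best_lt_brute {β : ℝ} {L : Finset (ℝ × ℝ)} (hβ : 1 < β) (hL : IsSpecList L) :
    best L β < (brute β : EReal) := by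
  obtain ⟨⟨p, hp⟩, hL⟩ := hL
  obtain ⟨hα, hc⟩ := hL p hp
  set M := ⌈p.2⌉₊ with hM
  have hcM : p.2 ≤ M := Nat.le_ceil p.2
  have hM1 : 1 ≤ M := by
    have : (1 : ℝ) ≤ M := hc.trans hcM
    exact_mod_cast this
  obtain ⟨Q, d₀, hQ, hd₀, hd₀', hgood⟩ := exists_goodParams (M := (M : ℝ)) hα hβ
    (by exact_mod_cast hM1)
  -- A rational base lets the machine compute the numbers of trials exactly, and the gap between
  -- `d₀` and `r` absorbs the polynomial factors.
  obtain ⟨r, hr1, hr2⟩ := exists_rat_btwn hd₀'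
  have hr0 : 0 < r := by
    have : (0 : ℝ) < r := by linarith
    exact_mod_cast this
  have hr : ((r.num.natAbs : ℕ) : ℝ) / (r.den : ℕ) = r := by
    have h1 : ((r.num.natAbs : ℕ) : ℤ) = r.num := Int.natAbs_of_nonneg (Rat.num_nonneg.2 hr0.le)
    have h2 : ((r.num.natAbs : ℕ) : ℝ) = ((r.num : ℤ) : ℝ) := by
      rw [← h1]; simp
    rw [h2, ← Rat.cast_def]
  obtain ⟨K, hK⟩ := exists_nat_mul_pow_le (by linarith) hr1 (8 * Q) (by positivity)
  have hden : 0 < r.den := r.den_pos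
  have hA := isApprox_algorithm (K := K) (a := r.num.natAbs) (b := r.den) (M := M) (⟨p, hp⟩ : L)
    hden hM1 hQ (by linarith) hgood (by rw [hr]; exact hK)
  obtain ⟨C, hC⟩ := hasCost_algorithm (K := K) (a := r.num.natAbs) (b := r.den) (M := M)
    (⟨p, hp⟩ : L) (by simp only; linarith) hden hM1 hcM (by rw [hr]; linarith)
  rw [hr] at hC
  have h : best L β ≤ ((r : ℝ) : EReal) := sInf_le ⟨(r : ℝ), ⟨by linarith, _, hA, C, hC⟩, rfl⟩
  exact h.trans_lt (EReal.coe_lt_coe_iff.2 hr2)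

end SubsetMin
end

theorem theorem2p15 :
    (∀ (β : ℝ) (L : Finset (ℝ × ℝ)), 1 < β → SubsetMin.IsSpecList L →
      SubsetMin.best L β < ((SubsetMin.brute β : ℝ) : EReal)) ∧
    (∀ α β : ℝ, 1 ≤ α → 1 < β →
      Tendsto (fun c : ℝ => SubsetMin.best {(α, c)} β) atTop
        (𝓝 ((SubsetMin.brute β : ℝ) : EReal))) := by
  refine ⟨fun β L hβ hL => SubsetMin.best_lt_brute hβ hL, fun α β hα hβ => ?_⟩
  refine SubsetMin.tendsto_best_of_lt hα hβ fun c hc => SubsetMin.best_lt_brute hβ ?_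
  refine ⟨Finset.singleton_nonempty _, fun p hp => ?_⟩
  rw [Finset.mem_singleton.1 hp]
  exact ⟨hα, hc⟩
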